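/- Let $p$ be a prime, $0<\rho<1$, $c\in\mathbb R$, let $M=\begin{bmatrix}\rho^{-1}&c\\0&\rho^{-1}\end{bmatrix}$, and let $D\subset\mathbb Z^2$ be a set of exactly $p$ elements. Let $\mu_{M,D}$ be the self-affine measure of $(M,D)$, that is, the unique Borel probability measure on $\mathbb R^2$ with $$\mu_{M,D}=\frac1p\sum_{d\in D}\mu_{M,D}\circ\varphi_d^{-1},\qquad \varphi_d(x)=M^{-1}(x+d).$$ Put $\delta_D=\frac1p\sum_{d\in D}\delta_d$ and suppose that the zero set of its Fourier transform $\widehat{\delta_D}(\xi)=\frac1p\sum_{d\in D}e^{-2\pi i\langle\xi,d\rangle}$ is $$\{\xi\in\mathbb R^2:\widehat{\delta_D}(\xi)=0\}=\bigcup_{j=1}^{p-1}\Big(\frac{j\,\mathbf a}{p}+\mathbb Z^2\Big)$$ for some $\mathbf a=(a_1,a_2)$ with integers $1\le a_1,a_2\le p-1$. Call a probability measure $\mu$ on $\mathbb R^2$ spectral if there is a countable set $\Lambda\subset\mathbb R^2$ such that the exponentials $e^{-2\pi i\langle\lambda,x\rangle}$, $\lambda\in\Lambda$, form an orthonormal basis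 of $L^2(\mu)$. **Theorem 1.5.** The measure $\mu_{M,D}$ is spectral if and only if $$\rho^{-1}\in p\mathbb Z\quad\text{and}\quad c\in\Big\{\frac ts: s,t\in\mathbb Z,\ s\neq0,\ t\in p\mathbb Z,\ \gcd(t,s)=1\Big\}\cup\{0\}.$$ Consequently, spectrality does not force $p\kappa\in\mathbb Z$ when $c=\kappa\rho^{-1}$: for $p=3$, $M=\begin{bmatrix}6&3/4\\0&6\end{bmatrix}$ and $D=\{(0,0),(1,0),(0,1)\}$, the zero set hypothesis holds with $\mathbf a=(1,2)$ and $\mu_{M,D}$ is spectral, while $c=\frac34=\kappa\cdot 6$ with $\kappa=\frac18$ and $3\kappa\notin\mathbb Z$. (This is the counterexample to a conjecture of Chen, Wang and Zhang.) -/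

import Mathlib

open MeasureTheory Filter Topology
open scoped ENNReal Matrix

/-- The plane `ℝ²`. Only its topology, its Borel sets and the dot product `⬝ᵥ` are used below. -/
abbrev Plane : Type := Fin 2 → ℝ

/-- An integer digit, regarded as a point of the plane. -/
def digitVec (d : Fin 2 → ℤ) : Plane := fun i => (d i : ℝ)

/-- The matrix `[[ρ₁⁻¹, c], [0, ρ₂⁻¹]]`. -/
noncomputable def triMatrix (ρ₁ ρ₂ c : ℝ) : Matrix (Fin 2) (Fin 2) ℝ :=
  !![ρ₁⁻¹, c; 0, ρ₂⁻¹]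

/-- The map `φ_d(x) = M⁻¹(x + d)` of the iterated function system. -/
noncomputable def ifsMap (M : Matrix (Fin 2) (Fin 2) ℝ) (d : Fin 2 → ℤ) (x : Plane) : Plane :=
  M⁻¹ *ᵥ (x + digitVec d)

/-- `μ` is a Borel probability measure with `μ = (1/#D) ∑_{d ∈ D} μ ∘ φ_d⁻¹`. -/
structure IsSelfAffineMeasure (M : Matrix (Fin 2) (Fin 2) ℝ) (D : Finset (Fin 2 → ℤ))
    (μ : Measure Plane) : Prop where
  isProb : IsProbabilityMeasure μ
  selfAffine : μ = (D.card : ℝ≥0∞)⁻¹ • ∑ d ∈ D, μ.map (ifsMap M d)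

/-- The uniform distribution on the digits. -/
noncomputable def digitLaw (D : Finset (Fin 2 → ℤ)) : Measure D :=
  (D.card : ℝ≥0∞)⁻¹ • Measure.count

/-- The point `∑_{k ≥ 1} M^{-k} d_k` of the self-affine set addressed by a sequence of digits
(indexed from `0` here). -/
noncomputable def codingMap (M : Matrix (Fin 2) (Fin 2) ℝ) (D : Finset (Fin 2 → ℤ))
    (ω : ℕ → D) : Plane :=
  ∑' k : ℕ, (M⁻¹ ^ (k + 1)) *ᵥ digitVec (ω k).1

/-- The self-affine measure `μ_{M,D}`: the law of `∑_{k ≥ 1} M^{-k} d_k` for independent digits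
`d_k` distributed uniformly on `D`, that is `δ_{M⁻¹D} * δ_{M⁻²D} * ⋯`. By
`isSelfAffineMeasure_iff` below it is the unique probability measure with
`μ = (1/#D) ∑_{d ∈ D} μ ∘ φ_d⁻¹`. -/
noncomputable def selfAffineMeasure (M : Matrix (Fin 2) (Fin 2) ℝ) (D : Finset (Fin 2 → ℤ)) :
    Measure Plane :=
  (Measure.infinitePi fun _ : ℕ => digitLaw D).map (codingMap M D)

/-- The exponential `x ↦ e^{-2πi⟨l, x⟩}`. -/
noncomputable def expFun (l : Plane) (x : Plane) : ℂ :=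
  Complex.exp (-2 * Real.pi * Complex.I * ((l ⬝ᵥ x : ℝ) : ℂ))

/-- `μ` is a spectral measure: for some countable `Λ ⊂ ℝ²` the exponentials `e^{-2πi⟨l, x⟩}`,
`l ∈ Λ`, form an orthonormal basis of `L²(μ)`. -/
def IsSpectralMeasure (μ : Measure Plane) : Prop :=
  ∃ Λ : Set Plane, Λ.Countable ∧
    ∃ b : HilbertBasis Λ ℂ (Lp ℂ 2 μ), ∀ l : Λ, (b l : Plane → ℂ) =ᵐ[μ] expFun l

/-- The Fourier transform `ξ ↦ ∫ e^{-2πi⟨ξ, x⟩} dμ(x)` of a finite measure. -/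
noncomputable def measureFourier (μ : Measure Plane) (ξ : Plane) : ℂ :=
  ∫ x, expFun ξ x ∂μ

/-- `δ_D = (1/#D) ∑_{d ∈ D} δ_d`. -/
noncomputable def digitMeasure (D : Finset (Fin 2 → ℤ)) : Measure Plane :=
  (D.card : ℝ≥0∞)⁻¹ • ∑ d ∈ D, Measure.dirac (digitVec d)

/-- The set of zeros of a function. -/
def zeroSet (f : Plane → ℂ) : Set Plane := {ξ | f ξ = 0}

/-- The set `⋃_{j=1}^{p-1} (j a / p + ℤ²)`. -/
def latticeCosets (p : ℕ) (a : Fin 2 → ℤ) : Set Plane :=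
  ⋃ j ∈ Finset.Icc 1 (p - 1),
    {ξ | ∃ k : Fin 2 → ℤ, ∀ i, ξ i = (j : ℝ) * (a i : ℝ) / (p : ℝ) + (k i : ℝ)}

/-- The numbers `t / s` with `t ∈ pℤ` and `gcd(t, s) = 1`, together with `0`. -/
def admissibleEntries (p : ℕ) : Set ℝ :=
  {x | ∃ t s : ℤ, s ≠ 0 ∧ (p : ℤ) ∣ t ∧ Int.gcd t s = 1 ∧ x = (t : ℝ) / (s : ℝ)} ∪ {0}

/-! ### The self-affine measure is characterised by its defining equation -/

section SelfAffine

variable {M : Matrix (Fin 2) (Fin 2) ℝ} {D : Finset (Fin 2 → ℤ)}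

/-- Prepend a digit to a sequence of digits. -/
def consDigit (d : D) (ω : ℕ → D) : ℕ → D := fun n => Nat.casesOn n d ω

lemma measurable_consDigit (d : D) : Measurable (consDigit d) := by
  refine measurable_pi_lambda _ fun n => ?_
  cases n with
  | zero => exact measurable_const
  | succ n => exact measurable_pi_apply n

lemma isProbabilityMeasure_digitLaw (hD : D.Nonempty) : IsProbabilityMeasure (digitLaw D) := by
  constructor
  have h : (D.card : ℝ≥0∞) ≠ 0 := by simpa using hD.ne_empty
  simp only [digitLaw, Measure.smul_apply, smul_eq_mul, Measure.count_univ]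
  rw [ENat.card_eq_coe_fintype_card, Fintype.card_coe]
  exact ENNReal.inv_mul_cancel h (by simp)

lemma infinitePi_cons (hD : D.Nonempty) :
    (Measure.infinitePi fun _ : ℕ => digitLaw D) = (D.card : ℝ≥0∞)⁻¹ • ∑ d : D,
      (Measure.infinitePi fun _ : ℕ => digitLaw D).map (consDigit d) := by
  classical
  have := isProbabilityMeasure_digitLaw hD
  refine (Measure.eq_infinitePi _ fun s t ht => ?_).symm
  set s' : Finset ℕ := s.preimage Nat.succ Nat.succ_injective.injOn with hs'
  have hpre : ∀ d : D, consDigit d ⁻¹' (Set.pi (s : Set ℕ) t) =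
      if 0 ∈ s → d ∈ t 0 then Set.pi (s' : Set ℕ) (fun k => t (k + 1)) else ∅ := by
    intro d
    ext ω
    by_cases h : 0 ∈ s → d ∈ t 0
    · rw [if_pos h]
      constructor
      · intro hω k hk
        have := hω (k + 1) (by simpa [hs'] using hk)
        exact this
      · intro hω k hk
        cases k with
        | zero => exact h hk
        | succ k => exact hω k (by simpa [hs'] using hk)
    · rw [if_neg h]
      push Not at h
      simp only [Set.mem_empty_iff_false, iff_false]
      intro hω
      exact h.2 (hω 0 h.1)
  have hmap : ∀ d : D, (Measure.infinitePi fun _ : ℕ => digitLaw D).map (consDigit d)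
      (Set.pi (s : Set ℕ) t) =
        (if 0 ∈ s → d ∈ t 0 then 1 else 0) * ∏ k ∈ s', digitLaw D (t (k + 1)) := by
    intro d
    rw [Measure.map_apply (measurable_consDigit d)
      (MeasurableSet.pi s.countable_toSet fun i _ => ht i), hpre d]
    split_ifs with h
    · rw [Measure.infinitePi_pi _ (fun i _ => ht (i + 1)), one_mul]
    · simp
  rw [Measure.smul_apply, Measure.finsetSum_apply]
  simp only [hmap, smul_eq_mul]
  rw [← Finset.sum_mul, ← mul_assoc]
  have hone : (D.card : ℝ≥0∞)⁻¹ * ∑ d : D, (if 0 ∈ s → d ∈ t 0 then (1 : ℝ≥0∞) else 0)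
      = if 0 ∈ s then digitLaw D (t 0) else 1 := by
    split_ifs with h0
    · simp only [digitLaw, Measure.smul_apply, smul_eq_mul, h0, true_imp_iff]
      congr 1
      rw [Measure.count, Measure.sum_apply _ (ht 0), tsum_fintype]
      refine Finset.sum_congr rfl fun d _ => ?_
      rw [Measure.dirac_apply' _ (ht 0), Set.indicator_apply, Pi.one_apply]
    · simp only [h0, false_imp_iff, if_true, Finset.sum_const, Finset.card_univ,
        Fintype.card_coe, nsmul_eq_mul, mul_one]
      exact ENNReal.inv_mul_cancel (by simpa using hD.ne_empty) (by simp)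
  rw [hone]
  by_cases h0 : 0 ∈ s
  · have hs : s = insert 0 (s'.image Nat.succ) := by
      ext k
      cases k with
      | zero => simp [h0]
      | succ k => simp [hs']
    rw [if_pos h0]
    conv_rhs => rw [hs]
    rw [Finset.prod_insert (by simp), Finset.prod_image (by simp)]
  · have hs : s = s'.image Nat.succ := by
      ext k
      cases k with
      | zero => simp [h0]
      | succ k => simp [hs']
    rw [if_neg h0, one_mul]
    conv_rhs => rw [hs]
    rw [Finset.prod_image (by simp)]

lemma summable_coding (hM : ∀ i j, Summable fun k : ℕ => (M⁻¹ ^ k) i j) (ω : ℕ → D) :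
    Summable fun k : ℕ => (M⁻¹ ^ (k + 1)) *ᵥ digitVec (ω k).1 := by
  rw [Pi.summable]
  intro i
  simp only [Matrix.mulVec, dotProduct]
  refine summable_sum fun j _ => ?_
  obtain ⟨B, hB⟩ : ∃ B : ℝ, ∀ d : D, |digitVec d.1 j| ≤ B := by
    obtain ⟨B, hB⟩ := (Set.finite_range fun d : D => |digitVec d.1 j|).bddAbove
    exact ⟨B, fun d => hB ⟨d, rfl⟩⟩
  have hs : Summable fun k : ℕ => |(M⁻¹ ^ (k + 1)) i j| * B :=
    ((summable_nat_add_iff 1).2 (hM i j)).abs.mul_right B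
  refine Summable.of_norm_bounded hs fun k => ?_
  rw [Real.norm_eq_abs, abs_mul]
  exact mul_le_mul_of_nonneg_left (hB _) (abs_nonneg _)

lemma measurable_codingMap (hM : ∀ i j, Summable fun k : ℕ => (M⁻¹ ^ k) i j) :
    Measurable (codingMap M D) := by
  refine measurable_of_tendsto_metrizable (f := fun n (ω : ℕ → D) =>
    ∑ k ∈ Finset.range n, (M⁻¹ ^ (k + 1)) *ᵥ digitVec (ω k).1) (fun n => ?_) ?_
  · refine Finset.measurable_sum _ fun k _ => ?_
    exact (measurable_of_countable
      (fun d : D => (M⁻¹ ^ (k + 1)) *ᵥ digitVec d.1)).comp (measurable_pi_apply k)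
  · rw [tendsto_pi_nhds]
    intro ω
    exact (summable_coding hM ω).hasSum.tendsto_sum_nat

lemma codingMap_cons (hM : ∀ i j, Summable fun k : ℕ => (M⁻¹ ^ k) i j) (d : D) (ω : ℕ → D) :
    codingMap M D (consDigit d ω) = ifsMap M d.1 (codingMap M D ω) := by
  have hc : Continuous fun x : Plane => M⁻¹ *ᵥ x := continuous_const.matrix_mulVec continuous_id
  have h1 : M⁻¹ *ᵥ codingMap M D ω = ∑' k : ℕ, (M⁻¹ ^ (k + 1 + 1)) *ᵥ digitVec (ω k).1 := by
    have := (summable_coding hM ω).hasSum.map (Matrix.mulVecLin M⁻¹).toAddMonoidHom hc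
    refine this.tsum_eq.symm.trans (tsum_congr fun k => ?_)
    change M⁻¹ *ᵥ (M⁻¹ ^ (k + 1) *ᵥ digitVec (ω k).1) = M⁻¹ ^ (k + 1 + 1) *ᵥ digitVec (ω k).1
    rw [Matrix.mulVec_mulVec, ← pow_succ']
  rw [ifsMap, Matrix.mulVec_add, h1, codingMap, (summable_coding hM _).tsum_eq_zero_add]
  simp [consDigit, add_comm]

lemma measurable_ifsMap (d : Fin 2 → ℤ) : Measurable (ifsMap M d) := by
  refine Continuous.measurable ?_
  exact continuous_const.matrix_mulVec (continuous_id.add continuous_const)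

lemma isSelfAffineMeasure_selfAffineMeasure
    (hM : ∀ i j, Summable fun k : ℕ => (M⁻¹ ^ k) i j) (hD : D.Nonempty) :
    IsSelfAffineMeasure M D (selfAffineMeasure M D) := by
  have := isProbabilityMeasure_digitLaw hD
  have hF := measurable_codingMap (D := D) hM
  refine ⟨Measure.isProbabilityMeasure_map hF.aemeasurable, ?_⟩
  conv_lhs => rw [selfAffineMeasure, infinitePi_cons hD]
  rw [Measure.map_smul, Measure.map_finset_sum hF.aemeasurable, ← Finset.sum_coe_sort D]
  congr 1
  refine Finset.sum_congr rfl fun d _ => ?_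
  rw [selfAffineMeasure, Measure.map_map hF (measurable_consDigit d),
    Measure.map_map (measurable_ifsMap _) hF]
  congr 1
  funext ω
  exact codingMap_cons hM d ω

lemma charFunDual_selfAffine {μ : Measure Plane} (h : IsSelfAffineMeasure M D μ)
    (L : StrongDual ℝ Plane) :
    charFunDual μ L = (D.card : ℂ)⁻¹ * ∑ d ∈ D,
      charFunDual μ (L.comp (Matrix.mulVecLin M⁻¹).toContinuousLinearMap) *
        Complex.exp (L (M⁻¹ *ᵥ digitVec d) * Complex.I) := by
  have := h.isProb
  have hint : ∀ d ∈ D, Integrable (fun x : Plane => Complex.exp (L x * Complex.I))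
      (μ.map (ifsMap M d)) := by
    intro d _
    have := Measure.isProbabilityMeasure_map (μ := μ) (measurable_ifsMap (M := M) d).aemeasurable
    refine Integrable.of_bound (C := 1) (by fun_prop) (Eventually.of_forall fun x => ?_)
    rw [Complex.norm_exp_ofReal_mul_I]
  rw [charFunDual_apply]
  conv_lhs => rw [h.selfAffine]
  rw [integral_smul_measure, integral_finsetSum_measure hint, Complex.real_smul]
  congr 1
  · simp
  · refine Finset.sum_congr rfl fun d _ => ?_
    rw [integral_map (measurable_ifsMap d).aemeasurable (by fun_prop), charFunDual_apply,
      ← integral_mul_const]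
    refine integral_congr_ae (Eventually.of_forall fun x => ?_)
    change Complex.exp (L (M⁻¹ *ᵥ (x + digitVec d)) * Complex.I) =
      Complex.exp (L (M⁻¹ *ᵥ x) * Complex.I) * _
    rw [Matrix.mulVec_add, map_add, Complex.ofReal_add, add_mul, Complex.exp_add]

/-- Uniqueness in the defining equation. -/
lemma IsSelfAffineMeasure.unique (hM : ∀ i j, Summable fun k : ℕ => (M⁻¹ ^ k) i j)
    {μ ν : Measure Plane} (hμ : IsSelfAffineMeasure M D μ) (hν : IsSelfAffineMeasure M D ν) :
    μ = ν := by
  have := hμ.isProb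
  have := hν.isProb
  set A : Plane →L[ℝ] Plane := (Matrix.mulVecLin M⁻¹).toContinuousLinearMap with hA
  have hstep : ∀ L : StrongDual ℝ Plane, ‖charFunDual μ L - charFunDual ν L‖ ≤
      ‖charFunDual μ (L.comp A) - charFunDual ν (L.comp A)‖ := by
    intro L
    rw [charFunDual_selfAffine hμ L, charFunDual_selfAffine hν L, ← mul_sub,
      ← Finset.sum_sub_distrib, norm_mul, norm_inv, Complex.norm_natCast]
    rcases D.eq_empty_or_nonempty with rfl | hD
    · simp
    have hc : (0 : ℝ) < D.card := by exact_mod_cast hD.card_pos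
    rw [inv_mul_le_iff₀ hc, ← nsmul_eq_mul]
    refine (norm_sum_le _ _).trans (Finset.sum_le_card_nsmul _ _ _ fun d _ => ?_)
    rw [← sub_mul, norm_mul, Complex.norm_exp_ofReal_mul_I, mul_one]
  have hpow : ∀ (n : ℕ) (L : StrongDual ℝ Plane), ‖charFunDual μ L - charFunDual ν L‖ ≤
      ‖charFunDual μ (L.comp (A ^ n)) - charFunDual ν (L.comp (A ^ n))‖ := by
    intro n
    induction n with
    | zero => intro L; exact le_of_eq rfl
    | succ n ih =>
      intro L
      refine (ih L).trans ((hstep _).trans (le_of_eq ?_))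
      rw [ContinuousLinearMap.comp_assoc]
      rfl
  have happly : ∀ (n : ℕ) (x : Plane), (A ^ n) x = (M⁻¹ ^ n) *ᵥ x := by
    intro n
    induction n with
    | zero => intro x; simp
    | succ n ih =>
      intro x
      rw [pow_succ, pow_succ, ← Matrix.mulVec_mulVec, ← ih]
      rfl
  have hlim : ∀ x : Plane, Tendsto (fun n : ℕ => (A ^ n) x) atTop (𝓝 0) := by
    intro x
    rw [tendsto_pi_nhds]
    intro i
    simp only [happly, Matrix.mulVec, dotProduct, Pi.zero_apply]
    have : Tendsto (fun n : ℕ => ∑ j, (M⁻¹ ^ n) i j * x j) atTop (𝓝 (∑ j : Fin 2, 0 * x j)) :=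
      tendsto_finsetSum _ fun j _ => (hM i j).tendsto_atTop_zero.mul_const _
    simpa using this
  have hchar : ∀ (κ : Measure Plane) [IsProbabilityMeasure κ] (L : StrongDual ℝ Plane),
      Tendsto (fun n : ℕ => charFunDual κ (L.comp (A ^ n))) atTop (𝓝 1) := by
    intro κ _ L
    simp only [charFunDual_apply]
    have : (1 : ℂ) = ∫ _ : Plane, (1 : ℂ) ∂κ := by simp
    rw [this]
    refine tendsto_integral_of_dominated_convergence (fun _ => 1) (fun n => by fun_prop)
      (integrable_const _) (fun n => Eventually.of_forall fun x => ?_)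
      (Eventually.of_forall fun x => ?_)
    · rw [Complex.norm_exp_ofReal_mul_I]
    · have h1 : Tendsto (fun n : ℕ => L ((A ^ n) x)) atTop (𝓝 (L 0)) :=
        (L.continuous.tendsto 0).comp (hlim x)
      have h2 : Continuous fun r : ℝ => Complex.exp (r * Complex.I) := by fun_prop
      have h3 := (h2.tendsto (L 0)).comp h1
      simpa [Function.comp_def] using h3
  refine Measure.ext_of_charFunDual (funext fun L => ?_)
  have hz : Tendsto (fun n : ℕ => ‖charFunDual μ (L.comp (A ^ n)) -
      charFunDual ν (L.comp (A ^ n))‖) atTop (𝓝 0) := by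
    simpa using ((hchar μ L).sub (hchar ν L)).norm
  have h0 := ge_of_tendsto' hz fun n => hpow n L
  exact sub_eq_zero.1 (norm_le_zero_iff.1 h0)

/-- If the powers of `M⁻¹` are summable, as they are for an expanding matrix, then
`selfAffineMeasure M D` is the one and only probability measure solving the defining equation. -/
theorem isSelfAffineMeasure_iff (hM : ∀ i j, Summable fun k : ℕ => (M⁻¹ ^ k) i j)
    (hD : D.Nonempty) (μ : Measure Plane) :
    IsSelfAffineMeasure M D μ ↔ μ = selfAffineMeasure M D := by
  constructor
  · intro h
    exact h.unique hM (isSelfAffineMeasure_selfAffineMeasure hM hD)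
  · rintro rfl
    exact isSelfAffineMeasure_selfAffineMeasure hM hD

end SelfAffine

lemma triMatrix_inv_pow {ρ : ℝ} (hρ : ρ ≠ 0) (c : ℝ) (k : ℕ) :
    (triMatrix ρ ρ c)⁻¹ ^ k = !![ρ ^ k, -(k * ρ ^ k * (c * ρ)); 0, ρ ^ k] := by
  have hinv : (triMatrix ρ ρ c)⁻¹ = !![ρ, -(c * ρ ^ 2); 0, ρ] := by
    refine Matrix.inv_eq_right_inv ?_
    ext i j
    fin_cases i <;> fin_cases j <;> simp [triMatrix, hρ]; field_simp; ring
  rw [hinv]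
  induction k with
  | zero => ext i j; fin_cases i <;> fin_cases j <;> simp
  | succ k ih =>
    rw [pow_succ, ih]
    ext i j
    fin_cases i <;> fin_cases j <;> simp [Matrix.mul_apply, Fin.sum_univ_two] <;> ring

lemma summable_triMatrix {ρ : ℝ} (h0 : 0 < ρ) (h1 : ρ < 1) (c : ℝ) (i j : Fin 2) :
    Summable fun k : ℕ => ((triMatrix ρ ρ c)⁻¹ ^ k) i j := by
  have hg : Summable fun k : ℕ => ρ ^ k := summable_geometric_of_lt_one h0.le h1
  have hk : Summable fun k : ℕ => -((k : ℝ) * ρ ^ k * (c * ρ)) := by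
    have := summable_pow_mul_geometric_of_norm_lt_one 1 (r := ρ)
      (by rwa [Real.norm_eq_abs, abs_of_pos h0])
    simpa using (this.mul_right (c * ρ)).neg
  simp only [triMatrix_inv_pow h0.ne']
  fin_cases i <;> fin_cases j <;> simp [hg, hk, summable_zero]

/-! ### Exponentials and Fourier transforms -/

/-! Write r = ρ⁻¹, A for the transpose of M (so `shear r c k` is A^k), m for the mask of D and F for
the transform of the self-affine measure. Since F(ξ) = ∏_{k ≥ 1} m(A^{-k} ξ), every zero ξ of F has
a level, that is, some k ≥ 1 with m(A^{-k} ξ) = 0. By the criterion of Jorgensen and Pedersen, Λ is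
a spectrum exactly when ∑_{l ∈ Λ} |F(ξ - l)|² = 1 for all ξ.

Sufficiency. For c = t/s the lattice Γ = sℤ × ℤ is A-invariant and consists of periods of m. Because
p divides both r and t, there are p points of Γ forming a Parseval set for the first factor.
Concatenating copies of it dilated by powers of A gives Parseval sets for all finite products, and
corrections from dilates of Γ are harmless. F(ξ) and F(ξ - (0,1)) never vanish together, so the
corrections can keep the tail of the product bounded below on the chosen points, and dominated
convergence passes the identity to F (`isSpectralMeasure_of_block`).

Necessity. Each level K is the only level of some difference in a spectrum: otherwise the K-th
factor could be removed and Bessel's inequality for the remaining transform would contradict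
completeness (`exists_difference_of_level`). The dilated first coordinates of Λ thus form an
infinite set whose differences are r^k z with p ∤ z. Reduction modulo p shows that r satisfies no
integer polynomial with extreme coefficients prime to p; from this a power of r is rational, and its
p-adic valuation must be positive (`HasPowerDifferences.exists_pow_eq_ratCast`). Exponents then
behave ultrametrically, a difference of level L ≥ 2 is a sum of two differences of level 1, and
comparing the two forms gives r = u/v with p ∣ u, the condition on c, and a lower bound for
differences of level k in terms of u^k.

It remains to exclude v ≥ 2. In that case an orbit under division by u/v cannot stay near the
integers, so F decays like a power of a logarithm (`norm_affineFourier_le_pow`). The lower bound on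
differences makes far points of Λ contribute little, and mass missing from a large ball is never
recovered, because the relative gains are summable (`not_hasSum_of_rounds`). This contradicts
completeness. -/

lemma expFun_eq_exp_mul_I (l x : Plane) :
    expFun l x = Complex.exp (((-2 * Real.pi * (l ⬝ᵥ x) : ℝ) : ℂ) * Complex.I) := by
  rw [expFun]
  congr 1
  push_cast
  ring

@[simp] lemma norm_expFun (l x : Plane) : ‖expFun l x‖ = 1 := by
  rw [expFun_eq_exp_mul_I, Complex.norm_exp_ofReal_mul_I]

lemma expFun_add_left (l l' x : Plane) : expFun (l + l') x = expFun l x * expFun l' x := by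
  simp only [expFun, ← Complex.exp_add, add_dotProduct]
  congr 1
  push_cast
  ring

lemma conj_expFun (l x : Plane) : (starRingEnd ℂ) (expFun l x) = expFun (-l) x := by
  simp only [expFun_eq_exp_mul_I, ← Complex.exp_conj, map_mul, Complex.conj_ofReal, Complex.conj_I,
    neg_dotProduct]
  congr 1
  push_cast
  ring

@[simp] lemma expFun_zero_left (x : Plane) : expFun 0 x = 1 := by simp [expFun]

lemma continuous_expFun (l : Plane) : Continuous (expFun l) := by
  unfold expFun
  have : Continuous fun x : Plane => l ⬝ᵥ x := continuous_const.dotProduct continuous_id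
  fun_prop

lemma continuous_expFun_left (x : Plane) : Continuous fun l => expFun l x := by
  unfold expFun
  have : Continuous fun l : Plane => l ⬝ᵥ x := continuous_id.dotProduct continuous_const
  fun_prop

lemma integrable_expFun (μ : Measure Plane) [IsFiniteMeasure μ] (l : Plane) :
    Integrable (expFun l) μ :=
  Integrable.of_bound (C := 1) (continuous_expFun l).aestronglyMeasurable
    (Eventually.of_forall fun x => by simp)

section FourierBasic

variable (μ ν : Measure Plane)

lemma measureFourier_zero [IsProbabilityMeasure μ] : measureFourier μ 0 = 1 := by
  simp [measureFourier]

lemma norm_measureFourier_le_one [IsProbabilityMeasure μ] (ξ : Plane) :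
    ‖measureFourier μ ξ‖ ≤ 1 := by
  refine (norm_integral_le_integral_norm _).trans ?_
  simp

lemma continuous_measureFourier [IsProbabilityMeasure μ] : Continuous (measureFourier μ) := by
  unfold measureFourier
  refine continuous_of_dominated (bound := fun _ => 1)
    (fun ξ => (continuous_expFun ξ).aestronglyMeasurable)
    (fun ξ => Eventually.of_forall fun x => by simp) (integrable_const _)
    (Eventually.of_forall fun x => continuous_expFun_left x)

lemma exists_dual_apply_eq_dotProduct (L : StrongDual ℝ Plane) :
    ∃ ξ : Plane, ∀ x, L x = ξ ⬝ᵥ x := by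
  refine ⟨fun i => L (Pi.single i 1), fun x => ?_⟩
  conv_lhs => rw [← Finset.univ_sum_single x]
  rw [map_sum, dotProduct]
  refine Finset.sum_congr rfl fun i _ => ?_
  have : (Pi.single i (x i) : Plane) = x i • Pi.single i 1 := by
    rw [← Pi.single_smul, smul_eq_mul, mul_one]
  rw [this, map_smul, smul_eq_mul, mul_comm]

lemma exists_exp_dual_eq_expFun (L : StrongDual ℝ Plane) :
    ∃ ξ : Plane, ∀ x, Complex.exp (L x * Complex.I) = expFun ξ x := by
  obtain ⟨ξ, hξ⟩ := exists_dual_apply_eq_dotProduct L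
  refine ⟨(-(2 * Real.pi)⁻¹) • ξ, fun x => ?_⟩
  rw [expFun_eq_exp_mul_I, hξ, smul_dotProduct, smul_eq_mul]
  congr 3
  have := Real.pi_pos.ne'
  field_simp

lemma exists_dual_expFun_eq (ξ : Plane) :
    ∃ L : StrongDual ℝ Plane, ∀ x, expFun ξ x = Complex.exp (L x * Complex.I) := by
  refine ⟨LinearMap.toContinuousLinearMap (dotProductBilin ℝ ℝ ((-2 * Real.pi) • ξ)), fun x => ?_⟩
  rw [expFun_eq_exp_mul_I]
  congr 3
  simp [dotProductBilin]
  ring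

lemma measureFourier_conv [IsProbabilityMeasure μ] [IsProbabilityMeasure ν] (ξ : Plane) :
    measureFourier (μ ∗ ν) ξ = measureFourier μ ξ * measureFourier ν ξ := by
  obtain ⟨L, hL⟩ := exists_dual_expFun_eq ξ
  have := charFunDual_conv (μ := μ) (ν := ν) L
  simp only [charFunDual_apply, ← hL] at this
  exact this

/-- The densities g⁺ and g⁻ define finite measures with the same Fourier transform, hence the same
measure. -/
lemma ae_eq_zero_of_forall_integral_real_mul_expFun {g : Plane → ℝ} (hg : Integrable g μ)
    [IsFiniteMeasure μ]
    (h : ∀ ξ, ∫ x, (g x : ℂ) * expFun ξ x ∂μ = 0) : g =ᵐ[μ] 0 := by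
  have hfin1 : IsFiniteMeasure (μ.withDensity fun x => ENNReal.ofReal (g x)) :=
    isFiniteMeasure_withDensity_ofReal hg.2
  have hfin2 : IsFiniteMeasure (μ.withDensity fun x => ENNReal.ofReal (-g x)) :=
    isFiniteMeasure_withDensity_ofReal hg.neg.2
  have hm1 : AEMeasurable (fun x => ENNReal.ofReal (g x)) μ := hg.1.aemeasurable.ennreal_ofReal
  have hm2 : AEMeasurable (fun x => ENNReal.ofReal (-g x)) μ :=
    hg.1.aemeasurable.neg.ennreal_ofReal
  have hint : ∀ {g' : Plane → ℝ}, Integrable g' μ → ∀ ξ,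
      Integrable (fun x => (ENNReal.ofReal (g' x)).toReal • expFun ξ x) μ := by
    intro g' hg' ξ
    simp only [ENNReal.toReal_ofReal']
    exact hg'.pos_part.smul_of_top_left
      (memLp_top_of_bound (continuous_expFun ξ).aestronglyMeasurable 1
        (Eventually.of_forall fun x => by simp))
  have heq : (μ.withDensity fun x => ENNReal.ofReal (g x)) =
      μ.withDensity fun x => ENNReal.ofReal (-g x) := by
    refine Measure.ext_of_charFunDual (funext fun L => ?_)
    obtain ⟨ξ, hξ⟩ := exists_exp_dual_eq_expFun L
    simp only [charFunDual_apply, hξ]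
    rw [integral_withDensity_eq_integral_toReal_smul₀ hm1 (by simp),
      integral_withDensity_eq_integral_toReal_smul₀ hm2 (by simp), ← sub_eq_zero,
      ← integral_sub, ← h ξ]
    · refine integral_congr_ae (Eventually.of_forall fun x => ?_)
      simp only [ENNReal.toReal_ofReal', Complex.real_smul, ← sub_mul, ← Complex.ofReal_sub]
      rcases le_total 0 (g x) with h0 | h0
      · simp [h0]
      · simp [h0]
    · exact hint hg ξ
    · exact hint hg.neg ξ
  have hae := (withDensity_eq_iff hm1 hm2 ?_).1 heq
  · filter_upwards [hae] with x hx
    rcases le_total 0 (g x) with h0 | h0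
    · rw [ENNReal.ofReal_of_nonpos (neg_nonpos.2 h0)] at hx
      exact le_antisymm (ENNReal.ofReal_eq_zero.1 hx) h0
    · rw [ENNReal.ofReal_of_nonpos h0] at hx
      have := ENNReal.ofReal_eq_zero.1 hx.symm
      simp only [Pi.zero_apply]
      linarith
  · have := measure_ne_top (μ.withDensity fun x => ENNReal.ofReal (g x)) Set.univ
    rwa [withDensity_apply _ MeasurableSet.univ, setLIntegral_univ] at this

/-- Conjugation replaces ξ by -ξ, so the conjugate of f has vanishing transform too; the real case
then applies to the real and imaginary parts. -/
lemma ae_eq_zero_of_forall_integral_mul_expFun [IsFiniteMeasure μ] {f : Plane → ℂ}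
    (hf : Integrable f μ) (h : ∀ ξ, ∫ x, f x * expFun ξ x ∂μ = 0) : f =ᵐ[μ] 0 := by
  have hconj : ∀ ξ, ∫ x, (starRingEnd ℂ) (f x) * expFun ξ x ∂μ = 0 := by
    intro ξ
    have := congrArg (starRingEnd ℂ) (h (-ξ))
    rw [← integral_conj, map_zero] at this
    rw [← this]
    refine integral_congr_ae (Eventually.of_forall fun x => ?_)
    simp only [map_mul, conj_expFun, neg_neg]
  have hi1 : ∀ ξ, Integrable (fun x => f x * expFun ξ x) μ := fun ξ =>
    hf.mul_bdd (c := 1) (continuous_expFun ξ).aestronglyMeasurable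
      (Eventually.of_forall fun x => by simp)
  have hfc : Integrable (fun x => (starRingEnd ℂ) (f x)) μ :=
    (Complex.conjCLE.integrable_comp_iff).2 hf
  have hi2 : ∀ ξ, Integrable (fun x => (starRingEnd ℂ) (f x) * expFun ξ x) μ := fun ξ =>
    hfc.mul_bdd (c := 1) (continuous_expFun ξ).aestronglyMeasurable
      (Eventually.of_forall fun x => by simp)
  have hre := ae_eq_zero_of_forall_integral_real_mul_expFun μ (g := fun x => (f x).re) hf.re
    fun ξ => by
      have h2 : (2 : ℂ) * ∫ x, ((f x).re : ℂ) * expFun ξ x ∂μ = 0 := by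
        rw [← integral_const_mul, ← add_zero (0 : ℂ)]
        nth_rw 1 [← h ξ]
        rw [← hconj ξ, ← integral_add (hi1 ξ) (hi2 ξ)]
        refine integral_congr_ae (Eventually.of_forall fun x => ?_)
        simp only
        rw [← add_mul, Complex.add_conj, Complex.ofReal_mul]
        push_cast
        ring
      simpa using h2
  have him := ae_eq_zero_of_forall_integral_real_mul_expFun μ (g := fun x => (f x).im) hf.im
    fun ξ => by
      have h2 : (2 * Complex.I : ℂ) * ∫ x, ((f x).im : ℂ) * expFun ξ x ∂μ = 0 := by
        rw [← integral_const_mul, ← sub_zero (0 : ℂ)]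
        nth_rw 1 [← h ξ]
        rw [← hconj ξ, ← integral_sub (hi1 ξ) (hi2 ξ)]
        refine integral_congr_ae (Eventually.of_forall fun x => ?_)
        simp only
        rw [← sub_mul, Complex.sub_conj]
        push_cast
        ring
      simpa using h2
  filter_upwards [hre, him] with x h1 h2
  exact Complex.ext h1 h2

/-- The exponential as an element of `L²`. -/
noncomputable def expLp [IsFiniteMeasure μ] (l : Plane) : Lp ℂ 2 μ :=
  (MemLp.of_bound (continuous_expFun l).aestronglyMeasurable 1
    (Eventually.of_forall fun x => by simp) : MemLp (expFun l) 2 μ).toLp _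

lemma coeFn_expLp [IsFiniteMeasure μ] (l : Plane) : (expLp μ l : Plane → ℂ) =ᵐ[μ] expFun l :=
  MemLp.coeFn_toLp _

lemma inner_expLp [IsFiniteMeasure μ] (l l' : Plane) :
    inner ℂ (expLp μ l) (expLp μ l') = measureFourier μ (l' - l) := by
  rw [L2.inner_def, measureFourier]
  refine integral_congr_ae ?_
  filter_upwards [coeFn_expLp μ l, coeFn_expLp μ l'] with x h1 h2
  rw [h1, h2, RCLike.inner_apply, conj_expFun, ← expFun_add_left, sub_eq_add_neg]

lemma norm_expLp [IsProbabilityMeasure μ] (l : Plane) : ‖expLp μ l‖ = 1 := by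
  have h := inner_self_eq_norm_sq_to_K (𝕜 := ℂ) (expLp μ l)
  rw [inner_expLp, sub_self, measureFourier_zero] at h
  have h2 : ‖expLp μ l‖ ^ 2 = 1 := Complex.ofReal_injective (by push_cast; exact h.symm)
  exact (pow_eq_one_iff_of_nonneg (norm_nonneg _) two_ne_zero).1 h2

lemma orthonormal_expLp [IsProbabilityMeasure μ] {ι : Type*} {v : ι → Plane}
    (h : ∀ i j, i ≠ j → measureFourier μ (v j - v i) = 0) :
    Orthonormal ℂ fun i => expLp μ (v i) :=
  ⟨fun _ => norm_expLp μ _, fun _ _ hij => (inner_expLp μ _ _).trans (h _ _ hij)⟩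

/-- Bessel's inequality for exponentials. -/
lemma sum_norm_sq_measureFourier_le_one [IsProbabilityMeasure μ] (S : Finset Plane)
    (h : ∀ l ∈ S, ∀ l' ∈ S, l ≠ l' → measureFourier μ (l - l') = 0) (ξ : Plane) :
    ∑ l ∈ S, ‖measureFourier μ (ξ - l)‖ ^ 2 ≤ 1 := by
  have ho : Orthonormal ℂ fun l : S => expLp μ l.1 :=
    orthonormal_expLp μ fun i j hij => h _ j.2 _ i.2 fun h' => hij (Subtype.ext h'.symm)
  have := ho.sum_inner_products_le (s := Finset.univ) (expLp μ ξ)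
  simp only [inner_expLp, norm_expLp, one_pow] at this
  rwa [← Finset.sum_coe_sort]

lemma exists_hasSum_of_isSpectralMeasure [IsProbabilityMeasure μ] (h : IsSpectralMeasure μ) :
    ∃ Λ : Set Plane, (∀ l ∈ Λ, ∀ l' ∈ Λ, l ≠ l' → measureFourier μ (l - l') = 0) ∧
      ∀ ξ, HasSum (fun l : Λ => ‖measureFourier μ (ξ - l)‖ ^ 2) 1 := by
  obtain ⟨Λ, -, b, hb⟩ := h
  have hb' : ∀ l : Λ, b l = expLp μ l := fun l =>
    Lp.ext ((hb l).trans (coeFn_expLp μ l).symm)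
  refine ⟨Λ, fun l hl l' hl' hne => ?_, fun ξ => ?_⟩
  · rw [← inner_expLp]
    have := b.orthonormal.2 (i := ⟨l', hl'⟩) (j := ⟨l, hl⟩) fun h => hne (congrArg Subtype.val h).symm
    simpa [hb'] using this
  · have := b.hasSum_inner_mul_inner (expLp μ ξ) (expLp μ ξ)
    rw [inner_expLp, sub_self, measureFourier_zero] at this
    rw [← Complex.hasSum_ofReal]
    refine this.congr_fun ?_
    intro l
    rw [← inner_conj_symm, hb', inner_expLp, Complex.conj_mul']
    push_cast
    rfl

/-- The sufficient half of the Jorgensen–Pedersen criterion. Parseval's identity for exponentials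
alone is enough, because their span is dense in L²(μ). -/
lemma isSpectralMeasure_of_hasSum [IsProbabilityMeasure μ] {Λ : Set Plane} (hΛ : Λ.Countable)
    (h : ∀ ξ, HasSum (fun l : Λ => ‖measureFourier μ (ξ - l)‖ ^ 2) 1) :
    IsSpectralMeasure μ := by
  have ho : Orthonormal ℂ fun l : Λ => expLp μ l.1 := by
    refine orthonormal_expLp μ fun i j hij => ?_
    -- At ξ = j the term of j is already 1, so every other term vanishes: orthogonality is part of
    -- the identity.
    have h1 := sum_le_hasSum {j, i} (fun l _ => by positivity) (h j)
    rw [Finset.sum_pair hij.symm, sub_self, measureFourier_zero] at h1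
    have h2 : ‖measureFourier μ (j.1 - i.1)‖ ^ 2 ≤ 0 := by
      simp only [norm_one, one_pow] at h1
      linarith
    exact norm_eq_zero.1 (pow_eq_zero_iff two_ne_zero |>.1 (le_antisymm h2 (by positivity)))
  refine ⟨Λ, hΛ, HilbertBasis.mkOfOrthogonalEqBot ho ?_, fun l => ?_⟩
  · set K : Submodule ℂ (Lp ℂ 2 μ) := Submodule.span ℂ (Set.range fun l : Λ => expLp μ l.1) with hK
    have hmem : ∀ ξ, expLp μ ξ ∈ K.topologicalClosure := by
      intro ξ
      have : CompleteSpace K.topologicalClosure :=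
        K.isClosed_topologicalClosure.completeSpace_coe
      obtain ⟨y, hy, z, hz, hyz⟩ := K.topologicalClosure.exists_add_mem_mem_orthogonal (expLp μ ξ)
      have hv : ∀ l : Λ, inner ℂ (expLp μ l.1) y = measureFourier μ (ξ - l) := by
        intro l
        have hl : expLp μ l.1 ∈ K.topologicalClosure :=
          K.le_topologicalClosure (Submodule.subset_span ⟨l, rfl⟩)
        rw [← inner_expLp, hyz, inner_add_right, (Submodule.mem_orthogonal _ _).1 hz _ hl, add_zero]
      -- By Bessel the projection y has norm at least 1, the norm of the exponential itself; so the
      -- orthogonal part z is zero.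
      have hb : 1 ≤ ‖y‖ ^ 2 := by
        refine le_of_tendsto' (h ξ) fun s => ?_
        have := ho.sum_inner_products_le (s := s) y
        simpa only [hv] using this
      have hn : ‖expLp μ ξ‖ * ‖expLp μ ξ‖ = ‖y‖ * ‖y‖ + ‖z‖ * ‖z‖ := by
        rw [hyz]
        exact norm_add_sq_eq_norm_sq_add_norm_sq_of_inner_eq_zero y z
          ((Submodule.mem_orthogonal _ _).1 hz y hy)
      rw [norm_expLp] at hn
      have hz0 : z = 0 := norm_eq_zero.1 (by nlinarith [norm_nonneg z])
      rw [hyz, hz0, add_zero]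
      exact hy
    rw [Submodule.eq_bot_iff]
    intro f hf
    rw [← Submodule.orthogonal_closure] at hf
    have hfi : Integrable (fun x => (starRingEnd ℂ) (f x)) μ :=
      (Complex.conjCLE.integrable_comp_iff).2 ((Lp.memLp f).integrable (by norm_num))
    have h0 := ae_eq_zero_of_forall_integral_mul_expFun μ hfi fun ξ => by
      have h1 := (Submodule.mem_orthogonal' _ _).1 hf _ (hmem ξ)
      rw [L2.inner_def] at h1
      rw [← h1]
      refine integral_congr_ae ?_
      filter_upwards [coeFn_expLp μ ξ] with x hx
      rw [hx, RCLike.inner_apply, mul_comm]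
    refine Lp.ext ?_
    filter_upwards [h0, Lp.coeFn_zero ℂ 2 μ] with x h1 h2
    rw [h2]
    simpa using h1
  · rw [HilbertBasis.coe_mkOfOrthogonalEqBot]
    exact coeFn_expLp μ l

end FourierBasic

/-! ### The mask of a digit set -/

/-- The trigonometric polynomial `(1/#D) ∑_{d ∈ D} e^{-2πi⟨ξ, d⟩}`. -/
noncomputable def mask (D : Finset (Fin 2 → ℤ)) (ξ : Plane) : ℂ :=
  (D.card : ℂ)⁻¹ * ∑ d ∈ D, expFun ξ (digitVec d)

lemma measureFourier_digitMeasure (D : Finset (Fin 2 → ℤ)) (ξ : Plane) :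
    measureFourier (digitMeasure D) ξ = mask D ξ := by
  rw [measureFourier, digitMeasure, integral_smul_measure,
    integral_finsetSum_measure fun d _ => integrable_expFun _ ξ, mask, Complex.real_smul]
  simp [integral_dirac]

lemma isProbabilityMeasure_digitMeasure {D : Finset (Fin 2 → ℤ)} (hD : D.Nonempty) :
    IsProbabilityMeasure (digitMeasure D) := by
  constructor
  have h : (D.card : ℝ≥0∞) ≠ 0 := by simpa using hD.ne_empty
  simp only [digitMeasure, Measure.smul_apply, Measure.finsetSum_apply, measure_univ,
    Finset.sum_const, nsmul_eq_mul, mul_one, smul_eq_mul]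
  exact ENNReal.inv_mul_cancel h (by simp)

lemma continuous_mask (D : Finset (Fin 2 → ℤ)) : Continuous (mask D) :=
  continuous_const.mul (continuous_finsetSum _ fun _ _ => continuous_expFun_left _)

lemma mask_zero {D : Finset (Fin 2 → ℤ)} (hD : D.Nonempty) : mask D 0 = 1 := by
  have h : (D.card : ℂ) ≠ 0 := by simpa using hD.ne_empty
  simp [mask, h]

lemma norm_mask_le_one {D : Finset (Fin 2 → ℤ)} (hD : D.Nonempty) (ξ : Plane) :
    ‖mask D ξ‖ ≤ 1 := by
  have := isProbabilityMeasure_digitMeasure hD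
  rw [← measureFourier_digitMeasure]
  exact norm_measureFourier_le_one _ _

lemma expFun_digitVec (k d : Fin 2 → ℤ) : expFun (digitVec k) (digitVec d) = 1 := by
  have : (digitVec k ⬝ᵥ digitVec d : ℝ) = ((k 0 * d 0 + k 1 * d 1 : ℤ) : ℝ) := by
    simp [dotProduct, Fin.sum_univ_two, digitVec]
  rw [expFun, this, Complex.exp_eq_one_iff]
  exact ⟨-(k 0 * d 0 + k 1 * d 1), by push_cast; ring⟩

lemma mask_add_digitVec (D : Finset (Fin 2 → ℤ)) (ξ : Plane) (k : Fin 2 → ℤ) :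
    mask D (ξ + digitVec k) = mask D ξ := by
  simp only [mask, expFun_add_left, expFun_digitVec, mul_one]

lemma mask_sub_digitVec (D : Finset (Fin 2 → ℤ)) (ξ : Plane) (k : Fin 2 → ℤ) :
    mask D (ξ - digitVec k) = mask D ξ := by
  rw [← mask_add_digitVec D _ k, sub_add_cancel]

/-- If the mean of finitely many unit complex numbers has modulus one, they all coincide. -/
lemma eq_of_norm_mean_eq_one {ι : Type*} {s : Finset ι} (hs : s.Nonempty) {f : ι → ℂ}
    (hf : ∀ i ∈ s, ‖f i‖ = 1) (h : ‖(s.card : ℂ)⁻¹ * ∑ i ∈ s, f i‖ = 1) :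
    ∀ i ∈ s, f i = (s.card : ℂ)⁻¹ * ∑ i ∈ s, f i := by
  set w := (s.card : ℂ)⁻¹ * ∑ i ∈ s, f i with hw
  have hc : (s.card : ℂ) ≠ 0 := by simpa using hs.ne_empty
  have hww : (starRingEnd ℂ) w * w = 1 := by rw [Complex.conj_mul', h]; simp
  have hsum : ∑ i ∈ s, ((starRingEnd ℂ) w * f i).re = ∑ i ∈ s, (1 : ℝ) := by
    rw [← Complex.re_sum, ← Finset.mul_sum]
    have : ∑ i ∈ s, f i = s.card * w := by rw [hw, mul_inv_cancel_left₀ hc]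
    rw [this, mul_left_comm, hww]
    simp
  have hn : ∀ i ∈ s, ‖(starRingEnd ℂ) w * f i‖ = 1 := fun i hi => by
    rw [norm_mul, RCLike.norm_conj, h, hf i hi, one_mul]
  have hle : ∀ i ∈ s, ((starRingEnd ℂ) w * f i).re ≤ 1 := fun i hi =>
    (Complex.re_le_norm _).trans (hn i hi).le
  intro i hi
  have h1 : ((starRingEnd ℂ) w * f i).re = 1 := (Finset.sum_eq_sum_iff_of_le hle).1 hsum i hi
  have h2 : (starRingEnd ℂ) w * f i = 1 := by
    have h3 := hn i hi
    have h4 : ((starRingEnd ℂ) w * f i).im = 0 := by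
      have := Complex.sq_norm ((starRingEnd ℂ) w * f i)
      rw [h3, Complex.normSq_apply, h1] at this
      nlinarith
    exact Complex.ext h1 h4
  calc f i = w * ((starRingEnd ℂ) w * f i) := by
        rw [← mul_assoc, mul_comm w, hww, one_mul]
    _ = w := by rw [h2, mul_one]

/-- Parseval's identity for the uniform measure on the digits. -/
lemma sum_norm_sq_mask_eq_one {D : Finset (Fin 2 → ℤ)} (hD : D.Nonempty) {ι : Type*} [Fintype ι]
    (hcard : Fintype.card ι = D.card) (v : ι → Plane)
    (h : ∀ i j, i ≠ j → mask D (v j - v i) = 0) (ξ : Plane) :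
    ∑ i, ‖mask D (ξ - v i)‖ ^ 2 = 1 := by
  have hc : (D.card : ℝ) ≠ 0 := by simpa using hD.ne_empty
  set e : Plane → EuclideanSpace ℂ D := fun l =>
    WithLp.toLp 2 fun d : D => (((Real.sqrt D.card)⁻¹ : ℝ) : ℂ) * expFun l (digitVec d.1) with he
  have hin : ∀ l l', inner ℂ (e l) (e l') = mask D (l' - l) := by
    intro l l'
    simp only [he, PiLp.inner_apply, RCLike.inner_apply, map_mul, Complex.conj_ofReal, conj_expFun]
    rw [mask, ← Finset.sum_coe_sort D, Finset.mul_sum]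
    refine Finset.sum_congr rfl fun d _ => ?_
    have h2 : (D.card : ℂ)⁻¹ = (((Real.sqrt D.card)⁻¹ : ℝ) : ℂ) * (((Real.sqrt D.card)⁻¹ : ℝ) : ℂ) := by
      rw [← Complex.ofReal_mul, ← mul_inv, Real.mul_self_sqrt (Nat.cast_nonneg _)]
      simp
    rw [h2, sub_eq_add_neg, expFun_add_left]
    ring
  have hnorm : ∀ l, ‖e l‖ = 1 := fun l => by
    have h := inner_self_eq_norm_sq_to_K (𝕜 := ℂ) (e l)
    rw [hin, sub_self, mask_zero hD] at h
    have h2 : ‖e l‖ ^ 2 = 1 := Complex.ofReal_injective (by push_cast; exact h.symm)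
    exact (pow_eq_one_iff_of_nonneg (norm_nonneg _) two_ne_zero).1 h2
  have ho : Orthonormal ℂ fun i => e (v i) :=
    ⟨fun i => hnorm _, fun i j hij => (hin _ _).trans (h i j hij)⟩
  have hspan : ⊤ ≤ Submodule.span ℂ (Set.range fun i => e (v i)) := by
    rw [ho.linearIndependent.span_eq_top_of_card_eq_finrank' (by simp [hcard])]
  have := (OrthonormalBasis.mk ho hspan).sum_sq_norm_inner_right (e ξ)
  simpa [hin, hnorm] using this

/-- The zeros of the mask of `D` are the points `z / p` with `z` an integer vector which is a
multiple, but not the zero multiple, of `a` modulo `p`. -/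
def HasLatticeZeros (p : ℕ) (a : Fin 2 → ℤ) (D : Finset (Fin 2 → ℤ)) : Prop :=
  ∀ ξ : Plane, mask D ξ = 0 ↔
    ∃ z : Fin 2 → ℤ, ¬ (p : ℤ) ∣ z 0 ∧ (p : ℤ) ∣ a 0 * z 1 - a 1 * z 0 ∧ ∀ i, ξ i = z i / p

lemma not_dvd_of_mem_Icc {p : ℕ} {x : ℤ} (hx : 1 ≤ x ∧ x ≤ (p : ℤ) - 1) : ¬ (p : ℤ) ∣ x :=
  fun h => by
    have := Int.le_of_dvd (by omega) h
    omega

/-- As a₀ is invertible modulo p, the multiples of a modulo p are the solutions of a determinant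
equation, and p ∤ z₀ excludes the zero multiple. -/
lemma mem_latticeCosets_iff {p : ℕ} (hp : p.Prime) {a : Fin 2 → ℤ}
    (ha : ∀ i, 1 ≤ a i ∧ a i ≤ (p : ℤ) - 1) (ξ : Plane) :
    ξ ∈ latticeCosets p a ↔ ∃ z : Fin 2 → ℤ, ¬ (p : ℤ) ∣ z 0 ∧
      (p : ℤ) ∣ a 0 * z 1 - a 1 * z 0 ∧ ∀ i, ξ i = z i / p := by
  have hp0 : (p : ℝ) ≠ 0 := by exact_mod_cast hp.ne_zero
  have hpZ : Prime (p : ℤ) := Nat.prime_iff_prime_int.1 hp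
  have ha0 := not_dvd_of_mem_Icc (ha 0)
  simp only [latticeCosets, Set.mem_iUnion, Set.mem_ofPred_eq, Finset.mem_Icc, exists_prop]
  constructor
  · rintro ⟨j, ⟨hj1, hj2⟩, k, hk⟩
    refine ⟨fun i => j * a i + p * k i, ?_, ⟨a 0 * k 1 - a 1 * k 0, by ring⟩, fun i => ?_⟩
    · intro h
      have h1 : (p : ℤ) ∣ j * a 0 := (dvd_add_left (dvd_mul_right _ _)).1 h
      rcases hpZ.dvd_or_dvd h1 with h2 | h2
      · have := Nat.le_of_dvd hj1 (Int.natCast_dvd_natCast.1 h2)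
        omega
      · exact ha0 h2
    · rw [hk i]
      push_cast
      field_simp
  · rintro ⟨z, hz0, hz1, hξ⟩
    have hcop : IsCoprime (a 0) (p : ℤ) :=
      ((Prime.coprime_iff_not_dvd hpZ).2 ha0).symm
    obtain ⟨u, w, huw⟩ := hcop
    have hppos : (0 : ℤ) < p := by exact_mod_cast hp.pos
    -- Here u inverts a₀ modulo p, so this is the only candidate for the multiplier.
    set j : ℤ := (z 0 * u) % p with hj
    have hjnn : 0 ≤ j := Int.emod_nonneg _ hppos.ne'
    have hjlt : j < p := Int.emod_lt_of_pos _ hppos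
    have hjmod : (p : ℤ) ∣ z 0 * u - j := by
      rw [hj]; exact Int.dvd_self_sub_emod
    have hdvd0 : (p : ℤ) ∣ z 0 - j * a 0 := by
      have : z 0 - j * a 0 = (z 0 * u - j) * a 0 + p * (w * z 0) := by
        linear_combination (-z 0) * huw
      rw [this]
      exact dvd_add (hjmod.mul_right _) (dvd_mul_right _ _)
    have hdvd1 : (p : ℤ) ∣ z 1 - j * a 1 := by
      have h1 : (p : ℤ) ∣ a 0 * (z 1 - j * a 1) := by
        have : a 0 * (z 1 - j * a 1) = (a 0 * z 1 - a 1 * z 0) + a 1 * (z 0 - j * a 0) := by ring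
        rw [this]
        exact dvd_add hz1 (hdvd0.mul_left _)
      exact (hpZ.dvd_or_dvd h1).resolve_left ha0
    have hj0 : j ≠ 0 := by
      intro h0
      rw [h0] at hdvd0
      simp only [zero_mul, sub_zero] at hdvd0
      exact hz0 hdvd0
    obtain ⟨k0, hk0⟩ := hdvd0
    obtain ⟨k1, hk1⟩ := hdvd1
    have hjr : ((j.toNat : ℕ) : ℝ) = (j : ℝ) := by
      exact_mod_cast congrArg (fun t : ℤ => (t : ℝ)) (Int.toNat_of_nonneg hjnn)
    refine ⟨j.toNat, ⟨by omega, by omega⟩, ![k0, k1], fun i => ?_⟩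
    rw [hξ i, hjr]
    have h0 : (z 0 : ℝ) = j * a 0 + p * k0 := by
      have : z 0 = j * a 0 + p * k0 := by linarith
      exact_mod_cast this
    have h1 : (z 1 : ℝ) = j * a 1 + p * k1 := by
      have : z 1 = j * a 1 + p * k1 := by linarith
      exact_mod_cast this
    fin_cases i
    · simp only [Fin.zero_eta, Matrix.cons_val_zero, h0]
      field_simp
    · simp only [Fin.mk_one, Matrix.cons_val_one, Matrix.cons_val_fin_one, h1]
      field_simp

lemma hasLatticeZeros_of_zeroSet_eq {p : ℕ} (hp : p.Prime) {a : Fin 2 → ℤ}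
    (ha : ∀ i, 1 ≤ a i ∧ a i ≤ (p : ℤ) - 1) {D : Finset (Fin 2 → ℤ)}
    (h : zeroSet (measureFourier (digitMeasure D)) = latticeCosets p a) :
    HasLatticeZeros p a D := fun ξ => by
  rw [← mem_latticeCosets_iff hp ha, ← h, zeroSet, Set.mem_ofPred_eq, measureFourier_digitMeasure]

/-! ### Strict bounds for the mask away from integral first coordinates -/

section LatticeZeros

variable {p : ℕ} {a : Fin 2 → ℤ} {D : Finset (Fin 2 → ℤ)}

/-- If |m(ξ)| = 1, all exponentials at ξ agree on D and m(x + ξ) = m(x) m(ξ). Translating the zero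
a/p by ξ shows that ξ is again a multiple of a over p modulo ℤ². Its first coordinate not being an
integer, -ξ is a zero of m, and x = -ξ gives m(0) = 0. -/
lemma norm_mask_lt_one (hp : p.Prime) (ha0 : ¬ (p : ℤ) ∣ a 0) (hD : D.Nonempty)
    (hz : HasLatticeZeros p a D) {ξ : Plane} (hξ : ∀ n : ℤ, ξ 0 ≠ n) : ‖mask D ξ‖ < 1 := by
  have hp0 : (p : ℝ) ≠ 0 := by exact_mod_cast hp.ne_zero
  refine lt_of_le_of_ne (norm_mask_le_one hD ξ) fun h1 => ?_
  have heq : ∀ d ∈ D, expFun ξ (digitVec d) = mask D ξ :=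
    eq_of_norm_mean_eq_one hD (fun _ _ => norm_expFun _ _) h1
  have hmul : ∀ x, mask D (x + ξ) = mask D x * mask D ξ := by
    intro x
    rw [mask, mask, mul_assoc, Finset.sum_mul]
    congr 1
    refine Finset.sum_congr rfl fun d hd => ?_
    rw [expFun_add_left, heq d hd]
  have h0 : mask D (fun i => a i / p) = 0 := (hz _).2 ⟨a, ha0, ⟨0, by ring⟩, fun _ => rfl⟩
  have h2 := hmul (fun i => a i / p)
  rw [h0, zero_mul] at h2
  obtain ⟨z, -, hz1, hz2⟩ := (hz _).1 h2
  have hξz : ∀ i, ξ i = ((z i - a i : ℤ) : ℝ) / p := fun i => by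
    have := hz2 i
    rw [Pi.add_apply] at this
    push_cast
    rw [sub_div, ← this]
    ring
  have h3 : mask D (-ξ) = 0 := by
    refine (hz _).2 ⟨fun i => -(z i - a i), ?_, ?_, fun i => ?_⟩
    · rw [dvd_neg]
      rintro ⟨n, hn⟩
      refine hξ n ?_
      rw [hξz 0, hn]
      push_cast
      field_simp
    · have : a 0 * -(z 1 - a 1) - a 1 * -(z 0 - a 0) = -(a 0 * z 1 - a 1 * z 0) := by ring
      rw [this, dvd_neg]
      exact hz1
    · rw [Pi.neg_apply, hξz i]
      push_cast
      ring
  have h4 := hmul (-ξ)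
  rw [h3, zero_mul, neg_add_cancel, mask_zero hD] at h4
  exact one_ne_zero h4

/-- Periodicity reduces the bound to a compact part of the unit square, where the strict inequality
becomes uniform. -/
lemma exists_norm_mask_le (hp : p.Prime) (ha0 : ¬ (p : ℤ) ∣ a 0) (hD : D.Nonempty)
    (hz : HasLatticeZeros p a D) {η : ℝ} (hη : 0 < η) :
    ∃ b : ℝ, 0 < b ∧ b < 1 ∧ ∀ ξ : Plane, (∀ n : ℤ, η ≤ |ξ 0 - n|) → ‖mask D ξ‖ ≤ b := by
  set K : Set Plane := Set.Icc 0 1 ∩ {ξ | ∀ n : ℤ, η ≤ |ξ 0 - n|} with hK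
  have hclosed : IsClosed {ξ : Plane | ∀ n : ℤ, η ≤ |ξ 0 - n|} := by
    simp only [Set.ofPred_forall]
    refine isClosed_iInter fun n => isClosed_le continuous_const ?_
    fun_prop
  have hcomp : IsCompact K := isCompact_Icc.inter_right hclosed
  obtain ⟨b, hb0, hb, hbK⟩ : ∃ b : ℝ, 0 < b ∧ b < 1 ∧ ∀ ξ ∈ K, ‖mask D ξ‖ ≤ b := by
    rcases K.eq_empty_or_nonempty with h | h
    · exact ⟨1 / 2, by norm_num, by norm_num, by simp [h]⟩
    · obtain ⟨x, hxK, hx⟩ := hcomp.exists_isMaxOn h (continuous_mask D).norm.continuousOn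
      refine ⟨max ‖mask D x‖ (1 / 2), by positivity, max_lt ?_ (by norm_num),
        fun ξ hξ => (hx hξ).trans (le_max_left _ _)⟩
      refine norm_mask_lt_one hp ha0 hD hz fun n hn => ?_
      have := hxK.2 n
      rw [hn, sub_self, abs_zero] at this
      linarith
  refine ⟨b, hb0, hb, fun ξ hξ => ?_⟩
  rw [← mask_sub_digitVec D ξ fun i => ⌊ξ i⌋]
  refine hbK _ ⟨⟨fun i => ?_, fun i => ?_⟩, fun n => ?_⟩
  · simp only [Pi.zero_apply, Pi.sub_apply, digitVec]
    linarith [Int.floor_le (ξ i)]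
  · simp only [Pi.one_apply, Pi.sub_apply, digitVec]
    linarith [Int.lt_floor_add_one (ξ i)]
  · have := hξ (⌊ξ 0⌋ + n)
    simp only [Pi.sub_apply, digitVec]
    push_cast at this
    rwa [sub_sub]

end LatticeZeros

/-! ### The dual dynamics -/

/-- The powers of the transpose of `[[r, c], [0, r]]`. -/
noncomputable def shear (r c : ℝ) (k : ℤ) (ξ : Plane) : Plane :=
  ![r ^ k * ξ 0, k * c * r ^ (k - 1) * ξ 0 + r ^ k * ξ 1]

section Shear

variable {r : ℝ} (c : ℝ)

@[simp] lemma shear_apply_zero (k : ℤ) (ξ : Plane) : shear r c k ξ 0 = r ^ k * ξ 0 := rfl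

@[simp] lemma shear_apply_one (k : ℤ) (ξ : Plane) :
    shear r c k ξ 1 = k * c * r ^ (k - 1) * ξ 0 + r ^ k * ξ 1 := rfl

lemma plane_ext {x y : Plane} (h0 : x 0 = y 0) (h1 : x 1 = y 1) : x = y := by
  ext i
  fin_cases i
  · exact h0
  · exact h1

lemma shear_shear (hr : r ≠ 0) (k l : ℤ) (ξ : Plane) :
    shear r c k (shear r c l ξ) = shear r c (k + l) ξ := by
  refine plane_ext ?_ ?_
  · simp only [shear_apply_zero]
    rw [zpow_add₀ hr]
    ring
  · simp only [shear_apply_zero, shear_apply_one]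
    have h1 : r ^ (k + l - 1) = r ^ k * r ^ l * r⁻¹ := by
      rw [zpow_sub_one₀ hr, zpow_add₀ hr]
    rw [h1, zpow_sub_one₀ hr, zpow_sub_one₀ hr, zpow_add₀ hr]
    push_cast
    ring

@[simp] lemma shear_zero (ξ : Plane) : shear r c 0 ξ = ξ :=
  plane_ext (by simp) (by simp)

lemma shear_neg_shear (hr : r ≠ 0) (k : ℤ) (ξ : Plane) :
    shear r c (-k) (shear r c k ξ) = ξ := by
  rw [shear_shear c hr, neg_add_cancel, shear_zero]

lemma shear_shear_neg (hr : r ≠ 0) (k : ℤ) (ξ : Plane) :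
    shear r c k (shear r c (-k) ξ) = ξ := by
  rw [shear_shear c hr, add_neg_cancel, shear_zero]

lemma shear_add (k : ℤ) (ξ η : Plane) :
    shear r c k (ξ + η) = shear r c k ξ + shear r c k η :=
  plane_ext (by simp; ring) (by simp; ring)

lemma shear_sub (k : ℤ) (ξ η : Plane) :
    shear r c k (ξ - η) = shear r c k ξ - shear r c k η :=
  plane_ext (by simp; ring) (by simp; ring)

@[simp] lemma shear_apply_eq_zero (k : ℤ) : shear r c k 0 = 0 :=
  plane_ext (by simp) (by simp)

lemma tendsto_shear_neg (hr : 1 < r) (ξ : Plane) :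
    Tendsto (fun n : ℕ => shear r c (-n) ξ) atTop (𝓝 0) := by
  have hr0 : 0 < r := by linarith
  have hi0 : 0 ≤ r⁻¹ := by positivity
  have hi1 : r⁻¹ < 1 := inv_lt_one_of_one_lt₀ hr
  have h1 := tendsto_pow_atTop_nhds_zero_of_lt_one hi0 hi1
  have h2 := tendsto_self_mul_const_pow_of_lt_one hi0 hi1
  rw [tendsto_pi_nhds]
  intro i
  fin_cases i
  · simpa using h1.mul_const (ξ 0)
  · have h3 := (h2.mul_const (-(c * r⁻¹ * ξ 0))).add (h1.mul_const (ξ 1))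
    simp only [zero_mul, add_zero] at h3
    refine h3.congr fun n => ?_
    simp only [Fin.mk_one, shear_apply_one]
    rw [zpow_sub_one₀ hr0.ne', zpow_neg, zpow_natCast, inv_pow]
    push_cast
    ring

/-- Fourier transforms of probability measures on the plane. -/
def IsFourierTransform (g : Plane → ℂ) : Prop :=
  ∃ ν : Measure Plane, IsProbabilityMeasure ν ∧ ∀ ξ, measureFourier ν ξ = g ξ

lemma IsFourierTransform.mul {f g : Plane → ℂ} (hf : IsFourierTransform f)
    (hg : IsFourierTransform g) : IsFourierTransform fun ξ => f ξ * g ξ := by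
  obtain ⟨ν, hν, h⟩ := hf
  obtain ⟨ν', hν', h'⟩ := hg
  exact ⟨ν ∗ ν', inferInstance, fun ξ => by rw [measureFourier_conv, h, h']⟩

lemma isFourierTransform_one : IsFourierTransform fun _ => 1 :=
  ⟨Measure.dirac 0, inferInstance, fun ξ => by simp [measureFourier, expFun]⟩

lemma isFourierTransform_mask {D : Finset (Fin 2 → ℤ)} (hD : D.Nonempty) :
    IsFourierTransform (mask D) :=
  ⟨digitMeasure D, isProbabilityMeasure_digitMeasure hD, measureFourier_digitMeasure D⟩

/-- The map `T` is the adjoint of A^k, and the image of the measure under `T` has the required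
transform. -/
lemma IsFourierTransform.comp_shear {g : Plane → ℂ} (hg : IsFourierTransform g) (k : ℤ) :
    IsFourierTransform fun ξ => g (shear r c k ξ) := by
  obtain ⟨ν, hν, h⟩ := hg
  set T : Plane → Plane := fun x => ![r ^ k * x 0 + k * c * r ^ (k - 1) * x 1, r ^ k * x 1] with hT
  have hTc : Continuous T := by
    refine continuous_pi fun i => ?_
    fin_cases i
    · simp only [hT, Fin.zero_eta, Matrix.cons_val_zero]
      fun_prop
    · simp only [hT, Fin.mk_one, Matrix.cons_val_one, Matrix.cons_val_fin_one]
      fun_prop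
  refine ⟨ν.map T, Measure.isProbabilityMeasure_map hTc.measurable.aemeasurable, fun ξ => ?_⟩
  refine Eq.trans ?_ (h _)
  rw [measureFourier, measureFourier, integral_map hTc.measurable.aemeasurable
    (continuous_expFun ξ).aestronglyMeasurable]
  refine integral_congr_ae (Eventually.of_forall fun x => ?_)
  have : ξ ⬝ᵥ T x = shear r c k ξ ⬝ᵥ x := by
    simp only [dotProduct, Fin.sum_univ_two, hT, shear_apply_zero, shear_apply_one,
      Matrix.cons_val_zero, Matrix.cons_val_one, Matrix.cons_val_fin_one]
    ring
  simp only [expFun, this]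

lemma IsFourierTransform.norm_le_one {g : Plane → ℂ} (hg : IsFourierTransform g) (ξ : Plane) :
    ‖g ξ‖ ≤ 1 := by
  obtain ⟨ν, hν, h⟩ := hg
  rw [← h]
  exact norm_measureFourier_le_one ν ξ

lemma IsFourierTransform.continuous {g : Plane → ℂ} (hg : IsFourierTransform g) :
    Continuous g := by
  obtain ⟨ν, hν, h⟩ := hg
  rw [← funext h]
  exact continuous_measureFourier ν

lemma IsFourierTransform.apply_zero {g : Plane → ℂ} (hg : IsFourierTransform g) : g 0 = 1 := by
  obtain ⟨ν, hν, h⟩ := hg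
  rw [← h]
  exact measureFourier_zero ν

lemma IsFourierTransform.sum_norm_sq_le_one {g : Plane → ℂ} (hg : IsFourierTransform g)
    (S : Finset Plane) (h : ∀ l ∈ S, ∀ l' ∈ S, l ≠ l' → g (l - l') = 0) (ξ : Plane) :
    ∑ l ∈ S, ‖g (ξ - l)‖ ^ 2 ≤ 1 := by
  obtain ⟨ν, hν, hν'⟩ := hg
  simp only [← hν'] at h ⊢
  exact sum_norm_sq_measureFourier_le_one ν S h ξ

/-- The Fourier transform of the `n`-th discrete approximation of the self-affine measure. -/
noncomputable def partialMask (D : Finset (Fin 2 → ℤ)) (r c : ℝ) (n : ℕ) (ξ : Plane) : ℂ :=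
  ∏ k ∈ Finset.range n, mask D (shear r c (-((k : ℤ) + 1)) ξ)

variable {D : Finset (Fin 2 → ℤ)}

lemma isFourierTransform_partialMask (hD : D.Nonempty) (n : ℕ) :
    IsFourierTransform (partialMask D r c n) := by
  induction n with
  | zero => exact isFourierTransform_one
  | succ n ih =>
    have := ih.mul ((isFourierTransform_mask hD).comp_shear (r := r) c (-((n : ℤ) + 1)))
    refine (funext fun ξ => ?_ : partialMask D r c (n + 1) = _) ▸ this
    exact Finset.prod_range_succ _ n

lemma partialMask_add (hr : r ≠ 0) (n q : ℕ) (ξ : Plane) :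
    partialMask D r c (n + q) ξ = partialMask D r c n ξ * partialMask D r c q (shear r c (-n) ξ) := by
  rw [partialMask, Finset.prod_range_add, partialMask, partialMask]
  congr 1
  refine Finset.prod_congr rfl fun k _ => ?_
  rw [shear_shear c hr]
  congr 2
  push_cast
  ring

lemma partialMask_one (ξ : Plane) : partialMask D r c 1 ξ = mask D (shear r c (-1) ξ) := by
  simp [partialMask]

end Shear

/-! ### The Fourier transform of the self-affine measure -/

section SelfAffineFourier

variable {ρ c : ℝ} {D : Finset (Fin 2 → ℤ)}

/-- The Fourier transform of the self-affine measure. -/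
noncomputable def affineFourier (ρ c : ℝ) (D : Finset (Fin 2 → ℤ)) : Plane → ℂ :=
  measureFourier (selfAffineMeasure (triMatrix ρ ρ c) D)

lemma isProbabilityMeasure_selfAffineMeasure (h0 : 0 < ρ) (h1 : ρ < 1) (hD : D.Nonempty) :
    IsProbabilityMeasure (selfAffineMeasure (triMatrix ρ ρ c) D) :=
  (isSelfAffineMeasure_selfAffineMeasure (summable_triMatrix h0 h1 c) hD).isProb

lemma isFourierTransform_affineFourier (h0 : 0 < ρ) (h1 : ρ < 1) (hD : D.Nonempty) :
    IsFourierTransform (affineFourier ρ c D) :=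
  ⟨_, isProbabilityMeasure_selfAffineMeasure h0 h1 hD, fun _ => rfl⟩

lemma expFun_triMatrix_inv_mulVec (h0 : 0 < ρ) (ξ x : Plane) :
    expFun ξ ((triMatrix ρ ρ c)⁻¹ *ᵥ x) = expFun (shear ρ⁻¹ c (-1) ξ) x := by
  have h : ξ ⬝ᵥ ((triMatrix ρ ρ c)⁻¹ *ᵥ x) = shear ρ⁻¹ c (-1) ξ ⬝ᵥ x := by
    have := triMatrix_inv_pow h0.ne' c 1
    rw [pow_one] at this
    rw [this]
    have h2 : (ρ⁻¹ : ℝ) ^ (-1 - 1 : ℤ) = ρ ^ 2 := by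
      rw [inv_zpow, ← zpow_neg]
      norm_num
    simp only [dotProduct, Fin.sum_univ_two, shear_apply_zero, shear_apply_one, Matrix.mulVec, h2]
    simp
    ring
  simp only [expFun, h]

lemma affineFourier_eq_mask_mul (h0 : 0 < ρ) (h1 : ρ < 1) (hD : D.Nonempty) (ξ : Plane) :
    affineFourier ρ c D ξ =
      mask D (shear ρ⁻¹ c (-1) ξ) * affineFourier ρ c D (shear ρ⁻¹ c (-1) ξ) := by
  obtain ⟨L, hL⟩ := exists_dual_expFun_eq ξ
  have h := charFunDual_selfAffine
    (isSelfAffineMeasure_selfAffineMeasure (summable_triMatrix h0 h1 c) hD) L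
  simp only [charFunDual_apply, ← hL] at h
  have hL' : ∀ x, Complex.exp ((L.comp (Matrix.mulVecLin
      (triMatrix ρ ρ c)⁻¹).toContinuousLinearMap) x * Complex.I) =
        expFun (shear ρ⁻¹ c (-1) ξ) x := fun x => by
    rw [← expFun_triMatrix_inv_mulVec h0, hL]
    rfl
  simp only [hL', expFun_triMatrix_inv_mulVec h0] at h
  rw [affineFourier, measureFourier, h, ← Finset.mul_sum, mask, measureFourier]
  ring

lemma affineFourier_eq_partialMask_mul (h0 : 0 < ρ) (h1 : ρ < 1) (hD : D.Nonempty) (n : ℕ)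
    (ξ : Plane) : affineFourier ρ c D ξ =
      partialMask D ρ⁻¹ c n ξ * affineFourier ρ c D (shear ρ⁻¹ c (-n) ξ) := by
  induction n with
  | zero => simp [partialMask]
  | succ n ih =>
    have hr : ρ⁻¹ ≠ 0 := inv_ne_zero h0.ne'
    rw [ih, partialMask_add c hr, partialMask_one, affineFourier_eq_mask_mul h0 h1 hD,
      shear_shear c hr, mul_assoc]
    congr 4
    all_goals (push_cast; ring)

/-- The tail F(A^{-n} ξ) tends to F(0) = 1, so a zero of F must come from one of the first finitely
many factors. -/
lemma affineFourier_eq_zero (h0 : 0 < ρ) (h1 : ρ < 1) (hD : D.Nonempty) {ξ : Plane}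
    (h : affineFourier ρ c D ξ = 0) : ∃ k : ℕ, 1 ≤ k ∧ mask D (shear ρ⁻¹ c (-k) ξ) = 0 := by
  have hr : 1 < ρ⁻¹ := (one_lt_inv₀ h0).2 h1
  have hF := isFourierTransform_affineFourier (c := c) h0 h1 hD
  have ht : Tendsto (fun n : ℕ => affineFourier ρ c D (shear ρ⁻¹ c (-n) ξ)) atTop (𝓝 1) := by
    have := (hF.continuous.tendsto 0).comp (tendsto_shear_neg c hr ξ)
    rwa [hF.apply_zero] at this
  obtain ⟨n, hn⟩ := (ht.eventually_ne one_ne_zero).exists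
  rw [affineFourier_eq_partialMask_mul h0 h1 hD n, mul_eq_zero, or_iff_left hn, partialMask,
    Finset.prod_eq_zero_iff] at h
  obtain ⟨k, -, hk⟩ := h
  exact ⟨k + 1, by omega, by exact_mod_cast hk⟩

end SelfAffineFourier

/-! ### Construction of a spectrum -/

/-- The lattice `sℤ × ℤ`. -/
def stretchedLattice (s : ℤ) : AddSubgroup Plane where
  carrier := {γ | ∃ x y : ℤ, γ 0 = s * x ∧ γ 1 = y}
  zero_mem' := ⟨0, 0, by simp, by simp⟩
  add_mem' := by
    rintro γ γ' ⟨x, y, hx, hy⟩ ⟨x', y', hx', hy'⟩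
    exact ⟨x + x', y + y', by simp [hx, hx', mul_add], by simp [hy, hy']⟩
  neg_mem' := by
    rintro γ ⟨x, y, hx, hy⟩
    exact ⟨-x, -y, by simp [hx], by simp [hy]⟩

lemma mask_sub_of_mem {D : Finset (Fin 2 → ℤ)} {s : ℤ} {γ : Plane} (hγ : γ ∈ stretchedLattice s)
    (ξ : Plane) : mask D (ξ - γ) = mask D ξ := by
  obtain ⟨x, y, hx, hy⟩ := hγ
  rw [← mask_sub_digitVec D ξ ![s * x, y]]
  congr 2
  exact plane_ext (by simp [digitVec, hx]) (by simp [digitVec, hy])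

/-- The translates of `|g|²` by the points of `S` sum to one. -/
def IsParsevalSet (g : Plane → ℂ) (S : Finset Plane) : Prop :=
  ∀ ξ, ∑ l ∈ S, ‖g (ξ - l)‖ ^ 2 = 1

/-- Injectivity of F on I is automatic: a repeated point would contribute two terms equal to 1. -/
lemma isParsevalSet_image {g : Plane → ℂ} (hg : g 0 = 1) {ι : Type*} {I : Finset ι}
    {F : ι → Plane} (h : ∀ ξ, ∑ i ∈ I, ‖g (ξ - F i)‖ ^ 2 = 1) [DecidableEq Plane] :
    IsParsevalSet g (I.image F) := by
  classical
  have hinj : Set.InjOn F I := by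
    intro i hi j hj hij
    by_contra hne
    have h1 := Finset.sum_le_sum_of_subset_of_nonneg (f := fun k => ‖g (F i - F k)‖ ^ 2)
      (Finset.insert_subset hi (Finset.singleton_subset_iff.2 hj) : {i, j} ⊆ I)
      fun k _ _ => by positivity
    rw [h, Finset.sum_pair hne, ← hij, sub_self, hg] at h1
    norm_num at h1
  intro ξ
  rw [Finset.sum_image hinj]
  exact h ξ

/-! ### Parseval sets built from lattice-valued blocks -/

section Construction

variable {r c : ℝ} {s : ℤ} {D : Finset (Fin 2 → ℤ)}

lemma shear_natCast_mem (hr : r ≠ 0)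
    (hΓ : ∀ γ ∈ stretchedLattice s, shear r c 1 γ ∈ stretchedLattice s) (n : ℕ) {γ : Plane}
    (hγ : γ ∈ stretchedLattice s) : shear r c n γ ∈ stretchedLattice s := by
  induction n with
  | zero => simpa using hγ
  | succ n ih =>
    have := hΓ _ ih
    rwa [shear_shear c hr, add_comm] at this

/-- The factor of level k ≤ n is shifted by A^{n-k} γ, which stays in the lattice and is a period of
the mask. -/
lemma partialMask_sub_shear (hr : r ≠ 0)
    (hΓ : ∀ γ ∈ stretchedLattice s, shear r c 1 γ ∈ stretchedLattice s) (n : ℕ) {γ : Plane}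
    (hγ : γ ∈ stretchedLattice s) (ξ : Plane) :
    partialMask D r c n (ξ - shear r c n γ) = partialMask D r c n ξ := by
  refine Finset.prod_congr rfl fun k hk => ?_
  have hk' := Finset.mem_range.1 hk
  rw [shear_sub, shear_shear c hr]
  have : -((k : ℤ) + 1) + n = ((n - (k + 1) : ℕ) : ℤ) := by omega
  rw [this]
  exact mask_sub_of_mem (shear_natCast_mem hr hΓ _ hγ) _

/-- Extension of a Parseval set by a block, with corrections in the lattice. -/
lemma IsParsevalSet.extend (hr : r ≠ 0) (hD : D.Nonempty)
    (hΓ : ∀ γ ∈ stretchedLattice s, shear r c 1 γ ∈ stretchedLattice s) {n q : ℕ}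
    {S B : Finset Plane} (hS : IsParsevalSet (partialMask D r c n) S)
    (hB : IsParsevalSet (partialMask D r c q) B) (hBΓ : ∀ b ∈ B, b ∈ stretchedLattice s)
    (γ : Plane × Plane → Plane) (hγ : ∀ x, γ x ∈ stretchedLattice s) [DecidableEq Plane] :
    IsParsevalSet (partialMask D r c (n + q))
      ((S ×ˢ B).image fun x => x.1 + shear r c n (x.2 + shear r c q (γ x))) := by
  refine isParsevalSet_image (isFourierTransform_partialMask c hD _).apply_zero fun ξ => ?_
  rw [Finset.sum_product]
  calc _ = ∑ l ∈ S, ∑ b ∈ B, ‖partialMask D r c n (ξ - l)‖ ^ 2 *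
        ‖partialMask D r c q (shear r c (-n) (ξ - l) - b)‖ ^ 2 := by
        refine Finset.sum_congr rfl fun l _ => Finset.sum_congr rfl fun b hb => ?_
        have hm : b + shear r c q (γ (l, b)) ∈ stretchedLattice s :=
          add_mem (hBΓ b hb) (shear_natCast_mem hr hΓ _ (hγ _))
        rw [partialMask_add c hr, ← sub_sub, partialMask_sub_shear hr hΓ n hm,
          shear_sub c (-n : ℤ) (ξ - l), shear_neg_shear c hr, ← sub_sub,
          partialMask_sub_shear hr hΓ q (hγ _), norm_mul, mul_pow]
    _ = 1 := by
        simp only [← Finset.mul_sum, hB _, mul_one]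
        exact hS ξ

/-- Blocks of every length, given a block of length one. -/
lemma exists_isParsevalSet_block (hr : r ≠ 0) (hD : D.Nonempty)
    (hΓ : ∀ γ ∈ stretchedLattice s, shear r c 1 γ ∈ stretchedLattice s) {B₁ : Finset Plane}
    (hB₁ : IsParsevalSet (partialMask D r c 1) B₁) (hB₁Γ : ∀ b ∈ B₁, b ∈ stretchedLattice s)
    (h0 : (0 : Plane) ∈ B₁) (q : ℕ) :
    ∃ B : Finset Plane, IsParsevalSet (partialMask D r c q) B ∧
      (∀ b ∈ B, b ∈ stretchedLattice s) ∧ (0 : Plane) ∈ B := by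
  classical
  induction q with
  | zero =>
    exact ⟨{0}, fun ξ => by simp [partialMask], by simp [zero_mem], by simp⟩
  | succ q ih =>
    obtain ⟨B, hB, hBΓ, hB0⟩ := ih
    refine ⟨_, hB.extend hr hD hΓ hB₁ hB₁Γ (fun _ => 0) (fun _ => zero_mem _), ?_, ?_⟩
    · intro b hb
      obtain ⟨⟨x, y⟩, hxy, rfl⟩ := Finset.mem_image.1 hb
      obtain ⟨hx, hy⟩ := Finset.mem_product.1 hxy
      refine add_mem (hBΓ _ hx) (shear_natCast_mem hr hΓ _ ?_)
      simpa using hB₁Γ _ hy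
    · exact Finset.mem_image.2 ⟨(0, 0), Finset.mem_product.2 ⟨hB0, h0⟩, by simp⟩

/-- If some lattice translate of the Fourier transform is nonzero at every point, then the
translates can be chosen uniformly bounded below. -/
lemma exists_uniform_translate {F : Plane → ℂ} (hF : Continuous F) (hF0 : F 0 = 1)
    (hs : s ≠ 0) (hne : ∀ ξ, F ξ ≠ 0 ∨ F (ξ - ![0, 1]) ≠ 0) :
    ∃ ε > 0, ∃ δ > 0,
      (∀ x, ∃ γ ∈ stretchedLattice s, ∀ y, ‖y‖ < δ → ε ≤ ‖F (x - γ + y)‖) ∧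
      ∀ x, ‖x‖ < δ → ∀ y, ‖y‖ < δ → ε ≤ ‖F (x + y)‖ := by
  have hsR : (s : ℝ) ≠ 0 := by exact_mod_cast hs
  set R : ℝ := |(s : ℝ)| + 1 with hR
  have hRpos : 0 < R := by positivity
  have hGc : Continuous fun ξ => max ‖F ξ‖ ‖F (ξ - ![0, 1])‖ := by fun_prop
  -- The ball of radius R = |s| + 1 contains a fundamental domain of the lattice, so the minimum
  -- found here serves every point of the plane.
  obtain ⟨x₀, -, hx₀⟩ := (isCompact_closedBall (0 : Plane) R).exists_isMinOn
    ⟨0, by simp [hRpos.le]⟩ hGc.continuousOn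
  set ε₀ : ℝ := max ‖F x₀‖ ‖F (x₀ - ![0, 1])‖ with hε₀
  have hε₀pos : 0 < ε₀ := by
    rcases hne x₀ with h | h
    · exact lt_max_of_lt_left (norm_pos_iff.2 h)
    · exact lt_max_of_lt_right (norm_pos_iff.2 h)
  set ε : ℝ := min (ε₀ / 2) (1 / 2) with hε
  have hεpos : 0 < ε := by positivity
  have huc := (isCompact_closedBall (0 : Plane) (R + 2)).uniformContinuousOn_of_continuous
    hF.continuousOn
  rw [Metric.uniformContinuousOn_iff] at huc
  obtain ⟨δ₁, hδ₁, huc⟩ := huc ε hεpos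
  set δ : ℝ := min (δ₁ / 2) (1 / 2) with hδ
  have hδpos : 0 < δ := by positivity
  have hδ1 : δ ≤ δ₁ / 2 := min_le_left _ _
  have hδ2 : δ ≤ 1 / 2 := min_le_right _ _
  have key : ∀ x y : Plane, ‖x‖ ≤ R + 1 → ‖y‖ < 2 * δ → ‖F x‖ - ε < ‖F (x + y)‖ := by
    intro x y hx hy
    have h1 := huc (x + y) (by
      rw [mem_closedBall_zero_iff]
      linarith [norm_add_le x y]) x (by
      rw [mem_closedBall_zero_iff]
      linarith) (by
      rw [dist_eq_norm, add_sub_cancel_left]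
      linarith)
    rw [dist_eq_norm] at h1
    have := norm_sub_norm_le (F x) (F (x + y))
    rw [norm_sub_rev] at this
    linarith
  refine ⟨ε, hεpos, δ, hδpos, fun x => ?_, fun x hx y hy => ?_⟩
  · set γ₀ : Plane := ![s * ⌊x 0 / s⌋, ⌊x 1⌋] with hγ₀
    have hmem : γ₀ ∈ stretchedLattice s := ⟨⌊x 0 / s⌋, ⌊x 1⌋, rfl, rfl⟩
    have hball : ‖x - γ₀‖ ≤ R := by
      rw [pi_norm_le_iff_of_nonneg hRpos.le]
      intro i
      fin_cases i
      · have h1 : x 0 - s * ⌊x 0 / s⌋ = s * Int.fract (x 0 / s) := by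
          rw [Int.fract]
          field_simp
        have h2 := (Int.fract_lt_one (x 0 / s)).le
        have h3 := Int.fract_nonneg (x 0 / s)
        simp only [Fin.zero_eta, Pi.sub_apply, hγ₀, Matrix.cons_val_zero, Real.norm_eq_abs, h1,
          abs_mul, abs_of_nonneg h3]
        nlinarith [abs_nonneg (s : ℝ)]
      · have h1 : |x 1 - ⌊x 1⌋| ≤ 1 := by
          rw [abs_le]
          constructor <;> linarith [Int.floor_le (x 1), Int.lt_floor_add_one (x 1)]
        simp only [Fin.mk_one, Pi.sub_apply, hγ₀, Matrix.cons_val_one, Matrix.cons_val_fin_one,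
          Real.norm_eq_abs]
        linarith [abs_nonneg (s : ℝ)]
    have hmin : ε₀ ≤ max ‖F (x - γ₀)‖ ‖F (x - γ₀ - ![0, 1])‖ :=
      hx₀ (mem_closedBall_zero_iff.2 hball)
    have hεε₀ : 2 * ε ≤ ε₀ := by linarith [min_le_left (ε₀ / 2) (1 / 2)]
    have hunit : ‖(![0, 1] : Plane)‖ ≤ 1 := by
      rw [pi_norm_le_iff_of_nonneg zero_le_one]
      intro i
      fin_cases i <;> simp
    rcases le_max_iff.1 hmin with h | h
    · refine ⟨γ₀, hmem, fun y hy => ?_⟩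
      have := key (x - γ₀) y (by linarith) (by linarith)
      linarith
    · refine ⟨γ₀ + ![0, 1], add_mem hmem ⟨0, 1, by simp, by simp⟩, fun y hy => ?_⟩
      have := key (x - γ₀ - ![0, 1]) y ((norm_sub_le _ _).trans (by linarith)) (by linarith)
      rw [← sub_sub]
      linarith
  · have := key 0 (x + y) (by simp; positivity) ((norm_add_le _ _).trans_lt (by linarith))
    rw [zero_add, hF0, norm_one] at this
    linarith [min_le_right (ε₀ / 2) (1 / 2)]

end Construction

/-! ### Passage from finite products to the full transform -/

section Spectrum

variable {ρ c : ℝ} {s : ℤ} {D : Finset (Fin 2 → ℤ)}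

/-- One step in the construction of the spectrum. -/
lemma exists_extension (hr : 1 < ρ⁻¹) (hD : D.Nonempty)
    (hΓ : ∀ γ ∈ stretchedLattice s, shear ρ⁻¹ c 1 γ ∈ stretchedLattice s) {B₁ : Finset Plane}
    (hB₁ : IsParsevalSet (partialMask D ρ⁻¹ c 1) B₁) (hB₁Γ : ∀ b ∈ B₁, b ∈ stretchedLattice s)
    (h0 : (0 : Plane) ∈ B₁) {F : Plane → ℂ} {ε δ : ℝ} (hδ : 0 < δ)
    (hF : ∀ x, ∃ γ ∈ stretchedLattice s, ∀ y, ‖y‖ < δ → ε ≤ ‖F (x - γ + y)‖)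
    (hF' : ∀ x, ‖x‖ < δ → ∀ y, ‖y‖ < δ → ε ≤ ‖F (x + y)‖) {n : ℕ} {S : Finset Plane}
    (hS : IsParsevalSet (partialMask D ρ⁻¹ c n) S) :
    ∃ n' S', n < n' ∧ S ⊆ S' ∧ IsParsevalSet (partialMask D ρ⁻¹ c n') S' ∧
      ∀ l ∈ S', ∀ y, ‖y‖ < δ → ε ≤ ‖F (y - shear ρ⁻¹ c (-n') l)‖ := by
  classical
  have hr0 : ρ⁻¹ ≠ 0 := by linarith
  -- A long block makes the old points negligible at the new scale, so they can be kept without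
  -- correction.
  have hev : ∀ᶠ q : ℕ in atTop, ∀ l ∈ S, ‖shear ρ⁻¹ c (-(n + q : ℕ)) l‖ < δ := by
    rw [Filter.eventually_all_finset]
    intro l _
    have h1 := ((tendsto_shear_neg c hr l).norm).comp (tendsto_add_atTop_nat n)
    rw [norm_zero] at h1
    filter_upwards [h1.eventually_lt_const hδ] with q hq
    simpa [add_comm] using hq
  obtain ⟨q, hq, hq1⟩ := (hev.and (eventually_ge_atTop 1)).exists
  obtain ⟨B, hB, hBΓ, hB0⟩ := exists_isParsevalSet_block hr0 hD hΓ hB₁ hB₁Γ h0 q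
  choose γ hγ hγF using hF
  -- The correction is zero for b = 0, which keeps S inside the new set. For b ≠ 0 it moves
  -- A^{-(n+q)} of the new point by a lattice vector to where F is at least ε.
  set γ' : Plane × Plane → Plane := fun x =>
    if x.2 = 0 then 0 else γ (-(shear ρ⁻¹ c (-(n + q : ℕ)) (x.1 + shear ρ⁻¹ c n x.2))) with hγ'
  have hγ'Γ : ∀ x, γ' x ∈ stretchedLattice s := by
    intro x
    simp only [hγ']
    split_ifs
    · exact zero_mem _
    · exact hγ _
  refine ⟨n + q, _, by omega, ?_, hS.extend hr0 hD hΓ hB hBΓ γ' hγ'Γ, ?_⟩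
  · intro l hl
    exact Finset.mem_image.2 ⟨(l, 0), Finset.mem_product.2 ⟨hl, hB0⟩, by simp [hγ']⟩
  · intro l' hl' y hy
    obtain ⟨⟨l, b⟩, hlb, rfl⟩ := Finset.mem_image.1 hl'
    obtain ⟨hl, hb⟩ := Finset.mem_product.1 hlb
    by_cases hb0 : b = 0
    · subst hb0
      simp only [hγ', if_true, shear_apply_eq_zero, add_zero]
      rw [sub_eq_add_neg, add_comm]
      exact hF' _ (by rw [norm_neg]; exact hq l hl) y hy
    · have h1 := hγF (-(shear ρ⁻¹ c (-(n + q : ℕ)) (l + shear ρ⁻¹ c n b))) y hy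
      convert h1 using 3
      simp only [hγ', if_neg hb0]
      generalize γ (-(shear ρ⁻¹ c (-(n + q : ℕ)) (l + shear ρ⁻¹ c n b))) = w
      rw [shear_add c n b, ← add_assoc, shear_add c _ (l + shear ρ⁻¹ c n b), shear_shear c hr0 n,
        shear_shear c hr0]
      have : -((n + q : ℕ) : ℤ) + ((n : ℤ) + q) = 0 := by push_cast; ring
      rw [this, shear_zero]
      abel

/-- The n-th product is F(ξ) / F(A^{-n} ξ) as soon as the denominator, which tends to 1, is nonzero.
-/
lemma tendsto_partialMask (h0 : 0 < ρ) (h1 : ρ < 1) (hD : D.Nonempty) (ξ : Plane) :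
    Tendsto (fun n => partialMask D ρ⁻¹ c n ξ) atTop (𝓝 (affineFourier ρ c D ξ)) := by
  have hr : 1 < ρ⁻¹ := (one_lt_inv₀ h0).2 h1
  have hF := isFourierTransform_affineFourier (c := c) h0 h1 hD
  have ht : Tendsto (fun n : ℕ => affineFourier ρ c D (shear ρ⁻¹ c (-n) ξ)) atTop (𝓝 1) := by
    have := (hF.continuous.tendsto 0).comp (tendsto_shear_neg c hr ξ)
    rwa [hF.apply_zero] at this
  have h2 : Tendsto (fun n : ℕ => affineFourier ρ c D ξ /
      affineFourier ρ c D (shear ρ⁻¹ c (-n) ξ)) atTop (𝓝 (affineFourier ρ c D ξ / 1)) :=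
    tendsto_const_nhds.div ht one_ne_zero
  rw [div_one] at h2
  refine h2.congr' ?_
  filter_upwards [ht.eventually_ne one_ne_zero] with n hn
  rw [affineFourier_eq_partialMask_mul h0 h1 hD n ξ, mul_div_cancel_right₀ _ hn]

/-- A block of length one together with the nonvanishing of some translate yields a spectrum. -/
lemma isSpectralMeasure_of_block (h0 : 0 < ρ) (h1 : ρ < 1) (hD : D.Nonempty) (hs : s ≠ 0)
    (hΓ : ∀ γ ∈ stretchedLattice s, shear ρ⁻¹ c 1 γ ∈ stretchedLattice s) {B₁ : Finset Plane}
    (hB₁ : IsParsevalSet (partialMask D ρ⁻¹ c 1) B₁) (hB₁Γ : ∀ b ∈ B₁, b ∈ stretchedLattice s)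
    (h0B : (0 : Plane) ∈ B₁)
    (hne : ∀ ξ, affineFourier ρ c D ξ ≠ 0 ∨ affineFourier ρ c D (ξ - ![0, 1]) ≠ 0) :
    IsSpectralMeasure (selfAffineMeasure (triMatrix ρ ρ c) D) := by
  classical
  have hr : 1 < ρ⁻¹ := (one_lt_inv₀ h0).2 h1
  have hr0 : ρ⁻¹ ≠ 0 := by linarith
  have hF := isFourierTransform_affineFourier (c := c) h0 h1 hD
  have hprob := isProbabilityMeasure_selfAffineMeasure (c := c) h0 h1 hD
  obtain ⟨ε, hε, δ, hδ, hgood, hgood'⟩ :=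
    exists_uniform_translate (s := s) hF.continuous hF.apply_zero hs hne
  let X := {x : ℕ × Finset Plane // IsParsevalSet (partialMask D ρ⁻¹ c x.1) x.2 ∧
    ∀ l ∈ x.2, ∀ y, ‖y‖ < δ → ε ≤ ‖affineFourier ρ c D (y - shear ρ⁻¹ c (-x.1) l)‖}
  have hstep : ∀ x : X, ∃ x' : X, x.1.1 < x'.1.1 ∧ x.1.2 ⊆ x'.1.2 := by
    rintro ⟨⟨n, S⟩, hS, -⟩
    obtain ⟨n', S', h1, h2, h3, h4⟩ := exists_extension hr hD hΓ hB₁ hB₁Γ h0B hδ hgood hgood' hS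
    exact ⟨⟨⟨n', S'⟩, h3, h4⟩, h1, h2⟩
  have hstart : Nonempty X := by
    refine ⟨⟨⟨0, {0}⟩, fun ξ => by simp [partialMask], ?_⟩⟩
    intro l hl y hy
    rw [Finset.mem_singleton.1 hl, shear_apply_eq_zero, sub_zero]
    simpa using hgood' 0 (by simpa using hδ) y hy
  choose next hnext1 hnext2 using hstep
  set seq : ℕ → X := fun k => next^[k] (Classical.choice hstart) with hseq
  have hsucc : ∀ k, seq (k + 1) = next (seq k) := fun k => Function.iterate_succ_apply' _ _ _
  have hn : StrictMono fun k => (seq k).1.1 := strictMono_nat_of_lt_succ fun k => by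
    rw [hsucc]; exact hnext1 _
  have hmono : Monotone fun k => (seq k).1.2 := monotone_nat_of_le_succ fun k => by
    rw [hsucc]; exact hnext2 _
  set Λ : Set Plane := ⋃ k, ((seq k).1.2 : Set Plane) with hΛ
  refine isSpectralMeasure_of_hasSum _ (Λ := Λ)
    (Set.countable_iUnion fun k => (seq k).1.2.countable_toSet) fun ξ => ?_
  set f : Plane → ℝ := fun l => ‖affineFourier ρ c D (ξ - l)‖ ^ 2 with hf
  set g : ℕ → Plane → ℝ := fun k =>
    ((seq k).1.2 : Set Plane).indicator fun l =>
      ‖partialMask D ρ⁻¹ c (seq k).1.1 (ξ - l)‖ ^ 2 with hg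
  have hfg : ∀ k l, f l ≤ ‖partialMask D ρ⁻¹ c (seq k).1.1 (ξ - l)‖ ^ 2 := by
    intro k l
    rw [hf]
    simp only
    rw [affineFourier_eq_partialMask_mul h0 h1 hD (seq k).1.1, norm_mul]
    have := hF.norm_le_one (shear ρ⁻¹ c (-((seq k).1.1 : ℤ)) (ξ - l))
    gcongr
    exact mul_le_of_le_one_right (norm_nonneg _) this
  have hsum : ∀ u : Finset Plane, ∑ l ∈ u, Λ.indicator f l ≤ 1 := by
    intro u
    have h2 : ∀ l ∈ u.filter (· ∈ Λ), ∃ k, l ∈ (seq k).1.2 := fun l hl => by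
      simpa [hΛ] using (Finset.mem_filter.1 hl).2
    choose! κ hκ using h2
    set K := (u.filter (· ∈ Λ)).sup κ
    calc ∑ l ∈ u, Λ.indicator f l = ∑ l ∈ u.filter (· ∈ Λ), f l := by
          rw [Finset.sum_filter]
          exact Finset.sum_congr rfl fun l _ => Set.indicator_apply _ _ _
      _ ≤ ∑ l ∈ (seq K).1.2, f l :=
          Finset.sum_le_sum_of_subset_of_nonneg
            (fun l hl => hmono (Finset.le_sup hl : κ l ≤ K) (hκ l hl))
            fun l _ _ => by positivity
      _ ≤ _ := (Finset.sum_le_sum fun l _ => hfg K l)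
      _ = 1 := (seq K).2.1 ξ
  have hfnn : ∀ l, 0 ≤ Λ.indicator f l := fun l => Set.indicator_nonneg (fun _ _ => by positivity) l
  have hsumm : Summable (Λ.indicator f) := summable_of_sum_le hfnn hsum
  have hgsum : ∀ k, ∑' l, g k l = 1 := by
    intro k
    rw [tsum_eq_sum (s := (seq k).1.2) fun l hl => Set.indicator_of_notMem (by simpa using hl) _,
      ← (seq k).2.1 ξ]
    exact Finset.sum_congr rfl fun l hl => Set.indicator_of_mem (by simpa using hl) _
  -- The lower bound ε for the tail on the k-th set makes ε⁻² |F(ξ - l)|² a majorant of the partial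
  -- products. It is summable because each finite part of Λ lies in some Parseval set.
  have hlim : Tendsto (fun k => ∑' l, g k l) atTop (𝓝 (∑' l, Λ.indicator f l)) := by
    refine tendsto_tsum_of_dominated_convergence (bound := fun l => (ε ^ 2)⁻¹ * Λ.indicator f l)
      (hsumm.mul_left _) (fun l => ?_) ?_
    · by_cases hl : l ∈ Λ
      · obtain ⟨k₀, hk₀⟩ : ∃ k, l ∈ (seq k).1.2 := by simpa [hΛ] using hl
        rw [Set.indicator_of_mem hl]
        have := (((tendsto_partialMask (c := c) h0 h1 hD (ξ - l)).comp
          hn.tendsto_atTop).norm).pow 2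
        refine this.congr' ?_
        filter_upwards [eventually_ge_atTop k₀] with k hk
        simp only [hg, Function.comp_apply]
        rw [Set.indicator_of_mem (Finset.mem_coe.2 (hmono hk hk₀))]
      · rw [Set.indicator_of_notMem hl]
        refine tendsto_const_nhds.congr fun k => ?_
        refine (Set.indicator_of_notMem (fun h => hl ?_) _).symm
        exact Set.mem_iUnion.2 ⟨k, h⟩
    · have h2 := ((tendsto_shear_neg c hr ξ).norm).comp hn.tendsto_atTop
      rw [norm_zero] at h2
      filter_upwards [h2.eventually_lt_const hδ] with k hk l
      by_cases hl : l ∈ (seq k).1.2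
      · have hlΛ : l ∈ Λ := Set.mem_iUnion.2 ⟨k, hl⟩
        rw [hg]
        simp only
        rw [Set.indicator_of_mem (by simpa using hl), Set.indicator_of_mem hlΛ, Real.norm_eq_abs,
          abs_of_nonneg (by positivity), le_inv_mul_iff₀ (by positivity), hf]
        simp only
        rw [affineFourier_eq_partialMask_mul h0 h1 hD (seq k).1.1 (ξ - l), norm_mul, mul_pow,
          mul_comm]
        have := (seq k).2.2 l hl _ hk
        rw [shear_sub]
        gcongr
      · rw [hg]
        simp only
        rw [Set.indicator_of_notMem (by simpa using hl), norm_zero]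
        exact mul_nonneg (by positivity) (hfnn l)
  simp only [hgsum] at hlim
  have htsum : ∑' l, Λ.indicator f l = 1 := tendsto_nhds_unique hlim tendsto_const_nhds
  have := hsumm.hasSum
  rw [htsum] at this
  exact hasSum_subtype_iff_indicator.2 this

end Spectrum

/-! ### Sufficiency of the conditions on ρ and c -/

section Sufficiency

variable {p : ℕ} {ρ c : ℝ} {a : Fin 2 → ℤ} {D : Finset (Fin 2 → ℤ)}

/-- Were k < l, then z = r^{l-k} w would be divisible by p. Used in both directions, this makes the
level of a zero a function of its first coordinate. -/
lemma exponent_le_of_zpow_eq {p : ℕ} (hp : p.Prime) {r : ℝ} {m : ℤ} (hr : r = p * m)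
    (hr0 : r ≠ 0) {k l : ℕ} {x : ℝ} {z w : ℤ} (hz : ¬ (p : ℤ) ∣ z) (hk : r ^ (-(k : ℤ)) * x = z / p)
    (hl : r ^ (-(l : ℤ)) * x = w / p) : l ≤ k := by
  have hp0 : (p : ℝ) ≠ 0 := by exact_mod_cast hp.ne_zero
  by_contra! hlt
  have hx : x = r ^ l * (w / p) := by
    rw [← hl, zpow_neg, zpow_natCast, mul_inv_cancel_left₀ (pow_ne_zero _ hr0)]
  have h1 : (z : ℝ) = r ^ (l - k) * w := by
    rw [zpow_neg, zpow_natCast, hx] at hk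
    have h2 : r ^ l = r ^ k * r ^ (l - k) := by rw [← pow_add]; congr 1; omega
    rw [h2] at hk
    have := pow_ne_zero k hr0
    field_simp at hk
    linarith
  have h2 : z = (p * m) ^ (l - k) * w := by
    rw [hr] at h1
    exact_mod_cast h1
  apply hz
  rw [h2]
  exact ((dvd_mul_right _ _).trans (dvd_pow_self _ (by omega))).mul_right _

/-- The condition in the theorem suffices for spectrality. -/
lemma isSpectralMeasure_of_integrality (hp : p.Prime) (h0 : 0 < ρ) (h1 : ρ < 1)
    (hcard : D.card = p) (ha0 : ¬ (p : ℤ) ∣ a 0) (hz : HasLatticeZeros p a D) {m : ℤ}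
    (hm : ρ⁻¹ = p * m) {t s : ℤ} (hs : s ≠ 0) (hpt : (p : ℤ) ∣ t) (hts : Int.gcd t s = 1)
    (hc : c = t / s) : IsSpectralMeasure (selfAffineMeasure (triMatrix ρ ρ c) D) := by
  classical
  have hp0 : (p : ℝ) ≠ 0 := by exact_mod_cast hp.ne_zero
  have hpZ : Prime (p : ℤ) := Nat.prime_iff_prime_int.1 hp
  have hsR : (s : ℝ) ≠ 0 := by exact_mod_cast hs
  have hr : 1 < ρ⁻¹ := (one_lt_inv₀ h0).2 h1
  have hr0 : ρ⁻¹ ≠ 0 := by linarith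
  have hD : D.Nonempty := Finset.card_pos.1 (hcard ▸ hp.pos)
  have hps : ¬ (p : ℤ) ∣ s := fun h => by
    have h2 : (p : ℤ) ∣ (Int.gcd t s : ℤ) := Int.dvd_coe_gcd hpt h
    rw [hts] at h2
    exact hpZ.not_isUnit (isUnit_of_dvd_one (by exact_mod_cast h2))
  obtain ⟨t', ht'⟩ := hpt
  have hΓ : ∀ γ ∈ stretchedLattice s, shear ρ⁻¹ c 1 γ ∈ stretchedLattice s := by
    rintro γ ⟨x, y, hx, hy⟩
    refine ⟨p * m * x, t * x + p * m * y, ?_, ?_⟩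
    · rw [shear_apply_zero, hx, zpow_one, hm]
      push_cast
      ring
    · rw [shear_apply_one, hx, hy, zpow_one, hm, hc]
      push_cast
      simp only [zpow_zero]
      field_simp
  obtain ⟨u, w, huw⟩ : IsCoprime (a 0) (p : ℤ) :=
    ((Prime.coprime_iff_not_dvd hpZ).2 ha0).symm
  -- With u inverse to a₀ modulo p, the vector (s, y₁) is a multiple of a modulo p whose first entry
  -- is s; the points v j are thus zeros of the mask for p ∤ j, and A maps them into the lattice.
  set y₁ : ℤ := s * a 1 * u with hy₁
  set v : ℤ → Plane := fun j => ![j * s / p, j * y₁ / p] with hv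
  have hvsub : ∀ i j, v j - v i = v (j - i) := fun i j => by
    refine plane_ext ?_ ?_
    · simp only [hv, Pi.sub_apply, Matrix.cons_val_zero]
      push_cast
      ring
    · simp only [hv, Pi.sub_apply, Matrix.cons_val_one, Matrix.cons_val_fin_one]
      push_cast
      ring
  have hvzero : ∀ j : ℤ, ¬ (p : ℤ) ∣ j → mask D (v j) = 0 := by
    intro j hj
    refine (hz _).2 ⟨![j * s, j * y₁], ?_, ?_, fun i => ?_⟩
    · rw [Matrix.cons_val_zero]
      exact fun h => (hpZ.dvd_or_dvd h).elim hj hps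
    · refine ⟨-(j * s * a 1 * w), ?_⟩
      simp only [hy₁, Matrix.cons_val_zero, Matrix.cons_val_one, Matrix.cons_val_fin_one]
      linear_combination (j * s * a 1) * huw
    · fin_cases i
      · simp [hv]
      · simp [hv]
  have hB₁ : IsParsevalSet (partialMask D ρ⁻¹ c 1)
      ((Finset.univ : Finset (Fin p)).image fun j : Fin p => shear ρ⁻¹ c 1 (v (j : ℕ))) := by
    refine isParsevalSet_image (isFourierTransform_partialMask c hD _).apply_zero fun ξ => ?_
    simp only [partialMask_one, shear_sub, shear_neg_shear c hr0]
    refine sum_norm_sq_mask_eq_one hD (by simp [hcard]) (fun j : Fin p => v (j : ℕ))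
      (fun i j hij => ?_) _
    rw [hvsub]
    refine hvzero _ fun h => hij ?_
    have hi := i.2
    have hj := j.2
    have h2 := Int.eq_zero_of_abs_lt_dvd h (abs_lt.2 ⟨by omega, by omega⟩)
    exact Fin.ext (by omega)
  refine isSpectralMeasure_of_block h0 h1 hD hs hΓ hB₁ ?_ ?_ ?_
  · intro b hb
    obtain ⟨j, -, rfl⟩ := Finset.mem_image.1 hb
    refine ⟨m * (j : ℕ), t' * (j : ℕ) + m * (j : ℕ) * y₁, ?_, ?_⟩
    · rw [shear_apply_zero, zpow_one, hm]
      simp only [hv, Matrix.cons_val_zero]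
      push_cast
      field_simp
    · rw [shear_apply_one, zpow_one, hm, hc, ht']
      simp only [hv, Matrix.cons_val_zero, Matrix.cons_val_one, Matrix.cons_val_fin_one, sub_self,
        zpow_zero]
      push_cast
      field_simp
  · refine Finset.mem_image.2 ⟨⟨0, hp.pos⟩, Finset.mem_univ _, ?_⟩
    have : v ((0 : ℕ) : ℤ) = 0 := plane_ext (by simp [hv]) (by simp [hv])
    simp only [this, shear_apply_eq_zero]
  -- If F vanished at ξ and at ξ - (0,1), the equal first coordinates would force equal levels k.
  · intro ξ
    by_contra! hcon
    obtain ⟨k, hk1, hk⟩ := affineFourier_eq_zero h0 h1 hD hcon.1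
    obtain ⟨l, hl1, hl⟩ := affineFourier_eq_zero h0 h1 hD hcon.2
    obtain ⟨z, hz0, hz1, hzξ⟩ := (hz _).1 hk
    obtain ⟨z', hz0', hz1', hzξ'⟩ := (hz _).1 hl
    have e0 := hzξ 0
    have e0' := hzξ' 0
    rw [shear_apply_zero] at e0 e0'
    simp only [Pi.sub_apply, Matrix.cons_val_zero, sub_zero] at e0'
    have hkl : k = l := le_antisymm (exponent_le_of_zpow_eq hp hm hr0 hz0' e0' e0)
      (exponent_le_of_zpow_eq hp hm hr0 hz0 e0 e0')
    subst hkl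
    have hzz : z 0 = z' 0 := by
      rw [e0] at e0'
      have : (z 0 : ℝ) = z' 0 := by field_simp at e0'; exact e0'
      exact_mod_cast this
    have e1 := hzξ 1
    have e1' := hzξ' 1
    rw [shear_apply_one] at e1 e1'
    simp only [Pi.sub_apply, Matrix.cons_val_zero, Matrix.cons_val_one, Matrix.cons_val_fin_one,
      sub_zero] at e1'
    have hdvd : (p : ℤ) ∣ z 1 - z' 1 := by
      refine (hpZ.dvd_or_dvd (?_ : (p : ℤ) ∣ a 0 * (z 1 - z' 1))).resolve_left ha0
      have := dvd_sub hz1 hz1'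
      rw [hzz] at this
      have e : a 0 * (z 1 - z' 1) =
          a 0 * z 1 - a 1 * z' 0 - (a 0 * z' 1 - a 1 * z' 0) := by ring
      rwa [e]
    obtain ⟨N, hN⟩ := hdvd
    have hNr : (z 1 : ℝ) - z' 1 = p * N := by exact_mod_cast hN
    -- Subtracting second coordinates turns the shift by (0,1) into r^{-k}, an integer strictly
    -- between 0 and 1.
    have hpow : (ρ⁻¹ : ℝ) ^ (-(k : ℤ)) = N := by
      have h3 : (ρ⁻¹ : ℝ) ^ (-(k : ℤ)) = (z 1 - z' 1) / p := by
        rw [sub_div, ← e1, ← e1']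
        ring
      rw [h3, hNr, mul_div_cancel_left₀ _ hp0]
    rw [zpow_neg, zpow_natCast] at hpow
    have hpos : 0 < ((ρ⁻¹ : ℝ) ^ k)⁻¹ := by positivity
    have hlt : ((ρ⁻¹ : ℝ) ^ k)⁻¹ < 1 := inv_lt_one_of_one_lt₀ (one_lt_pow₀ hr (by omega))
    rw [hpow] at hpos hlt
    have hN1 : 0 < N := by exact_mod_cast hpos
    have hN2 : N < 1 := by exact_mod_cast hlt
    omega

end Sufficiency

/-! ### Sets of reals whose differences are `r ^ k * z` with `z` prime to `p` -/

/-- All differences of distinct elements of `X` are of the form `r ^ k * z` with `p ∤ z`. -/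
def HasPowerDifferences (p : ℕ) (r : ℝ) (X : Set ℝ) : Prop :=
  ∀ x ∈ X, ∀ y ∈ X, x ≠ y → ∃ (k : ℕ) (z : ℤ), ¬ (p : ℤ) ∣ z ∧ x - y = r ^ k * z

section Arithmetic

open Polynomial

variable {p : ℕ} {r : ℝ} {X : Set ℝ}

/-- The leading coefficient times r is an algebraic integer, so a power of that coefficient clears
the denominators of any polynomial in r. -/
lemma exists_isIntegral_leadingCoeff_pow_mul {f : ℤ[X]} (hf : aeval r f = 0) (h : ℤ[X]) :
    ∃ T : ℕ, IsIntegral ℤ ((f.leadingCoeff : ℝ) ^ T * aeval r h) := by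
  have hr : IsIntegral ℤ ((f.leadingCoeff : ℝ) * r) := by
    simpa using isIntegral_leadingCoeff_smul f r hf
  have hc : ∀ n : ℤ, IsIntegral ℤ (n : ℝ) := fun n => isIntegral_algebraMap
  induction h using Polynomial.induction_on' with
  | add g h hg hh =>
    obtain ⟨S, hS⟩ := hg
    obtain ⟨T, hT⟩ := hh
    refine ⟨S + T, ?_⟩
    have : (f.leadingCoeff : ℝ) ^ (S + T) * aeval r (g + h) =
        f.leadingCoeff ^ T * (f.leadingCoeff ^ S * aeval r g) +
          f.leadingCoeff ^ S * (f.leadingCoeff ^ T * aeval r h) := by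
      rw [map_add]
      ring
    rw [this]
    exact (((hc _).pow _).mul hS).add (((hc _).pow _).mul hT)
  | monomial n a =>
    refine ⟨n, ?_⟩
    have : (f.leadingCoeff : ℝ) ^ n * aeval r (monomial n a) = a * (f.leadingCoeff * r) ^ n := by
      rw [aeval_monomial]
      simp only [algebraMap_int_eq, eq_intCast]
      ring
    rw [this]
    exact (hc a).mul (hr.pow n)

lemma dvd_of_isIntegral_div {m n : ℤ} (hn : n ≠ 0) (h : IsIntegral ℤ ((m : ℝ) / n)) : n ∣ m := by
  have h1 : IsIntegral ℤ ((m : ℚ) / n) := by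
    rw [← isIntegral_algebraMap_iff (algebraMap ℚ ℝ).injective]
    simpa using h
  obtain ⟨y, hy⟩ := IsIntegrallyClosed.isIntegral_iff.1 h1
  refine ⟨y, ?_⟩
  have hn' : (n : ℚ) ≠ 0 := by exact_mod_cast hn
  rw [eq_div_iff hn'] at hy
  simp only [algebraMap_int_eq, eq_intCast] at hy
  rw [mul_comm]
  exact_mod_cast hy.symm

/-- If `r` and `r⁻¹` are integral at `p`, then `r ^ k * z` is not divisible by `p` in `ℤ[r]`. -/
lemma pow_mul_ne_prime_mul_aeval (hp : p.Prime) (hr : r ≠ 0) {f : ℤ[X]} (hf : aeval r f = 0)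
    (hlc : ¬ (p : ℤ) ∣ f.leadingCoeff) (hf0 : ¬ (p : ℤ) ∣ f.coeff 0) (k : ℕ) {z : ℤ}
    (hz : ¬ (p : ℤ) ∣ z) (h : ℤ[X]) : r ^ k * z ≠ p * aeval r h := by
  intro heq
  have hpZ : Prime (p : ℤ) := Nat.prime_iff_prime_int.1 hp
  have hp0 : (p : ℝ) ≠ 0 := by exact_mod_cast hp.ne_zero
  obtain ⟨T, hT⟩ := exists_isIntegral_leadingCoeff_pow_mul hf h
  have hf00 : f.coeff 0 ≠ 0 := fun h0 => hf0 (h0 ▸ dvd_zero _)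
  have hinv : IsIntegral ℤ ((f.coeff 0 : ℝ) * r⁻¹) := by
    have hrev : aeval r⁻¹ f.reverse = 0 := by
      let _ : Invertible r := invertibleOfNonzero hr
      have := (eval₂_reverse_eq_zero_iff (algebraMap ℤ ℝ) r f).2 hf
      rwa [invOf_eq_inv] at this
    have := isIntegral_leadingCoeff_smul f.reverse r⁻¹ hrev
    rw [reverse_leadingCoeff, trailingCoeff_eq_coeff_zero hf00] at this
    simpa using this
  -- Both the leading coefficient times r and the constant coefficient times r⁻¹ are integral.
  -- Assuming the equality, this quotient is a rational algebraic integer, so p divides a product of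
  -- integers prime to p.
  have hint : IsIntegral ℤ (((f.leadingCoeff ^ T * f.coeff 0 ^ k * z : ℤ) : ℝ) / (p : ℤ)) := by
    have : ((f.leadingCoeff ^ T * f.coeff 0 ^ k * z : ℤ) : ℝ) / (p : ℤ) =
        (f.leadingCoeff ^ T * aeval r h) * (f.coeff 0 * r⁻¹) ^ k := by
      have h2 : aeval r h = r ^ k * z / p := by
        rw [heq]
        field_simp
      rw [h2, mul_pow, inv_pow]
      push_cast
      field_simp
    rw [this]
    exact hT.mul (hinv.pow k)
  have hdvd := dvd_of_isIntegral_div hpZ.ne_zero hint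
  rcases hpZ.dvd_or_dvd hdvd with h1 | h1
  · rcases hpZ.dvd_or_dvd h1 with h2 | h2
    · exact hlc (hpZ.dvd_of_dvd_pow h2)
    · exact hf0 (hpZ.dvd_of_dvd_pow h2)
  · exact hz h1

/-- If `r` and `r⁻¹` are integral at `p`, a set with power differences is finite. -/
lemma HasPowerDifferences.finite_of_aeval_eq_zero (hX : HasPowerDifferences p r X) (hp : p.Prime)
    (hr : r ≠ 0) {f : ℤ[X]} (hf : aeval r f = 0) (hlc : ¬ (p : ℤ) ∣ f.leadingCoeff)
    (hf0 : ¬ (p : ℤ) ∣ f.coeff 0) : X.Finite := by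
  by_contra hinf
  have : Fact p.Prime := ⟨hp⟩
  set fp : (ZMod p)[X] := f.map (Int.castRingHom (ZMod p)) with hfp
  have hfp0 : fp ≠ 0 := by
    intro h
    have h1 := congrArg (fun g => coeff g 0) h
    simp only [hfp, coeff_map, eq_intCast, coeff_zero, ZMod.intCast_zmod_eq_zero_iff_dvd] at h1
    exact hf0 h1
  have : Module.Finite (ZMod p) (AdjoinRoot fp) := (AdjoinRoot.powerBasis hfp0).finite
  have : Finite (AdjoinRoot fp) := Module.finite_of_finite (ZMod p)
  obtain ⟨x₀, hx₀⟩ := Set.Infinite.nonempty hinf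
  have hrep : ∀ x ∈ X, ∃ (k : ℕ) (z : ℤ), x - x₀ = r ^ k * z := fun x hx => by
    by_cases h : x = x₀
    · exact ⟨0, 0, by simp [h]⟩
    · obtain ⟨k, z, -, h⟩ := hX x hx x₀ hx₀ h
      exact ⟨k, z, h⟩
  choose! k z hkz using hrep
  obtain ⟨x, hx, y, hy, hne, hxy⟩ := Set.Infinite.exists_ne_map_eq_of_mapsTo
    (f := fun x => AdjoinRoot.mk fp (C (z x : ZMod p) * Polynomial.X ^ k x))
    hinf (Set.mapsTo_univ _ _) Set.finite_univ
  rw [AdjoinRoot.mk_eq_mk] at hxy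
  obtain ⟨g, hg⟩ := hxy
  obtain ⟨g', rfl⟩ := map_surjective (Int.castRingHom (ZMod p)) ZMod.intCast_surjective g
  set e : ℤ[X] := C (z x) * Polynomial.X ^ k x - C (z y) * Polynomial.X ^ k y - f * g' with he
  have hemap : e.map (Int.castRingHom (ZMod p)) = 0 := by
    have h1 : (f * g').map (Int.castRingHom (ZMod p)) =
        fp * g'.map (Int.castRingHom (ZMod p)) := Polynomial.map_mul _
    rw [he, Polynomial.map_sub, h1, ← hg]
    simp
  have hdvd : (C (p : ℤ)) ∣ e := by
    rw [C_dvd_iff_dvd_coeff]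
    intro i
    have := congrArg (fun q => coeff q i) hemap
    simpa [coeff_map, ZMod.intCast_zmod_eq_zero_iff_dvd] using this
  obtain ⟨h, hh⟩ := hdvd
  have hev := congrArg (aeval r) hh
  rw [he] at hev
  simp only [map_sub, map_mul, aeval_C, map_pow, aeval_X, hf, zero_mul, sub_zero] at hev
  simp only [algebraMap_int_eq, eq_intCast, Int.cast_natCast] at hev
  obtain ⟨k', z', hz', hxy⟩ := hX x hx y hy hne
  refine pow_mul_ne_prime_mul_aeval hp hr hf hlc hf0 k' hz' h ?_
  rw [← hev, ← hxy, mul_comm _ (r ^ k x), mul_comm _ (r ^ k y), ← hkz x hx, ← hkz y hy]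
  ring

/-- Relations among differences of X, divided by the lowest power of r, appear in this shape; only
the two extreme coefficients need to be prime to p. -/
lemma HasPowerDifferences.finite_of_add_monomial (hX : HasPowerDifferences p r X) (hp : p.Prime)
    (hr : r ≠ 0) {g : ℤ[X]} {d : ℕ} {z : ℤ} (hg : g.natDegree < d) (hg0 : ¬ (p : ℤ) ∣ g.coeff 0)
    (hz : ¬ (p : ℤ) ∣ z) (h : aeval r g + r ^ d * z = 0) : X.Finite := by
  have hz0 : z ≠ 0 := fun h0 => hz (h0 ▸ dvd_zero _)
  have hg1 : g ≠ 0 := fun h0 => hg0 (by simp [h0])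
  have hdeg : g.degree < (monomial d z).degree := by
    rw [degree_monomial _ hz0, degree_eq_natDegree hg1]
    exact_mod_cast hg
  refine hX.finite_of_aeval_eq_zero hp hr (f := g + monomial d z) ?_ ?_ ?_
  · rw [map_add, aeval_monomial]
    simp only [algebraMap_int_eq, eq_intCast]
    rw [← h]
    ring
  · rwa [leadingCoeff_add_of_degree_lt hdeg, leadingCoeff_monomial]
  · rwa [coeff_add, coeff_monomial, if_neg (by omega), add_zero]

/-- In an infinite set with power differences the exponents are determined. -/
lemma HasPowerDifferences.exponent_unique (hX : HasPowerDifferences p r X) (hinf : X.Infinite)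
    (hp : p.Prime) (hr : r ≠ 0) {k l : ℕ} {z w : ℤ} (hz : ¬ (p : ℤ) ∣ z) (hw : ¬ (p : ℤ) ∣ w)
    (h : r ^ k * z = r ^ l * w) : k = l := by
  have key : ∀ {k l : ℕ} {z w : ℤ}, ¬ (p : ℤ) ∣ z → ¬ (p : ℤ) ∣ w → r ^ k * z = r ^ l * w →
      ¬ k < l := by
    intro k l z w hz hw h hlt
    refine hinf (hX.finite_of_add_monomial hp hr (g := C (-z)) (d := l - k) (z := w)
      (by rw [natDegree_C]; omega) (by simpa using hz) hw ?_)
    have h2 : r ^ l = r ^ k * r ^ (l - k) := by rw [← pow_add]; congr 1; omega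
    rw [h2, mul_assoc] at h
    have := mul_left_cancel₀ (pow_ne_zero k hr) h
    simp [← this]
  exact le_antisymm (not_lt.1 (key hw hz h.symm)) (not_lt.1 (key hz hw h))

/-- In an infinite set with power differences, the exponents of a triangle are not distinct. -/
lemma HasPowerDifferences.exponents_not_distinct (hX : HasPowerDifferences p r X)
    (hinf : X.Infinite) (hp : p.Prime) (hr : r ≠ 0) {i j k : ℕ} {x y z : ℤ} (hx : ¬ (p : ℤ) ∣ x)
    (hy : ¬ (p : ℤ) ∣ y) (hz : ¬ (p : ℤ) ∣ z) (h : r ^ i * x + r ^ j * y + r ^ k * z = 0)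
    (hij : i ≠ j) (hjk : j ≠ k) (hik : i ≠ k) : False := by
  have key : ∀ {i j k : ℕ} {x y z : ℤ}, ¬ (p : ℤ) ∣ x → ¬ (p : ℤ) ∣ z → i < j → j < k →
      r ^ i * x + r ^ j * y + r ^ k * z = 0 → False := by
    intro i j k x y z hx hz hij hjk h
    refine hinf (hX.finite_of_add_monomial hp hr (g := C x + monomial (j - i) y) (d := k - i)
      (z := z) ?_ ?_ hz ?_)
    · refine lt_of_le_of_lt (natDegree_add_le _ _) (max_lt ?_ ?_)
      · rw [natDegree_C]
        omega
      · exact lt_of_le_of_lt (natDegree_monomial_le _) (by omega)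
    · rwa [coeff_add, coeff_C_zero, coeff_monomial, if_neg (by omega), add_zero]
    · have h2 : r ^ j = r ^ i * r ^ (j - i) := by rw [← pow_add]; congr 1; omega
      have h3 : r ^ k = r ^ i * r ^ (k - i) := by rw [← pow_add]; congr 1; omega
      have h4 : r ^ i * (x + y * r ^ (j - i) + r ^ (k - i) * z) = 0 := by
        rw [← h, h2, h3]
        ring
      simpa [aeval_monomial] using (mul_eq_zero.1 h4).resolve_left (pow_ne_zero i hr)
  rcases lt_or_gt_of_ne hij with h1 | h1 <;> rcases lt_or_gt_of_ne hjk with h2 | h2 <;>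
    rcases lt_or_gt_of_ne hik with h3 | h3
  · exact key hx hz h1 h2 h
  · omega
  · exact key (y := z) hx hy h3 h2 (by linarith)
  · exact key (y := x) hz hy h3 h1 (by linarith)
  · exact key (y := x) hy hz h1 h3 (by linarith)
  · exact key (y := z) hy hx h2 h3 (by linarith)
  · omega
  · exact key (y := y) hz hx h2 h1 (by linarith)

/-- Comparison of `p`-adic valuations when a power of `r` is rational. -/
lemma valuation_relation (hp : p.Prime) {n : ℕ} {w : ℚ} (hw : r ^ n = w) (hr : r ≠ 0) {k l : ℕ}
    {x y : ℚ} (hx : x ≠ 0) (hy : y ≠ 0) (h : r ^ k * x = r ^ l * y) :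
    k * padicValRat p w + n * padicValRat p x = l * padicValRat p w + n * padicValRat p y := by
  have : Fact p.Prime := ⟨hp⟩
  have hw0 : w ≠ 0 := by
    intro h0
    rw [h0, Rat.cast_zero] at hw
    exact pow_ne_zero n hr hw
  have h1 : w ^ k * x ^ n = w ^ l * y ^ n := by
    have h2 := congrArg (· ^ n) h
    simp only [mul_pow, ← pow_mul, mul_comm _ n] at h2
    rw [pow_mul, pow_mul, hw] at h2
    exact_mod_cast h2
  have h2 := congrArg (padicValRat p) h1
  rwa [padicValRat.mul (pow_ne_zero _ hw0) (pow_ne_zero _ hx),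
    padicValRat.mul (pow_ne_zero _ hw0) (pow_ne_zero _ hy), padicValRat.pow, padicValRat.pow,
    padicValRat.pow, padicValRat.pow] at h2

lemma padicValRat_intCast_of_not_dvd {z : ℤ} (hz : ¬ (p : ℤ) ∣ z) :
    padicValRat p (z : ℚ) = 0 := by
  rw [padicValRat.of_int, padicValInt.eq_zero_of_not_dvd hz]
  rfl

lemma padicValRat_intCast_nonneg (z : ℤ) : 0 ≤ padicValRat p (z : ℚ) := by
  rw [padicValRat.of_int]
  positivity

/-- An infinite set with power differences has two different exponents at some vertex. -/
lemma HasPowerDifferences.exists_two_exponents (hX : HasPowerDifferences p r X)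
    (hinf : X.Infinite) (hp : p.Prime) (hr : r ≠ 0) :
    ∃ x ∈ X, ∃ y ∈ X, ∃ y' ∈ X, y ≠ y' ∧ ∃ (k l : ℕ) (z w : ℤ), k < l ∧ ¬ (p : ℤ) ∣ z ∧
      ¬ (p : ℤ) ∣ w ∧ x - y = r ^ k * z ∧ x - y' = r ^ l * w := by
  by_contra! hcon
  -- Under the negation all differences at a vertex share one exponent, hence all points share the
  -- exponent K relative to x₀. Pigeonholing z modulo p then makes some difference divisible by p.
  have hsame : ∀ x ∈ X, ∀ y ∈ X, ∀ y' ∈ X, ∀ (k l : ℕ) (z w : ℤ), ¬ (p : ℤ) ∣ z →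
      ¬ (p : ℤ) ∣ w → x - y = r ^ k * z → x - y' = r ^ l * w → k = l := by
    intro x hx y hy y' hy' k l z w hz hw h1 h2
    by_cases hyy : y = y'
    · subst hyy
      exact hX.exponent_unique hinf hp hr hz hw (h1.symm.trans h2)
    · refine le_antisymm (not_lt.1 fun hlt => ?_) (not_lt.1 fun hlt => ?_)
      · exact hcon x hx y' hy' y hy (Ne.symm hyy) l k w z hlt hw hz h2 h1
      · exact hcon x hx y hy y' hy' hyy k l z w hlt hz hw h1 h2
  obtain ⟨x₀, hx₀⟩ := hinf.nonempty
  obtain ⟨x₁, hx₁, hne⟩ : ∃ x₁ ∈ X, x₁ ≠ x₀ := by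
    by_contra! h
    exact hinf ((Set.finite_singleton x₀).subset h)
  obtain ⟨K, z₁, hz₁, h01⟩ := hX x₀ hx₀ x₁ hx₁ hne.symm
  have hconst : ∀ x ∈ X, x ≠ x₀ → ∃ z : ℤ, ¬ (p : ℤ) ∣ z ∧ x₀ - x = r ^ K * z := by
    intro x hx h
    obtain ⟨k, z, hz, hxz⟩ := hX x₀ hx₀ x hx h.symm
    have := hsame x₀ hx₀ x₁ hx₁ x hx K k z₁ z hz₁ hz h01 hxz
    exact ⟨z, hz, this ▸ hxz⟩
  choose! z hz hxz using hconst
  have : NeZero p := ⟨hp.ne_zero⟩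
  have hinf' : (X \ {x₀}).Infinite := hinf.sdiff (Set.finite_singleton _)
  obtain ⟨x, hx, y, hy, hxy, hzz⟩ := hinf'.exists_ne_map_eq_of_mapsTo
    (f := fun x => ((z x : ℤ) : ZMod p)) (Set.mapsTo_univ _ _) Set.finite_univ
  have hx1 := hxz x hx.1 hx.2
  have hy1 := hxz y hy.1 hy.2
  obtain ⟨k, w, hw, hxyw⟩ := hX x hx.1 y hy.1 hxy
  have hk : K = k := by
    refine hsame x hx.1 x₀ hx₀ y hy.1 K k (-z x) w (by simpa using hz x hx.1 hx.2) hw ?_ hxyw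
    push_cast
    linarith
  subst hk
  apply hw
  have h3 : r ^ K * (w : ℝ) = r ^ K * ((z y - z x : ℤ) : ℝ) := by
    push_cast
    linarith
  have h4 : w = z y - z x := by exact_mod_cast mul_left_cancel₀ (pow_ne_zero K hr) h3
  rw [h4, ← ZMod.intCast_zmod_eq_zero_iff_dvd]
  push_cast
  rw [hzz, sub_self]

end Arithmetic

/-! ### Rationality and p-adic valuation of powers of r -/

section Valuation

open Polynomial

variable {p : ℕ} {r : ℝ} {X : Set ℝ}

/-- Some power of `r` is a rational number whose numerator is divisible by `p`. -/
lemma HasPowerDifferences.exists_pow_eq_ratCast (hX : HasPowerDifferences p r X)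
    (hinf : X.Infinite) (hp : p.Prime) (hr : 1 < r) :
    ∃ n : ℕ, 1 ≤ n ∧ ∃ w : ℚ, r ^ n = w ∧ 0 < padicValRat p w := by
  have hr0 : r ≠ 0 := by linarith
  have : Fact p.Prime := ⟨hp⟩
  have hnz : ∀ {z : ℤ}, ¬ (p : ℤ) ∣ z → z ≠ 0 := fun hz h0 => hz (h0 ▸ dvd_zero _)
  -- A triangle with two different exponents has its third exponent among them, so its relation
  -- involves only two powers of r.
  have htri : ∀ {k l m : ℕ} {z w v : ℤ}, k < l → ¬ (p : ℤ) ∣ z → ¬ (p : ℤ) ∣ w → ¬ (p : ℤ) ∣ v →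
      r ^ l * (w : ℝ) - r ^ k * z = r ^ m * v →
        r ^ k * ((z + v : ℤ) : ℝ) = r ^ l * (w : ℤ) ∨
        r ^ k * (z : ℝ) = r ^ l * ((w - v : ℤ) : ℝ) := by
    intro k l m z w v hkl hz hw hv h
    have hm : m = k ∨ m = l := by
      by_contra! hcon
      exact hX.exponents_not_distinct hinf hp hr0 (i := k) (j := m) (k := l) (x := z) (y := v)
        (z := -w) hz hv (by simpa using hw) (by push_cast; linarith) hcon.1.symm hcon.2 hkl.ne
    rcases hm with rfl | rfl
    · left; push_cast; linarith
    · right; push_cast; linarith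
  have hsub : ∀ {k l : ℕ}, k < l → r ^ l = r ^ k * r ^ (l - k) := fun {k l} h => by
    rw [← pow_add]; congr 1; omega
  obtain ⟨x₀, hx₀, y₀, hy₀, y₁, hy₁, hne, k₀, l₀, z₀, z₁, hkl, hz₀, hz₁, h0, h1⟩ :=
    hX.exists_two_exponents hinf hp hr0
  obtain ⟨m, v, hv, hm⟩ := hX y₀ hy₀ y₁ hy₁ hne
  obtain ⟨w, hw⟩ : ∃ w : ℚ, r ^ (l₀ - k₀) = w := by
    rcases htri hkl hz₀ hz₁ hv (m := m) (by linarith) with h | h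
    · refine ⟨(z₀ + v : ℤ) / z₁, ?_⟩
      rw [hsub hkl, mul_assoc] at h
      have h2 := mul_left_cancel₀ (pow_ne_zero k₀ hr0) h
      have : (z₁ : ℝ) ≠ 0 := by exact_mod_cast hnz hz₁
      push_cast at h2 ⊢
      field_simp
      linarith
    · refine ⟨z₀ / (z₁ - v : ℤ), ?_⟩
      rw [hsub hkl, mul_assoc] at h
      have h2 := mul_left_cancel₀ (pow_ne_zero k₀ hr0) h
      have h3 : ((z₁ - v : ℤ) : ℝ) ≠ 0 := by
        intro h4
        rw [h4, mul_zero] at h2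
        exact hnz hz₀ (by exact_mod_cast h2)
      rw [Rat.cast_div, Rat.cast_intCast, Rat.cast_intCast, eq_div_iff h3, h2]
  set n := l₀ - k₀ with hn
  have hn1 : 1 ≤ n := by omega
  refine ⟨n, hn1, w, hw, ?_⟩
  by_contra! hle
  rcases hle.eq_or_lt with h | hneg
  · have hw0 : w ≠ 0 := by
      intro h0
      rw [h0, Rat.cast_zero] at hw
      exact pow_ne_zero n hr0 hw
    have hboth : ¬ (p : ℤ) ∣ w.num ∧ ¬ (p : ℤ) ∣ (w.den : ℤ) := by
      have hcop := w.reduced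
      rw [padicValRat_def, sub_eq_zero] at h
      have hiff : (p : ℤ) ∣ w.num ↔ p ∣ w.den := by
        rw [← Int.natCast_dvd_natCast, ← not_iff_not]
        have e1 := padicValInt.eq_zero_iff (p := p) (z := w.num)
        have e2 := dvd_iff_padicValNat_ne_zero (p := p) w.den_nz
        rw [Int.natCast_dvd_natCast, e2, not_not]
        have h' : padicValInt p w.num = padicValNat p w.den := by exact_mod_cast h
        rw [← h', e1]
        constructor
        · exact fun h => Or.inr (Or.inr h)
        · rintro (h | h | h)
          · exact absurd h hp.one_lt.ne'
          · exact absurd (Rat.num_eq_zero.1 h) hw0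
          · exact h
      have hnot : ¬ p ∣ w.den := fun hd => by
        have hn := Int.natCast_dvd.1 (hiff.2 hd)
        exact hp.one_lt.ne' (Nat.dvd_one.1 (hcop ▸ Nat.dvd_gcd hn hd))
      exact ⟨fun h => hnot (hiff.1 h), fun h => hnot (Int.natCast_dvd_natCast.1 h)⟩
    refine hinf (hX.finite_of_add_monomial hp hr0 (g := C (-w.num)) (d := n) (z := w.den)
      (by rw [natDegree_C]; omega) (by simpa using hboth.1) hboth.2 ?_)
    rw [hw]
    have hden : (w.den : ℝ) ≠ 0 := by exact_mod_cast w.den_nz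
    have h3 : ((w : ℚ) : ℝ) * w.den = w.num := by exact_mod_cast Rat.mul_den_eq_num w
    simp [h3]
  · set E := padicValRat p w with hE
    -- Negative valuation: with exponent l > k₀ the triangle x₀, y₀, y admits two relations. One
    -- contradicts valuations; the other bounds r^l by absolute values.
    have hbound : ∀ y ∈ X, y ≠ x₀ → ∀ (l : ℕ) (z : ℤ), ¬ (p : ℤ) ∣ z → x₀ - y = r ^ l * z →
        r ^ l ≤ r ^ k₀ * |(z₀ : ℝ)| := by
      intro y hy hyx l z hz hyz
      have habs : (1 : ℝ) ≤ |(z₀ : ℝ)| := by exact_mod_cast Int.one_le_abs (hnz hz₀)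
      by_cases hlk : l ≤ k₀
      · have := pow_le_pow_right₀ hr.le hlk
        nlinarith [pow_pos (by linarith : 0 < r) k₀]
      · push Not at hlk
        have hyy : y₀ ≠ y := by
          rintro rfl
          have := hX.exponent_unique hinf hp hr0 hz₀ hz (h0.symm.trans hyz)
          omega
        obtain ⟨m, v, hv, hm⟩ := hX y₀ hy₀ y hy hyy
        rcases htri hlk hz₀ hz hv (m := m) (by linarith) with h | h
        · exfalso
          have h2 : z₀ + v ≠ 0 := by
            intro h2
            rw [h2, Int.cast_zero, mul_zero] at h
            have h3 := mul_eq_zero.1 h.symm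
            rcases h3 with h3 | h3
            · exact pow_ne_zero l hr0 h3
            · exact hnz hz (by exact_mod_cast h3)
          have h3 := valuation_relation hp hw hr0 (x := ((z₀ + v : ℤ) : ℚ)) (y := (z : ℚ))
            (by exact_mod_cast h2) (by exact_mod_cast hnz hz) (by exact_mod_cast h)
          rw [padicValRat_intCast_of_not_dvd hz] at h3
          have h4 := padicValRat_intCast_nonneg (p := p) (z₀ + v)
          have h5 : (k₀ : ℤ) < l := by exact_mod_cast hlk
          have h6 : (0 : ℤ) ≤ n * padicValRat p ((z₀ + v : ℤ) : ℚ) := by positivity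
          nlinarith
        · have h2 : z - v ≠ 0 := by
            intro h2
            rw [h2, Int.cast_zero, mul_zero] at h
            rcases mul_eq_zero.1 h with h3 | h3
            · exact pow_ne_zero k₀ hr0 h3
            · exact hnz hz₀ (by exact_mod_cast h3)
          have h3 : (1 : ℝ) ≤ |((z - v : ℤ) : ℝ)| := by exact_mod_cast Int.one_le_abs h2
          have h4 := congrArg abs h
          have h5 : 0 < r := by linarith
          rw [abs_mul, abs_mul, abs_of_pos (pow_pos h5 _), abs_of_pos (pow_pos h5 _)] at h4
          rw [h4]
          exact le_mul_of_one_le_right (pow_pos h5 _).le h3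
    obtain ⟨K, hK⟩ := pow_unbounded_of_one_lt (r ^ k₀ * |(z₀ : ℝ)|) hr
    -- B exceeds K(-E). Two points with equal exponent and residues agreeing modulo p^B would have a
    -- difference of positive valuation, whereas r^m v with p ∤ v cannot have one when E < 0.
    set B : ℕ := (K * (-E)).toNat + 1 with hB
    have hBE : (K : ℤ) * (-E) < B := by
      have := Int.self_le_toNat (K * (-E))
      push_cast [hB]
      linarith
    have hrep : ∀ y ∈ X, y ≠ x₀ → ∃ (l : ℕ) (z : ℤ), ¬ (p : ℤ) ∣ z ∧ x₀ - y = r ^ l * z ∧ l ≤ K := by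
      intro y hy hyx
      obtain ⟨l, z, hz, h⟩ := hX x₀ hx₀ y hy hyx.symm
      refine ⟨l, z, hz, h, ?_⟩
      have := (hbound y hy hyx l z hz h).trans hK.le
      exact (pow_le_pow_iff_right₀ hr).1 this
    choose! l z hz hlz hlK using hrep
    have : NeZero (p ^ B) := ⟨pow_ne_zero _ hp.ne_zero⟩
    have hinf' : (X \ {x₀}).Infinite := hinf.sdiff (Set.finite_singleton _)
    obtain ⟨y, hy, y', hy', hyy, heq⟩ := hinf'.exists_ne_map_eq_of_mapsTo
      (f := fun y => (l y, ((z y : ℤ) : ZMod (p ^ B)))) (t := Set.Iic K ×ˢ Set.univ)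
      (fun y hy => ⟨hlK y hy.1 hy.2, Set.mem_univ _⟩)
      ((Set.finite_Iic K).prod Set.finite_univ)
    simp only [Prod.mk.injEq] at heq
    obtain ⟨hl, hzz⟩ := heq
    have e1 := hlz y hy.1 hy.2
    have e2 := hlz y' hy'.1 hy'.2
    rw [← hl] at e2
    obtain ⟨m, v, hv, hm⟩ := hX y hy.1 y' hy'.1 hyy
    have hrel : r ^ l y * (((z y' - z y : ℤ) : ℚ) : ℝ) = r ^ m * ((v : ℚ) : ℝ) := by
      push_cast
      linarith
    have hd0 : z y' - z y ≠ 0 := by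
      intro h
      rw [h] at hrel
      simp only [Int.cast_zero, Rat.cast_zero, mul_zero, Rat.cast_intCast] at hrel
      rcases mul_eq_zero.1 hrel.symm with h3 | h3
      · exact pow_ne_zero m hr0 h3
      · exact hnz hv (by exact_mod_cast h3)
    have hval := valuation_relation hp hw hr0 (x := ((z y' - z y : ℤ) : ℚ)) (y := (v : ℚ))
      (by exact_mod_cast hd0) (by exact_mod_cast hnz hv) hrel
    rw [padicValRat_intCast_of_not_dvd hv, mul_zero, add_zero, ← hE] at hval
    have hdvd : ((p : ℤ) ^ B) ∣ z y' - z y := by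
      have : (((z y' - z y : ℤ)) : ZMod (p ^ B)) = 0 := by
        push_cast
        rw [hzz, sub_self]
      rw [ZMod.intCast_zmod_eq_zero_iff_dvd] at this
      exact_mod_cast this
    have hvB : (B : ℤ) ≤ padicValRat p ((z y' - z y : ℤ) : ℚ) := by
      rw [padicValRat.of_int]
      have := (padicValInt_dvd_iff B (z y' - z y)).1 hdvd
      exact_mod_cast this.resolve_left hd0
    have hly : (l y : ℤ) ≤ K := by exact_mod_cast hlK y hy.1 hy.2
    have hm0 : (0 : ℤ) ≤ m := by positivity
    have hn1' : (1 : ℤ) ≤ n := by exact_mod_cast hn1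
    have h7 : (B : ℤ) ≤ n * padicValRat p ((z y' - z y : ℤ) : ℚ) := by nlinarith
    nlinarith

/-- The smaller exponent at a vertex is the exponent of the opposite side. -/
lemma exponent_eq_of_lt (hX : HasPowerDifferences p r X) (hinf : X.Infinite) (hp : p.Prime)
    (hr : 1 < r) {k l m : ℕ} {z w v : ℤ} (hkl : k < l) (hz : ¬ (p : ℤ) ∣ z)
    (hw : ¬ (p : ℤ) ∣ w) (hv : ¬ (p : ℤ) ∣ v)
    (h : r ^ l * (w : ℝ) - r ^ k * z = r ^ m * v) : m = k := by
  have hr0 : r ≠ 0 := by linarith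
  obtain ⟨n, hn, q, hq, hE⟩ := hX.exists_pow_eq_ratCast hinf hp hr
  have hnz : ∀ {z : ℤ}, ¬ (p : ℤ) ∣ z → z ≠ 0 := fun hz h0 => hz (h0 ▸ dvd_zero _)
  by_contra hmk
  have hml : m = l := by
    by_contra hml
    exact hX.exponents_not_distinct hinf hp hr0 (i := k) (j := m) (k := l) (x := z) (y := v)
        (z := -w) hz hv (by simpa using hw) (by push_cast; linarith) (Ne.symm hmk) hml hkl.ne
  subst hml
  -- The remaining case m = l would give r^k z = r^l (w - v), impossible by valuations as k < l and
  -- p ∤ z.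
  have h2 : r ^ k * ((z : ℚ) : ℝ) = r ^ m * (((w - v : ℤ) : ℚ) : ℝ) := by
    push_cast
    linarith
  have h3 : w - v ≠ 0 := by
    intro h3
    rw [h3] at h2
    simp only [Int.cast_zero, Rat.cast_zero, mul_zero, Rat.cast_intCast] at h2
    rcases mul_eq_zero.1 h2 with h4 | h4
    · exact pow_ne_zero k hr0 h4
    · exact hnz hz (by exact_mod_cast h4)
  have h4 := valuation_relation hp hq hr0 (x := (z : ℚ)) (y := ((w - v : ℤ) : ℚ))
    (by exact_mod_cast hnz hz) (by exact_mod_cast h3) h2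
  rw [padicValRat_intCast_of_not_dvd hz] at h4
  have h5 := padicValRat_intCast_nonneg (p := p) (w - v)
  have h6 : (0 : ℤ) ≤ n * padicValRat p ((w - v : ℤ) : ℚ) := by positivity
  have h7 : (k : ℤ) < m := by exact_mod_cast hkl
  nlinarith

/-- Two sides with equal exponent bound the exponent of the third side from below. -/
lemma exponent_le_of_eq (hX : HasPowerDifferences p r X) (hinf : X.Infinite) (hp : p.Prime)
    (hr : 1 < r) {k m : ℕ} {z w v : ℤ} (hv : ¬ (p : ℤ) ∣ v)
    (h : r ^ k * (w : ℝ) - r ^ k * z = r ^ m * v) : k ≤ m := by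
  have hr0 : r ≠ 0 := by linarith
  obtain ⟨n, hn, q, hq, hE⟩ := hX.exists_pow_eq_ratCast hinf hp hr
  have hnz : ∀ {z : ℤ}, ¬ (p : ℤ) ∣ z → z ≠ 0 := fun hz h0 => hz (h0 ▸ dvd_zero _)
  have h2 : r ^ k * (((w - z : ℤ) : ℚ) : ℝ) = r ^ m * ((v : ℚ) : ℝ) := by
    push_cast
    linarith
  have h3 : w - z ≠ 0 := by
    intro h3
    rw [h3] at h2
    simp only [Int.cast_zero, Rat.cast_zero, mul_zero, Rat.cast_intCast] at h2
    rcases mul_eq_zero.1 h2.symm with h4 | h4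
    · exact pow_ne_zero m hr0 h4
    · exact hnz hv (by exact_mod_cast h4)
  have h4 := valuation_relation hp hq hr0 (x := ((w - z : ℤ) : ℚ)) (y := (v : ℚ))
    (by exact_mod_cast h3) (by exact_mod_cast hnz hv) h2
  rw [padicValRat_intCast_of_not_dvd hv] at h4
  have h5 := padicValRat_intCast_nonneg (p := p) (w - z)
  have h6 : (0 : ℤ) ≤ n * padicValRat p ((w - z : ℤ) : ℚ) := by positivity
  by_contra! hlt
  have h7 : (m : ℤ) < k := by exact_mod_cast hlt
  nlinarith

end Valuation

/-! ### Spectra: every level occurs as a difference -/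

section Levels

variable {p : ℕ} {ρ c : ℝ} {a : Fin 2 → ℤ} {D : Finset (Fin 2 → ℤ)}

lemma partialMask_eq_zero {r : ℝ} {n k : ℕ} (hk1 : 1 ≤ k) (hkn : k ≤ n) {ξ : Plane}
    (h : mask D (shear r c (-k) ξ) = 0) : partialMask D r c n ξ = 0 := by
  refine Finset.prod_eq_zero (Finset.mem_range.2 (by omega : k - 1 < n)) ?_
  convert h using 3
  omega

/-- A spectrum has differences which are zeros of the mask at any prescribed level only. -/
lemma exists_difference_of_level (h0 : 0 < ρ) (h1 : ρ < 1) (hp : p.Prime)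
    (ha0 : ¬ (p : ℤ) ∣ a 0) (hD : D.Nonempty) (hz : HasLatticeZeros p a D) {Λ : Set Plane}
    (hsum : ∀ ξ, HasSum (fun l : Λ => ‖affineFourier ρ c D (ξ - l)‖ ^ 2) 1) {K : ℕ} (hK : 1 ≤ K) :
    ∃ l ∈ Λ, ∃ l' ∈ Λ, l ≠ l' ∧
      ∀ k : ℕ, 1 ≤ k → mask D (shear ρ⁻¹ c (-k) (l - l')) = 0 → k = K := by
  classical
  by_contra! hcon
  have hr : 1 < ρ⁻¹ := (one_lt_inv₀ h0).2 h1
  have hr0 : ρ⁻¹ ≠ 0 := by linarith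
  have hF := isFourierTransform_affineFourier (c := c) h0 h1 hD
  -- The product with its K-th factor removed. It is again the transform of a probability measure,
  -- and by assumption Λ remains orthogonal for it.
  set g : Plane → ℂ := fun ξ =>
    partialMask D ρ⁻¹ c (K - 1) ξ * affineFourier ρ c D (shear ρ⁻¹ c (-K) ξ) with hg
  have hgF : IsFourierTransform g :=
    (isFourierTransform_partialMask c hD _).mul (hF.comp_shear c _)
  have hfac : ∀ ξ, affineFourier ρ c D ξ = mask D (shear ρ⁻¹ c (-K) ξ) * g ξ := by
    intro ξ
    have e1 := affineFourier_eq_partialMask_mul (c := c) h0 h1 hD K ξ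
    have e2 := partialMask_add (D := D) c hr0 (K - 1) 1 ξ
    have e3 : -1 + -((K - 1 : ℕ) : ℤ) = -K := by omega
    rw [partialMask_one, shear_shear c hr0, e3, Nat.sub_add_cancel hK] at e2
    rw [e1, e2, hg]
    ring
  have hgzero : ∀ l ∈ Λ, ∀ l' ∈ Λ, l ≠ l' → g (l - l') = 0 := by
    intro l hl l' hl' hne
    obtain ⟨k, hk1, hk, hkK⟩ := hcon l hl l' hl' hne
    rcases lt_or_gt_of_ne hkK with hlt | hgt
    · simp only [hg, partialMask_eq_zero hk1 (by omega : k ≤ K - 1) hk, zero_mul]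
    · have e1 := affineFourier_eq_partialMask_mul (c := c) h0 h1 hD (k - K)
        (shear ρ⁻¹ c (-K) (l - l'))
      have e2 : partialMask D ρ⁻¹ c (k - K) (shear ρ⁻¹ c (-K) (l - l')) = 0 := by
        refine partialMask_eq_zero (k := k - K) (by omega) le_rfl ?_
        rw [shear_shear c hr0]
        convert hk using 3
        omega
      simp only [hg, e1, e2, zero_mul, mul_zero]
  obtain ⟨l₀, hl₀⟩ : Λ.Nonempty := by
    rw [Set.nonempty_iff_ne_empty]
    rintro rfl
    have := (hsum 0).unique (hasSum_empty)
    exact one_ne_zero this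
  obtain ⟨n, hn⟩ : ∃ n : ℕ, g ![1 / ((n : ℝ) + 2), 0] ≠ 0 := by
    have ht : Tendsto (fun n : ℕ => (![1 / ((n : ℝ) + 2), 0] : Plane)) atTop (𝓝 0) := by
      rw [tendsto_pi_nhds]
      intro i
      fin_cases i
      · have h2 := tendsto_one_div_add_atTop_nhds_zero_nat (𝕜 := ℝ)
        refine ((tendsto_add_atTop_iff_nat 1).2 h2).congr fun n => ?_
        simp only [Fin.zero_eta, Matrix.cons_val_zero]
        push_cast
        ring_nf
      · simp
    have h2 := (hgF.continuous.tendsto 0).comp ht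
    rw [hgF.apply_zero] at h2
    exact (h2.eventually_ne one_ne_zero).exists
  -- Close to 0, so g(e) ≠ 0; and A^{-K} e has first coordinate strictly between 0 and 1, so the
  -- removed factor has modulus less than 1 there.
  set e : Plane := ![1 / ((n : ℝ) + 2), 0] with he
  have hmask : ‖mask D (shear ρ⁻¹ c (-K) e)‖ < 1 := by
    refine norm_mask_lt_one hp ha0 hD hz fun N hN => ?_
    rw [shear_apply_zero, zpow_neg, zpow_natCast, he, Matrix.cons_val_zero] at hN
    have hpos : 0 < ((ρ⁻¹ : ℝ) ^ K)⁻¹ * (1 / ((n : ℝ) + 2)) := by positivity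
    have hlt : ((ρ⁻¹ : ℝ) ^ K)⁻¹ * (1 / ((n : ℝ) + 2)) < 1 := by
      refine mul_lt_one_of_nonneg_of_lt_one_left (by positivity)
        (inv_lt_one_of_one_lt₀ (one_lt_pow₀ hr (by omega))) ?_
      rw [div_le_one (by positivity)]
      have : (0 : ℝ) ≤ n := by positivity
      linarith
    rw [hN] at hpos hlt
    have hN1 : 0 < N := by exact_mod_cast hpos
    have hN2 : N < 1 := by exact_mod_cast hlt
    omega
  -- Bessel for g bounds the sum by 1, and the term of l₀ loses a fixed amount in passing from g to
  -- F; so the total of F stays below 1.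
  have hS : ∀ S : Finset Λ, ∑ l ∈ S, ‖affineFourier ρ c D (l₀ + e - l)‖ ^ 2 ≤
      1 - (1 - ‖mask D (shear ρ⁻¹ c (-K) e)‖ ^ 2) * ‖g e‖ ^ 2 := by
    intro S
    set b₀ : Λ := ⟨l₀, hl₀⟩ with hb₀
    have hbes := hgF.sum_norm_sq_le_one ((insert b₀ S).image Subtype.val) (by
      intro l hl l' hl' hne
      obtain ⟨x, -, rfl⟩ := Finset.mem_image.1 hl
      obtain ⟨x', -, rfl⟩ := Finset.mem_image.1 hl'
      exact hgzero _ x.2 _ x'.2 hne) (l₀ + e)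
    rw [Finset.sum_image Subtype.val_injective.injOn] at hbes
    have hmem : b₀ ∈ insert b₀ S := Finset.mem_insert_self _ _
    rw [← Finset.add_sum_erase _ _ hmem] at hbes
    have hle : ∑ l ∈ S, ‖affineFourier ρ c D (l₀ + e - l)‖ ^ 2 ≤
        ∑ l ∈ insert b₀ S, ‖affineFourier ρ c D (l₀ + e - l)‖ ^ 2 :=
      Finset.sum_le_sum_of_subset_of_nonneg (Finset.subset_insert _ _) fun _ _ _ => by positivity
    rw [← Finset.add_sum_erase _ _ hmem] at hle
    have hle2 : ∑ l ∈ (insert b₀ S).erase b₀, ‖affineFourier ρ c D (l₀ + e - l)‖ ^ 2 ≤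
        ∑ l ∈ (insert b₀ S).erase b₀, ‖g (l₀ + e - l)‖ ^ 2 := by
      refine Finset.sum_le_sum fun l _ => ?_
      rw [hfac, norm_mul]
      have := norm_mask_le_one hD (shear ρ⁻¹ c (-K) (l₀ + e - l))
      gcongr
      exact mul_le_of_le_one_left (norm_nonneg _) this
    have hb : l₀ + e - (b₀ : Plane) = e := add_sub_cancel_left _ _
    rw [hb] at hbes hle
    have hlast : ‖affineFourier ρ c D e‖ ^ 2 =
        ‖mask D (shear ρ⁻¹ c (-K) e)‖ ^ 2 * ‖g e‖ ^ 2 := by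
      rw [hfac, norm_mul, mul_pow]
    nlinarith
  have hfin := hasSum_le_of_sum_le (hsum (l₀ + e)) hS
  have hgpos : 0 < ‖g e‖ ^ 2 := by have := norm_pos_iff.2 hn; positivity
  have hmpos : 0 < 1 - ‖mask D (shear ρ⁻¹ c (-K) e)‖ ^ 2 := by
    nlinarith [norm_nonneg (mask D (shear ρ⁻¹ c (-K) e))]
  nlinarith [mul_pos hmpos hgpos]

/-- A zero of the mask at level `k` in integer coordinates. -/
lemma exists_coordinates {r : ℝ} (hr : r ≠ 0) (hp : p.Prime) (hz : HasLatticeZeros p a D) {k : ℕ}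
    {x : Plane} (h : mask D (shear r c (-k) x) = 0) :
    ∃ z : Fin 2 → ℤ, ¬ (p : ℤ) ∣ z 0 ∧ (p : ℤ) ∣ a 0 * z 1 - a 1 * z 0 ∧
      (p : ℝ) • x = shear r c k (digitVec z) := by
  have hp0 : (p : ℝ) ≠ 0 := by exact_mod_cast hp.ne_zero
  obtain ⟨z, h0, h1, h2⟩ := (hz _).1 h
  refine ⟨z, h0, h1, ?_⟩
  have h3 : x = shear r c k (fun i => z i / p) := by
    have : (fun i => (z i : ℝ) / p) = shear r c (-k) x := funext fun i => (h2 i).symm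
    rw [this, shear_shear_neg c hr]
  rw [h3]
  refine plane_ext ?_ ?_
  · simp only [Pi.smul_apply, shear_apply_zero, smul_eq_mul, digitVec]
    field_simp
  · simp only [Pi.smul_apply, shear_apply_one, smul_eq_mul, digitVec]
    field_simp

/-- The dilated first coordinates of a set. -/
def firstCoords (p : ℕ) (Λ : Set Plane) : Set ℝ := (fun l : Plane => (p : ℝ) * l 0) '' Λ

/-- What a spectrum says about the parameters: there are three points whose differences have
levels `1`, `1` and `L`. -/
lemma exists_triangle (h0 : 0 < ρ) (h1 : ρ < 1) (hp : p.Prime)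
    (ha0 : ¬ (p : ℤ) ∣ a 0) (hD : D.Nonempty) (hz : HasLatticeZeros p a D) {Λ : Set Plane}
    (horth : ∀ l ∈ Λ, ∀ l' ∈ Λ, l ≠ l' → affineFourier ρ c D (l - l') = 0)
    (hsum : ∀ ξ, HasSum (fun l : Λ => ‖affineFourier ρ c D (ξ - l)‖ ^ 2) 1) :
    HasPowerDifferences p ρ⁻¹ (firstCoords p Λ) ∧ (firstCoords p Λ).Infinite ∧
    ∀ l ∈ Λ, ∀ l' ∈ Λ, l ≠ l' → ∀ L : ℕ, 2 ≤ L → ∀ ζ : Fin 2 → ℤ, ¬ (p : ℤ) ∣ ζ 0 →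
      (p : ℝ) • (l - l') = shear ρ⁻¹ c L (digitVec ζ) →
      ∃ Z : Fin 2 → ℤ, (p : ℤ) ∣ a 0 * Z 1 - a 1 * Z 0 ∧
        digitVec Z = shear ρ⁻¹ c (L - 1) (digitVec ζ) := by
  classical
  have hr : 1 < ρ⁻¹ := (one_lt_inv₀ h0).2 h1
  have hr0 : ρ⁻¹ ≠ 0 := by linarith
  have hp0 : (p : ℝ) ≠ 0 := by exact_mod_cast hp.ne_zero
  have hlev : ∀ l ∈ Λ, ∀ l' ∈ Λ, l ≠ l' → ∃ k : ℕ, 1 ≤ k ∧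
      mask D (shear ρ⁻¹ c (-k) (l - l')) = 0 := fun l hl l' hl' hne =>
    affineFourier_eq_zero h0 h1 hD (horth l hl l' hl' hne)
  have hcoord : ∀ {x y : Plane} {k : ℕ} {z : Fin 2 → ℤ},
      (p : ℝ) • (x - y) = shear ρ⁻¹ c k (digitVec z) →
      (p : ℝ) * x 0 - p * y 0 = ρ⁻¹ ^ k * z 0 := by
    intro x y k z h
    have := congrFun h 0
    simp only [Pi.smul_apply, Pi.sub_apply, smul_eq_mul, shear_apply_zero, digitVec,
      zpow_natCast] at this
    rw [← this]
    ring
  have hpd : HasPowerDifferences p ρ⁻¹ (firstCoords p Λ) := by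
    rintro _ ⟨l, hl, rfl⟩ _ ⟨l', hl', rfl⟩ hne
    obtain ⟨k, -, hk⟩ := hlev l hl l' hl' fun h => hne (by rw [h])
    obtain ⟨z, hz0, -, hz2⟩ := exists_coordinates hr0 hp hz hk
    exact ⟨k, z 0, hz0, hcoord hz2⟩
  have hinj : Set.InjOn (fun l : Plane => (p : ℝ) * l 0) Λ := by
    intro l hl l' hl' h
    by_contra hne
    obtain ⟨k, -, hk⟩ := hlev l hl l' hl' hne
    obtain ⟨z, hz0, -, hz2⟩ := exists_coordinates hr0 hp hz hk
    have h2 := hcoord hz2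
    simp only at h
    rw [h, sub_self] at h2
    rcases mul_eq_zero.1 h2.symm with h3 | h3
    · exact pow_ne_zero k hr0 h3
    · have : z 0 = 0 := by exact_mod_cast h3
      exact hz0 (this ▸ dvd_zero _)
  -- A finite Λ would have chosen levels bounded by some B, against a difference whose only level is
  -- B + 1.
  have hinf : (firstCoords p Λ).Infinite := by
    intro hfin
    have hΛ : Λ.Finite := Set.Finite.of_finite_image hfin hinj
    choose! κ hκ1 hκ using hlev
    obtain ⟨B, hB⟩ := ((hΛ.prod hΛ).image fun x : Plane × Plane => κ x.1 x.2).bddAbove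
    obtain ⟨l, hl, l', hl', hne, hK⟩ :=
      exists_difference_of_level h0 h1 hp ha0 hD hz hsum (K := B + 1) (by omega)
    have h2 := hK _ (hκ1 l hl l' hl' hne) (hκ l hl l' hl' hne)
    have h3 : κ l l' ≤ B := hB ⟨(l, l'), ⟨hl, hl'⟩, rfl⟩
    omega
  refine ⟨hpd, hinf, fun x hx y hy hxy L hL ζ hζ hxyζ => ?_⟩
  obtain ⟨u, hu, v, hv, huv, huvK⟩ :=
    exists_difference_of_level h0 h1 hp ha0 hD hz hsum (K := 1) le_rfl
  -- some endpoint of a difference of level one is at level one from `x`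
  obtain ⟨w, hw, hxw, z, hz0, hz1, hz2⟩ : ∃ w ∈ Λ, x ≠ w ∧ ∃ z : Fin 2 → ℤ, ¬ (p : ℤ) ∣ z 0 ∧
      (p : ℤ) ∣ a 0 * z 1 - a 1 * z 0 ∧ (p : ℝ) • (x - w) = shear ρ⁻¹ c 1 (digitVec z) := by
    obtain ⟨k, hk1, hk⟩ := hlev u hu v hv huv
    obtain rfl := huvK k hk1 hk
    obtain ⟨q, hq0, hq1, hq2⟩ := exists_coordinates hr0 hp hz hk
    by_cases hxu : x = u
    · subst hxu
      exact ⟨v, hv, huv, q, hq0, hq1, by exact_mod_cast hq2⟩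
    by_cases hxv : x = v
    · subst hxv
      refine ⟨u, hu, hxu, fun i => -q i, by simpa using hq0, ?_, ?_⟩
      · have : a 0 * -q 1 - a 1 * -q 0 = -(a 0 * q 1 - a 1 * q 0) := by ring
        simpa only [this, dvd_neg] using hq1
      · have h3 : digitVec (fun i => -q i) = 0 - digitVec q := by
          funext i
          simp [digitVec]
        rw [h3, shear_sub, shear_apply_eq_zero, zero_sub, ← neg_sub u x, smul_neg]
        exact_mod_cast congrArg Neg.neg hq2
    · obtain ⟨i, hi1, hi⟩ := hlev x hx u hu hxu
      obtain ⟨j, hj1, hj⟩ := hlev x hx v hv hxv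
      obtain ⟨α, hα0, hα1, hα2⟩ := exists_coordinates hr0 hp hz hi
      obtain ⟨β, hβ0, hβ1, hβ2⟩ := exists_coordinates hr0 hp hz hj
      have e1 := hcoord hα2
      have e2 := hcoord hβ2
      have e3 := hcoord hq2
      -- Exponents behave ultrametrically: in a triangle with one side of exponent 1, another side
      -- also has exponent 1.
      have hij : i = 1 ∨ j = 1 := by
        rcases lt_trichotomy i j with hlt | heq | hgt
        · left
          exact (exponent_eq_of_lt hpd hinf hp hr hlt hα0 hβ0 hq0
            (by rw [← e1, ← e2, ← e3]; ring)).symm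
        · left
          subst heq
          have := exponent_le_of_eq hpd hinf hp hr (k := i) (m := 1) (z := α 0) (w := β 0) hq0
            (by rw [← e1, ← e2, ← e3]; ring)
          omega
        · right
          exact (exponent_eq_of_lt hpd hinf hp hr (m := 1) (v := -q 0) hgt hβ0 hα0
            (by simpa using hq0) (by push_cast; rw [mul_neg, ← e1, ← e2, ← e3]; ring)).symm
      rcases hij with rfl | rfl
      · exact ⟨u, hu, hxu, α, hα0, hα1, by exact_mod_cast hα2⟩
      · exact ⟨v, hv, hxv, β, hβ0, hβ1, by exact_mod_cast hβ2⟩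
  have hwy : w ≠ y := by
    rintro rfl
    have e1 := hcoord hxyζ
    have e2 := hcoord (k := 1) (by exact_mod_cast hz2)
    have := hpd.exponent_unique hinf hp hr0 hz0 hζ (e2.symm.trans e1)
    omega
  obtain ⟨k, hk1, hk⟩ := hlev w hw y hy hwy
  obtain ⟨q, hq0, hq1, hq2⟩ := exists_coordinates hr0 hp hz hk
  have e1 := hcoord hxyζ
  have e2 := hcoord (k := 1) (by exact_mod_cast hz2)
  have e3 := hcoord hq2
  -- The sides x - w and x - y have exponents 1 < L, so w - y has exponent 1. Thus x - y is a sum of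
  -- two differences of level 1, and Z is the sum of their integer vectors.
  have hk' : k = 1 := exponent_eq_of_lt hpd hinf hp hr (by omega : 1 < L) hz0 hζ hq0
    (by rw [← e1, ← e2, ← e3]; ring)
  subst hk'
  refine ⟨fun i => z i + q i, ?_, ?_⟩
  · have : a 0 * (z 1 + q 1) - a 1 * (z 0 + q 0) =
        (a 0 * z 1 - a 1 * z 0) + (a 0 * q 1 - a 1 * q 0) := by ring
    rw [this]
    exact dvd_add hz1 hq1
  · have h2 : shear ρ⁻¹ c 1 (digitVec fun i => z i + q i) = shear ρ⁻¹ c L (digitVec ζ) := by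
      have h3 : (digitVec fun i => z i + q i) = digitVec z + digitVec q := by
        funext i
        simp [digitVec]
      rw [h3, shear_add, ← hxyζ, ← hz2]
      have h4 : shear ρ⁻¹ c 1 (digitVec q) = (p : ℝ) • (w - y) := by exact_mod_cast hq2.symm
      rw [h4, ← smul_add]
      congr 1
      abel
    rw [← shear_neg_shear c hr0 1 (digitVec fun i => z i + q i), h2, shear_shear c hr0]
    congr 1

end Levels

/-! ### Arithmetic conditions on ρ and c -/

section Parameters

variable {p : ℕ} {ρ c : ℝ} {a : Fin 2 → ℤ} {D : Finset (Fin 2 → ℤ)}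

/-- Reduction to lowest terms cancels a divisor of B, which is prime to p, so the numerator stays
divisible by p. -/
lemma mem_admissibleEntries_of_div (hp : p.Prime) {x : ℝ} {A B : ℤ} (hA : (p : ℤ) ∣ A)
    (hB : ¬ (p : ℤ) ∣ B) (hx : x = A / B) : x ∈ admissibleEntries p := by
  have hpZ : Prime (p : ℤ) := Nat.prime_iff_prime_int.1 hp
  have hB0 : B ≠ 0 := fun h => hB (h ▸ dvd_zero _)
  set q : ℚ := (A : ℚ) / B with hq
  have hxq : x = (q : ℝ) := by rw [hx, hq]; push_cast; rfl
  have hden : (q.den : ℚ) ≠ 0 := by exact_mod_cast q.den_nz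
  have hrel : A * q.den = q.num * B := by
    have h1 : (q.num : ℚ) / q.den = A / B := by rw [Rat.num_div_den]
    have hB0' : (B : ℚ) ≠ 0 := by exact_mod_cast hB0
    rw [div_eq_div_iff hden hB0'] at h1
    exact_mod_cast h1.symm
  refine Or.inl ⟨q.num, q.den, by exact_mod_cast q.den_nz, ?_, ?_, ?_⟩
  · have h2 : (p : ℤ) ∣ q.num * B := hrel ▸ hA.mul_right _
    exact (hpZ.dvd_or_dvd h2).resolve_right hB
  · rw [Int.gcd_eq_natAbs, Int.natAbs_natCast]
    exact q.reduced
  · rw [hxq]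
    exact_mod_cast (Rat.cast_def q : ((q : ℚ) : ℝ) = _)

/-- A spectrum forces `ρ⁻¹` to be rational with numerator divisible by `p`, forces `c` to be
admissible, and has differences which are large at every level. -/
lemma exists_rational_of_spectrum (h0 : 0 < ρ) (h1 : ρ < 1) (hp : p.Prime)
    (ha0 : ¬ (p : ℤ) ∣ a 0) (hD : D.Nonempty) (hz : HasLatticeZeros p a D) {Λ : Set Plane}
    (horth : ∀ l ∈ Λ, ∀ l' ∈ Λ, l ≠ l' → affineFourier ρ c D (l - l') = 0)
    (hsum : ∀ ξ, HasSum (fun l : Λ => ‖affineFourier ρ c D (ξ - l)‖ ^ 2) 1) :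
    c ∈ admissibleEntries p ∧ ∃ u v : ℕ, u.Coprime v ∧ v ≠ 0 ∧ p ∣ u ∧ ρ⁻¹ = u / v ∧
      ∀ l ∈ Λ, ∀ l' ∈ Λ, l ≠ l' → ∃ k : ℕ, 1 ≤ k ∧ mask D (shear ρ⁻¹ c (-k) (l - l')) = 0 ∧
        (u : ℝ) ^ k ≤ v * (p * |l 0 - l' 0|) := by
  have : Fact p.Prime := ⟨hp⟩
  have hr : 1 < ρ⁻¹ := (one_lt_inv₀ h0).2 h1
  have hr0 : ρ⁻¹ ≠ 0 := by linarith
  have hpZ : Prime (p : ℤ) := Nat.prime_iff_prime_int.1 hp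
  obtain ⟨hpd, hinf, htri⟩ := exists_triangle h0 h1 hp ha0 hD hz horth hsum
  have hfirst : ∀ {L : ℕ} {Z ζ : Fin 2 → ℤ}, 1 ≤ L →
      digitVec Z = shear ρ⁻¹ c (L - 1) (digitVec ζ) → (Z 0 : ℝ) = ρ⁻¹ ^ (L - 1) * ζ 0 := by
    intro L Z ζ hL h
    have h2 := congrFun h 0
    have h3 : (L : ℤ) - 1 = (L - 1 : ℕ) := by omega
    rwa [shear_apply_zero, h3, zpow_natCast] at h2
  obtain ⟨x, hx, y, hy, hxy, hxyK⟩ :=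
    exists_difference_of_level h0 h1 hp ha0 hD hz hsum (K := 2) (by omega)
  obtain ⟨k, hk1, hk⟩ := affineFourier_eq_zero h0 h1 hD (horth x hx y hy hxy)
  obtain rfl := hxyK k hk1 hk
  obtain ⟨ζ, hζ0, hζ1, hζ2⟩ := exists_coordinates hr0 hp hz hk
  obtain ⟨Z, hZ1, hZ2⟩ := htri x hx y hy hxy 2 le_rfl ζ hζ0 hζ2
  have hZ0 := hfirst (by omega) hZ2
  norm_num at hZ0
  have hζ00 : (ζ 0 : ℝ) ≠ 0 := by
    intro h
    have : ζ 0 = 0 := by exact_mod_cast h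
    exact hζ0 (this ▸ dvd_zero _)
  -- A level-2 difference gives Z = Aζ; its first coordinate reads Z₀ = r ζ₀, so r is rational.
  set q : ℚ := Z 0 / ζ 0 with hq
  have hqr : ρ⁻¹ = (q : ℝ) := by
    rw [hq]
    push_cast
    rw [hZ0]
    field_simp
  have hqpos : 0 < q := by
    have : (0 : ℝ) < (q : ℝ) := by rw [← hqr]; linarith
    exact_mod_cast this
  obtain ⟨n, hn, w, hw, hwv⟩ := hpd.exists_pow_eq_ratCast hinf hp hr
  have hpnum : (p : ℤ) ∣ q.num := by
    have hqw : q ^ n = w := by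
      rw [hqr] at hw
      exact_mod_cast hw
    rw [← hqw, padicValRat.pow] at hwv
    have hv : 0 < padicValRat p q := pos_of_mul_pos_right hwv (by positivity)
    by_contra hnd
    rw [padicValRat_def, padicValInt.eq_zero_of_not_dvd hnd] at hv
    have : (0 : ℤ) ≤ (padicValNat p q.den : ℤ) := by positivity
    simp only [Nat.cast_zero] at hv
    linarith
  have hpden : ¬ (p : ℤ) ∣ (q.den : ℤ) := by
    intro hd
    have h2 := Int.natCast_dvd.1 hpnum
    have h3 : p ∣ q.den := Int.natCast_dvd_natCast.1 hd
    have hcop := q.reduced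
    exact hp.one_lt.ne' (Nat.dvd_one.1 (hcop ▸ Nat.dvd_gcd h2 h3))
  have hnumpos : 0 < q.num := Rat.num_pos.2 hqpos
  have hdenR : (q.den : ℝ) ≠ 0 := by exact_mod_cast q.den_nz
  obtain ⟨N, hN⟩ : ∃ N : ℕ, (N : ℤ) = q.num := ⟨_, Int.natAbs_of_nonneg hnumpos.le⟩
  have hred : N.Coprime q.den := by
    have := q.reduced
    rwa [← hN, Int.natAbs_natCast] at this
  have hpN : p ∣ N := Int.natCast_dvd_natCast.1 (hN ▸ hpnum)
  have hnumabs : (N : ℝ) = q.num := by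
    rw [← hN, Int.cast_natCast]
  have hrdiv : ρ⁻¹ = (N : ℝ) / q.den := by
    rw [hnumabs, hqr]
    exact_mod_cast (Rat.cast_def q : ((q : ℚ) : ℝ) = _)
  have hdd : ∀ {L : ℕ} {Z ζ : Fin 2 → ℤ}, 1 ≤ L →
      digitVec Z = shear ρ⁻¹ c (L - 1) (digitVec ζ) →
      (q.den : ℤ) ^ (L - 1) * Z 0 = (N : ℤ) ^ (L - 1) * ζ 0 := by
    intro L Z ζ hL h
    have h2 := hfirst hL h
    rw [hrdiv, div_pow] at h2
    have h3 := pow_ne_zero (L - 1) hdenR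
    have h4 : (q.den : ℝ) ^ (L - 1) * Z 0 = (N : ℝ) ^ (L - 1) * ζ 0 := by
      rw [h2]
      field_simp
    exact_mod_cast h4
  refine ⟨?_, N, q.den, hred, q.den_nz, hpN, hrdiv, ?_⟩
  · have hpZ0 : (p : ℤ) ∣ Z 0 := by
      have h2 := hdd (by omega) hZ2
      norm_num at h2
      have h3 : (p : ℤ) ∣ q.den * Z 0 := by
        rw [h2]
        exact (Int.natCast_dvd_natCast.2 hpN).mul_right _
      exact (hpZ.dvd_or_dvd h3).resolve_left hpden
    -- Z lies on the line of a modulo p, so p ∣ Z₀ forces p ∣ Z₁. The second coordinate Z₁ = c ζ₀ +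
    -- r ζ₁ can then be solved for c.
    have hpZ1 : (p : ℤ) ∣ Z 1 := by
      have h2 : (p : ℤ) ∣ a 0 * Z 1 := by
        have := dvd_add hZ1 (hpZ0.mul_left (a 1))
        rwa [sub_add_cancel] at this
      exact (hpZ.dvd_or_dvd h2).resolve_left ha0
    have e1 := congrFun hZ2 1
    simp only [shear_apply_one, digitVec] at e1
    norm_num at e1
    refine mem_admissibleEntries_of_div hp (A := q.den * Z 1 - q.num * ζ 1) (B := q.den * ζ 0)
      (dvd_sub (hpZ1.mul_left _) (hpnum.mul_right _)) ?_ ?_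
    · exact fun h => (hpZ.dvd_or_dvd h).elim hpden hζ0
    · have h2 : (ρ⁻¹ : ℝ) = q.num / q.den := by rw [hrdiv, hnumabs]
      rw [← inv_inv ρ, h2, inv_inv] at e1
      push_cast
      rw [eq_div_iff (mul_ne_zero hdenR hζ00)]
      rw [e1]
      field_simp
      ring
  · intro l hl l' hl' hne
    obtain ⟨k, hk1, hk⟩ := affineFourier_eq_zero h0 h1 hD (horth l hl l' hl' hne)
    obtain ⟨η, hη0, hη1, hη2⟩ := exists_coordinates hr0 hp hz hk
    refine ⟨k, hk1, hk, ?_⟩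
    -- Integrality of r^{k-1} η₀ puts the full power den^{k-1} into η₀, so p|l₀ - l'₀| = r^k |η₀| is
    -- at least N^k / den.
    obtain ⟨t, ht⟩ : (q.den : ℤ) ^ (k - 1) ∣ η 0 := by
      rcases hk1.eq_or_lt with rfl | hk2
      · simp
      · obtain ⟨Z', -, hZ'⟩ := htri l hl l' hl' hne k hk2 η hη0 hη2
        have h2 := hdd hk1 hZ'
        have hcop : IsCoprime ((q.den : ℤ) ^ (k - 1)) ((N : ℤ) ^ (k - 1)) :=
          (Nat.Coprime.isCoprime hred.symm).pow
        exact hcop.dvd_of_dvd_mul_left ⟨Z' 0, h2.symm⟩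
    have ht0 : t ≠ 0 := by
      rintro rfl
      rw [mul_zero] at ht
      exact hη0 (ht ▸ dvd_zero _)
    have htabs : (1 : ℝ) ≤ |(t : ℝ)| := by exact_mod_cast Int.one_le_abs ht0
    have h2 := congrFun hη2 0
    simp only [Pi.smul_apply, Pi.sub_apply, smul_eq_mul, shear_apply_zero, digitVec,
      zpow_natCast, ht] at h2
    have hu0 : (0 : ℝ) ≤ (N : ℝ) := by positivity
    have h3 : (q.den : ℝ) * (p * (l 0 - l' 0)) = (N : ℝ) ^ k * t := by
      have h4 : (q.den : ℝ) ^ k = q.den ^ (k - 1) * q.den := by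
        rw [← pow_succ, Nat.sub_add_cancel hk1]
      rw [h2, hrdiv, div_pow, h4]
      push_cast
      field_simp
    have h4 := congrArg abs h3
    rw [abs_mul, abs_mul, abs_mul, Nat.abs_cast, Nat.abs_cast, abs_of_nonneg (pow_nonneg hu0 k)]
      at h4
    rw [h4]
    exact le_mul_of_one_le_right (pow_nonneg hu0 k) htabs

end Parameters

/-! ### Decay of the Fourier transform for rational non-integral expansion -/

section Decay

variable {p : ℕ} {ρ c : ℝ} {a : Fin 2 → ℤ} {D : Finset (Fin 2 → ℤ)} {u v : ℕ}

/-- The orbit of a large number under division by `u / v` meets a point far from the integers. -/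
lemma exists_far_from_integers (hcop : u.Coprime v) (hv : 2 ≤ v) (huv : v < u) {x : ℝ} {n : ℕ}
    (hn : 1 ≤ n) (hx : (u : ℝ) ^ n ≤ |x|) (hx' : |x| < (u : ℝ) ^ (n + 1)) :
    ∃ i : ℕ, 1 ≤ i ∧ i ≤ n + 2 ∧
      ∀ N : ℤ, 1 / (2 * ((u : ℝ) + v)) ≤ |((u : ℝ) / v) ^ (-(i : ℤ)) * x - N| := by
  by_contra! hcon
  choose! N hN using hcon
  have hvR : (2 : ℝ) ≤ v := by exact_mod_cast hv
  have huvR : (v : ℝ) + 1 ≤ u := by exact_mod_cast huv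
  have hv0 : (v : ℝ) ≠ 0 := by linarith
  have hu0 : (u : ℝ) ≠ 0 := by linarith
  -- Small enough that errors below η in two successive nearest integers combine to less than (u +
  -- v) η = 1/2.
  set η : ℝ := 1 / (2 * ((u : ℝ) + v)) with hη
  have hηpos : 0 < η := by positivity
  have hη1 : (u + v) * η = 1 / 2 := by
    rw [hη]
    field_simp
  set y : ℕ → ℝ := fun i => ((u : ℝ) / v) ^ (-(i : ℤ)) * x with hy
  have hyrec : ∀ i, (u : ℝ) * y (i + 1) = v * y i := by
    intro i
    simp only [hy]
    rw [zpow_neg, zpow_neg, zpow_natCast, zpow_natCast, pow_succ]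
    field_simp
  -- The integer u N_{i+1} - v N_i has modulus below 1, so the nearest integers obey the recursion
  -- of the orbit exactly.
  have hstep : ∀ i, 1 ≤ i → i ≤ n + 1 → (u : ℤ) * N (i + 1) = v * N i := by
    intro i h1 h2
    have e1 := abs_lt.1 (hN i h1 (by omega))
    have e2 := abs_lt.1 (hN (i + 1) (by omega) (by omega))
    have e3 := hyrec i
    simp only [hy] at e3
    have h3 : |((u * N (i + 1) - v * N i : ℤ) : ℝ)| < 1 := by
      push_cast
      rw [abs_lt]
      constructor <;> nlinarith
    have h4 : |(u * N (i + 1) - v * N i : ℤ)| < 1 := by exact_mod_cast h3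
    have := Int.abs_lt_one_iff.1 h4
    linarith
  have hchain : ∀ j, j ≤ n + 1 → (u : ℤ) ^ j * N (j + 1) = v ^ j * N 1 := by
    intro j
    induction j with
    | zero => simp
    | succ j ih =>
      intro hj
      have h1 := ih (by omega)
      have h2 := hstep (j + 1) (by omega) (by omega)
      rw [pow_succ, pow_succ]
      linear_combination (v : ℤ) * h1 + (u : ℤ) ^ j * h2
  -- Following the recursion up to N_{n+2} gives this divisibility, which is why n + 2 steps are
  -- allowed.
  have hdvd : (u : ℤ) ^ (n + 1) ∣ N 1 := by
    have h1 : (u : ℤ) ^ (n + 1) ∣ v ^ (n + 1) * N 1 := ⟨_, (hchain (n + 1) le_rfl).symm⟩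
    exact (Nat.Coprime.isCoprime hcop).pow.dvd_of_dvd_mul_left h1
  have hN1 := hN 1 le_rfl (by omega)
  have hux : (u : ℝ) ≤ |x| := le_trans (le_self_pow₀ (by linarith) (by omega)) hx
  have hy1 : ((u : ℝ) / v) ^ (-((1 : ℕ) : ℤ)) * x = v / u * x := by
    rw [zpow_neg, zpow_natCast, pow_one, inv_div]
  rw [hy1] at hN1
  have habs : |(v : ℝ) / u * x| = v / u * |x| := by
    rw [abs_mul, abs_of_pos (by positivity)]
  have hη2 : η < 1 := by nlinarith
  -- The gap of 1 comes from u - v ≥ 1 and |x| ≥ u; it keeps |N₁| below u^{n+1}, hence N₁ = 0,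
  -- although the first orbit point has modulus at least v.
  have h5 : (v : ℝ) / u * |x| ≤ |x| - 1 := by
    have h6 : (v : ℝ) / u * |x| = |x| - (u - v) / u * |x| := by field_simp; ring
    have h7 : 1 ≤ ((u : ℝ) - v) / u * |x| := by
      rw [div_mul_eq_mul_div, le_div_iff₀ (by linarith)]
      nlinarith
    linarith
  have h8 : |(N 1 : ℝ)| < (u : ℝ) ^ (n + 1) := by
    have := abs_sub_abs_le_abs_sub (N 1 : ℝ) (v / u * x)
    rw [abs_sub_comm] at hN1
    linarith
  have hN0 : N 1 = 0 := by
    refine Int.eq_zero_of_abs_lt_dvd hdvd ?_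
    exact_mod_cast h8
  rw [hN0, Int.cast_zero, sub_zero, habs] at hN1
  have h9 : (v : ℝ) ≤ v / u * |x| := by
    rw [div_mul_eq_mul_div, le_div_iff₀ (by linarith)]
    nlinarith
  linarith

lemma norm_partialMask_le {r : ℝ} (hr : r ≠ 0) (hD : D.Nonempty) {i : ℕ} (hi : 1 ≤ i) (ξ : Plane) :
    ‖partialMask D r c i ξ‖ ≤ ‖mask D (shear r c (-i) ξ)‖ := by
  have e2 := partialMask_add (D := D) c hr (i - 1) 1 ξ
  have e3 : -1 + -((i - 1 : ℕ) : ℤ) = -i := by omega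
  rw [partialMask_one, shear_shear c hr, e3, Nat.sub_add_cancel hi] at e2
  rw [e2, norm_mul]
  exact mul_le_of_le_one_left (norm_nonneg _)
    ((isFourierTransform_partialMask c hD _).norm_le_one ξ)

/-- Iterated logarithmic decay of the Fourier transform. -/
lemma norm_affineFourier_le_pow (h0 : 0 < ρ) (h1 : ρ < 1) (hD : D.Nonempty)
    (hcop : u.Coprime v) (hv : 2 ≤ v) (hρ : ρ⁻¹ = u / v) {b : ℝ} (hb : 0 < b)
    (hmask : ∀ ξ : Plane, (∀ n : ℤ, 1 / (2 * ((u : ℝ) + v)) ≤ |ξ 0 - n|) → ‖mask D ξ‖ ≤ b)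
    {s : ℕ} (hs : u ≤ 2 ^ s) (k : ℕ) :
    ∀ ξ : Plane, (u : ℝ) ^ ((3 * s) ^ k) ≤ |ξ 0| → ‖affineFourier ρ c D ξ‖ ≤ b ^ k := by
  have hr : 1 < ρ⁻¹ := (one_lt_inv₀ h0).2 h1
  have hr0 : ρ⁻¹ ≠ 0 := by linarith
  have hvR : (2 : ℝ) ≤ v := by exact_mod_cast hv
  have huv : v < u := by
    rw [hρ, one_lt_div (by linarith)] at hr
    exact_mod_cast hr
  have huR : (1 : ℝ) < u := by exact_mod_cast (by omega : 1 < u)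
  have hs1 : 1 ≤ s := by
    by_contra! h
    have : s = 0 := by omega
    subst this
    simp at hs
    omega
  have hF := isFourierTransform_affineFourier (c := c) h0 h1 hD
  induction k with
  | zero => intro ξ _; simpa using hF.norm_le_one ξ
  | succ k ih =>
    intro ξ hξ
    have hone : 1 ≤ |ξ 0| := (one_le_pow₀ huR.le).trans hξ
    obtain ⟨n, hn1, hn2⟩ := exists_nat_pow_near hone huR
    set t := (3 * s) ^ k with ht
    have ht1 : 1 ≤ t := Nat.one_le_pow _ _ (by omega)
    have hnk : 3 * s * t ≤ n := by
      have h2 := lt_of_le_of_lt hξ hn2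
      have h3 := (pow_lt_pow_iff_right₀ huR).1 h2
      rw [pow_succ, mul_comm, ← ht] at h3
      omega
    -- This is where the factor 3 is used: t ≥ 1 gives s(t + 2) ≤ 3st ≤ n.
    have hst : s * (t + 2) ≤ n + 2 := by nlinarith
    have hn0 : 1 ≤ n := by nlinarith
    obtain ⟨i, hi1, hi2, hi⟩ := exists_far_from_integers hcop hv huv hn0 hn1 hn2
    rw [affineFourier_eq_partialMask_mul h0 h1 hD i, norm_mul, pow_succ, mul_comm]
    have hm : ‖partialMask D ρ⁻¹ c i ξ‖ ≤ b := by
      refine (norm_partialMask_le hr0 hD hi1 ξ).trans (hmask _ fun N => ?_)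
      rw [shear_apply_zero, hρ]
      exact hi N
    refine mul_le_mul (ih _ ?_) hm (norm_nonneg _) (by positivity)
    rw [shear_apply_zero, abs_mul, hρ, zpow_neg, zpow_natCast, ← inv_pow, inv_div,
      abs_of_pos (by positivity)]
    have hle1 : (v : ℝ) / u ≤ 1 := by
      rw [div_le_one (by linarith)]
      exact_mod_cast huv.le
    -- After at most n + 2 divisions the first coordinate is still at least v^{n+2}/u², and v ≥ 2
    -- with u ≤ 2^s makes this at least u^t, so induction applies to the tail.
    calc (u : ℝ) ^ t ≤ (v : ℝ) ^ (n + 2) / u ^ 2 := by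
          rw [le_div_iff₀ (by positivity), ← pow_add]
          calc (u : ℝ) ^ (t + 2) ≤ ((2 : ℝ) ^ s) ^ (t + 2) := by
                gcongr
                exact_mod_cast hs
            _ = 2 ^ (s * (t + 2)) := by rw [pow_mul]
            _ ≤ 2 ^ (n + 2) := pow_le_pow_right₀ (by norm_num) hst
            _ ≤ (v : ℝ) ^ (n + 2) := by gcongr
      _ = ((v : ℝ) / u) ^ (n + 2) * u ^ n := by
          rw [div_pow, pow_add (u : ℝ) n 2]
          field_simp
      _ ≤ ((v : ℝ) / u) ^ i * |ξ 0| := by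
          refine mul_le_mul ?_ hn1 (by positivity) (by positivity)
          exact pow_le_pow_of_le_one (by positivity) hle1 hi2

end Decay

/-! ### A rational non-integral expansion admits no spectrum -/

/-- The mass of the points of `Λ` whose first coordinate is less than `R` in modulus is at most
`1 - δ`. -/
def HasMassDefect (Λ : Set Plane) (f : Plane → ℝ) (R δ : ℝ) : Prop :=
  ∀ S : Finset Plane, (∀ l ∈ S, l ∈ Λ ∧ |l 0| < R) → ∑ l ∈ S, f l ≤ 1 - δ

lemma HasMassDefect.mono {Λ : Set Plane} {f : Plane → ℝ} {R δ δ' : ℝ}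
    (h : HasMassDefect Λ f R δ) (hδ : δ' ≤ δ) : HasMassDefect Λ f R δ' :=
  fun S hS => (h S hS).trans (by linarith)

section NonIntegral

variable {p : ℕ} {ρ c : ℝ} {a : Fin 2 → ℤ} {D : Finset (Fin 2 → ℤ)} {u v : ℕ} {Λ : Set Plane}

/-- Two points within this radius differ by less than u^{n+1}/(vp), so their difference has a level
at most n and the n-th product vanishes there; Bessel's inequality applies. -/
lemma sum_norm_sq_partialMask_le_one (hp : 0 < p) (hv : 0 < v) (hu : 1 < u) (hD : D.Nonempty)
    (hlarge : ∀ l ∈ Λ, ∀ l' ∈ Λ, l ≠ l' → ∃ k : ℕ, 1 ≤ k ∧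
      mask D (shear ρ⁻¹ c (-k) (l - l')) = 0 ∧ (u : ℝ) ^ k ≤ v * (p * |l 0 - l' 0|)) {n : ℕ}
    (S : Finset Plane) (hS : ∀ l ∈ S, l ∈ Λ ∧ |l 0| < (u : ℝ) ^ (n + 1) / (2 * v * p)) (ξ : Plane) :
    ∑ l ∈ S, ‖partialMask D ρ⁻¹ c n (ξ - l)‖ ^ 2 ≤ 1 := by
  have hpR : (0 : ℝ) < p := by exact_mod_cast hp
  have hvR : (0 : ℝ) < v := by exact_mod_cast hv
  have huR : (1 : ℝ) < u := by exact_mod_cast hu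
  refine (isFourierTransform_partialMask c hD n).sum_norm_sq_le_one S (fun l hl l' hl' hne => ?_) ξ
  obtain ⟨k, hk1, hk, hkl⟩ := hlarge l (hS l hl).1 l' (hS l' hl').1 hne
  refine partialMask_eq_zero hk1 ?_ hk
  have h1 : |l 0 - l' 0| < (u : ℝ) ^ (n + 1) / (v * p) := by
    have e1 := (hS l hl).2
    have e2 := (hS l' hl').2
    have e3 := abs_sub (l 0) (l' 0)
    have e4 : (u : ℝ) ^ (n + 1) / (v * p) =
      (u : ℝ) ^ (n + 1) / (2 * v * p) + (u : ℝ) ^ (n + 1) / (2 * v * p) := by field_simp; ring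
    linarith
  rw [lt_div_iff₀ (by positivity)] at h1
  have h2 : (u : ℝ) ^ k < (u : ℝ) ^ (n + 1) := by nlinarith
  have := (pow_lt_pow_iff_right₀ huR).1 h2
  omega

/-- Enlarging the radius decreases the mass defect by a factor close to one at most. -/
lemma HasMassDefect.step (h0 : 0 < ρ) (h1 : ρ < 1) (hp : 0 < p) (hD : D.Nonempty)
    (hv : 2 ≤ v) (hρ : ρ⁻¹ = u / v)
    (hlarge : ∀ l ∈ Λ, ∀ l' ∈ Λ, l ≠ l' → ∃ k : ℕ, 1 ≤ k ∧
      mask D (shear ρ⁻¹ c (-k) (l - l')) = 0 ∧ (u : ℝ) ^ k ≤ v * (p * |l 0 - l' 0|))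
    {s : ℕ} (hs : u ≤ 2 ^ s) {T : ℕ} (hT : 1 ≤ T) {β : ℝ} (hβ0 : 0 ≤ β) (hβ1 : β ≤ 1)
    (hdecay : ∀ ξ : Plane, (u : ℝ) ^ T ≤ |ξ 0| → ‖affineFourier ρ c D ξ‖ ^ 2 ≤ β)
    {ξ : Plane} (hξ : |ξ 0| ≤ 1) {n : ℕ} (hn : s * (2 * T + 4 * p) ≤ n) {δ : ℝ}
    (h : HasMassDefect Λ (fun l => ‖affineFourier ρ c D (ξ - l)‖ ^ 2)
      ((u : ℝ) ^ (n + 1) / (2 * v * p)) δ) :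
    HasMassDefect Λ (fun l => ‖affineFourier ρ c D (ξ - l)‖ ^ 2)
      ((u : ℝ) ^ (n + T + 1) / (2 * v * p)) ((1 - β) * δ) := by
  classical
  have hr : 1 < ρ⁻¹ := (one_lt_inv₀ h0).2 h1
  have hvR : (2 : ℝ) ≤ v := by exact_mod_cast hv
  have huv : v < u := by
    rw [hρ, one_lt_div (by linarith)] at hr
    exact_mod_cast hr
  have huvR : (v : ℝ) ≤ u := by exact_mod_cast huv.le
  have huR : (2 : ℝ) ≤ u := by linarith
  have hpR : (1 : ℝ) ≤ p := by exact_mod_cast hp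
  have hs1 : 1 ≤ s := by
    by_contra! h
    have : s = 0 := by omega
    subst this
    simp at hs
    omega
  have hF := isFourierTransform_affineFourier (c := c) h0 h1 hD
  have hpu : (4 * p : ℝ) ≤ (u : ℝ) ^ (4 * p) := by
    have h2 : 4 * p ≤ u ^ (4 * p) := (Nat.lt_pow_self (by omega : 1 < u)).le
    exact_mod_cast h2
  intro S hS
  set R : ℝ := (u : ℝ) ^ (n + 1) / (2 * v * p) with hR
  set S₁ := S.filter fun l => |l 0| < R with hS₁
  set S₂ := S.filter fun l => ¬ |l 0| < R with hS₂
  have hsplit : ∀ φ : Plane → ℝ, ∑ l ∈ S, φ l = ∑ l ∈ S₁, φ l + ∑ l ∈ S₂, φ l := fun φ =>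
    (Finset.sum_filter_add_sum_filter_not S _ φ).symm
  have hS₁sum := h S₁ fun l hl =>
    ⟨(hS l (Finset.mem_filter.1 hl).1).1, (Finset.mem_filter.1 hl).2⟩
  have hbes := sum_norm_sq_partialMask_le_one hp (by omega) (by omega) hD hlarge S hS ξ
  rw [hsplit] at hbes
  have hfac : ∀ l, ‖affineFourier ρ c D (ξ - l)‖ ^ 2 =
      ‖partialMask D ρ⁻¹ c (n + T) (ξ - l)‖ ^ 2 *
        ‖affineFourier ρ c D (shear ρ⁻¹ c (-(n + T : ℕ)) (ξ - l))‖ ^ 2 := fun l => by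
    rw [affineFourier_eq_partialMask_mul h0 h1 hD (n + T), norm_mul, mul_pow]
  have hle₁ : ∑ l ∈ S₁, ‖affineFourier ρ c D (ξ - l)‖ ^ 2 ≤
      ∑ l ∈ S₁, ‖partialMask D ρ⁻¹ c (n + T) (ξ - l)‖ ^ 2 := by
    refine Finset.sum_le_sum fun l _ => ?_
    rw [hfac]
    exact mul_le_of_le_one_right (by positivity)
      (pow_le_one₀ (norm_nonneg _) (hF.norm_le_one _))
  have hle₂ : ∑ l ∈ S₂, ‖affineFourier ρ c D (ξ - l)‖ ^ 2 ≤
      β * ∑ l ∈ S₂, ‖partialMask D ρ⁻¹ c (n + T) (ξ - l)‖ ^ 2 := by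
    rw [Finset.mul_sum]
    refine Finset.sum_le_sum fun l hl => ?_
    rw [hfac, mul_comm]
    refine mul_le_mul_of_nonneg_right (hdecay _ ?_) (by positivity)
    have hlR : R ≤ |l 0| := not_lt.1 (Finset.mem_filter.1 hl).2
    -- Ensures that |ξ₀| ≤ 1 costs at most half of R, so the points outside R stay at distance R/2
    -- from ξ.
    have hR2 : 2 ≤ R := by
      rw [hR, le_div_iff₀ (by positivity)]
      have h2 : 4 * p ≤ n := by nlinarith
      calc (2 * (2 * v * p) : ℝ) = 4 * p * v := by ring
        _ ≤ (u : ℝ) ^ (4 * p) * u := by gcongr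
        _ = (u : ℝ) ^ (4 * p + 1) := (pow_succ _ _).symm
        _ ≤ (u : ℝ) ^ (n + 1) := pow_le_pow_right₀ (by linarith) (by omega)
    have hlow : R / 2 ≤ |ξ 0 - l 0| := by
      have := abs_sub_abs_le_abs_sub (l 0) (ξ 0)
      rw [abs_sub_comm] at this
      linarith
    rw [shear_apply_zero, abs_mul, hρ, zpow_neg, zpow_natCast, ← inv_pow, inv_div,
      abs_of_pos (by positivity), Pi.sub_apply]
    refine le_trans ?_ (mul_le_mul_of_nonneg_left hlow (by positivity))
    -- After n + T divisions this distance is still at least u^T, by v ≥ 2, u ≤ 2^s and 4p ≤ u^{4p};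
    -- hence the tail of F is bounded by β.
    have e1 : ((v : ℝ) / u) ^ (n + T) * (R / 2) =
        v ^ (n + T - 1) * u / (4 * p * u ^ T) := by
      have e2 : (v : ℝ) ^ (n + T) = v ^ (n + T - 1) * v := by
        rw [← pow_succ]
        congr 1
        omega
      rw [hR, div_pow, e2, pow_succ (u : ℝ) n, pow_add (u : ℝ) n T]
      field_simp
      ring
    rw [e1, le_div_iff₀ (by positivity)]
    calc (u : ℝ) ^ T * (4 * p * u ^ T) ≤ (u : ℝ) ^ T * (u ^ (4 * p) * u ^ T) := by gcongr
      _ = (u : ℝ) ^ (2 * T + 4 * p) := by rw [← pow_add, ← pow_add]; congr 1; omega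
      _ ≤ ((2 : ℝ) ^ s) ^ (2 * T + 4 * p) := by
          gcongr
          exact_mod_cast hs
      _ = (2 : ℝ) ^ (s * (2 * T + 4 * p)) := by rw [pow_mul]
      _ ≤ (2 : ℝ) ^ (n + T - 1) := pow_le_pow_right₀ (by norm_num) (by omega)
      _ ≤ (v : ℝ) ^ (n + T - 1) := by gcongr
      _ ≤ (v : ℝ) ^ (n + T - 1) * u := le_mul_of_one_le_right (by positivity) (by linarith)
  simp only at hS₁sum ⊢
  rw [hsplit]
  -- If σ is the sum of |F|² over S₁, the outer points add at most β(1 - σ). The total β + (1 - β)σ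
  -- is at most 1 - (1 - β)δ.
  nlinarith [mul_le_mul_of_nonneg_left hbes hβ0, mul_le_mul_of_nonneg_left hle₁ hβ0,
    mul_le_mul_of_nonneg_left hS₁sum (sub_nonneg.2 hβ1)]

/-- Some point of the spectrum has a large first coordinate. -/
lemma exists_mem_le_abs (h0 : 0 < ρ) (h1 : ρ < 1) (hp : p.Prime)
    (ha0 : ¬ (p : ℤ) ∣ a 0) (hD : D.Nonempty) (hz : HasLatticeZeros p a D)
    (hv : 0 < v) (hu : 1 < u)
    (hlarge : ∀ l ∈ Λ, ∀ l' ∈ Λ, l ≠ l' → ∃ k : ℕ, 1 ≤ k ∧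
      mask D (shear ρ⁻¹ c (-k) (l - l')) = 0 ∧ (u : ℝ) ^ k ≤ v * (p * |l 0 - l' 0|))
    (hsum : ∀ ξ, HasSum (fun l : Λ => ‖affineFourier ρ c D (ξ - l)‖ ^ 2) 1) (R : ℝ) :
    ∃ l ∈ Λ, R ≤ |l 0| := by
  have huR : (1 : ℝ) < u := by exact_mod_cast hu
  have hpR : (0 : ℝ) < p := by exact_mod_cast hp.pos
  have hvR : (0 : ℝ) < v := by exact_mod_cast hv
  -- A difference of level m + 1 is then too large for both endpoints to have first coordinate below
  -- R.
  obtain ⟨m, hm⟩ := pow_unbounded_of_one_lt (v * (p * (2 * R))) huR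
  obtain ⟨l, hl, l', hl', hne, hk⟩ :=
    exists_difference_of_level h0 h1 hp ha0 hD hz hsum (K := m + 1) (by omega)
  obtain ⟨k, hk1, hk2, hk3⟩ := hlarge l hl l' hl' hne
  obtain rfl := hk k hk1 hk2
  by_contra! hcon
  have e1 := hcon l hl
  have e2 := hcon l' hl'
  have e3 := abs_sub (l 0) (l' 0)
  have e4 : (u : ℝ) ^ m ≤ u ^ (m + 1) := pow_le_pow_right₀ huR.le (by omega)
  have e5 : v * (p * |l 0 - l' 0|) ≤ v * (p * (2 * R)) := by gcongr; linarith
  linarith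

/-- Every vertical strip of translates of `l` meets the support of the transform. -/
lemma exists_affineFourier_sub_ne_zero (h0 : 0 < ρ) (h1 : ρ < 1) (hD : D.Nonempty)
    (hz : HasLatticeZeros p a D) (hv : v ≠ 0) (hu : u ≠ 0) (hρ : ρ⁻¹ = u / v) (l : Plane) :
    ∃ ξ : Plane, |ξ 0| ≤ 1 ∧ affineFourier ρ c D (ξ - l) ≠ 0 := by
  have hvR : (v : ℝ) ≠ 0 := by exact_mod_cast hv
  have huR : (u : ℝ) ≠ 0 := by exact_mod_cast hu
  -- Zeros of F have rational first coordinate (u/v)^k z/p, so an irrational one avoids them.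
  obtain ⟨x, hx, hx1, hx2⟩ := exists_irrational_btwn (lt_add_one (-l 0))
  refine ⟨![l 0 + x, 0], ?_, fun h => ?_⟩
  · rw [Matrix.cons_val_zero, abs_le]
    constructor <;> linarith
  · obtain ⟨k, -, hk⟩ := affineFourier_eq_zero h0 h1 hD h
    obtain ⟨z, -, -, hz2⟩ := (hz _).1 hk
    have h2 := hz2 0
    rw [shear_apply_zero, Pi.sub_apply, Matrix.cons_val_zero, add_sub_cancel_left, hρ] at h2
    refine hx ⟨((u : ℚ) / v) ^ k * (z 0 / p), ?_⟩
    push_cast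
    rw [← h2, zpow_neg, zpow_natCast, mul_inv_cancel_left₀]
    exact pow_ne_zero _ (div_ne_zero huR hvR)

/-- Partial sums of the spectral identity. -/
lemma sum_le_one_of_hasSum {f : Plane → ℝ} (hf : ∀ l, 0 ≤ f l)
    (hsum : HasSum (fun l : Λ => f l) 1) (S : Finset Plane) (hS : ∀ l ∈ S, l ∈ Λ) :
    ∑ l ∈ S, f l ≤ 1 := by
  classical
  have h2 : HasSum (Λ.indicator f) 1 := hasSum_subtype_iff_indicator.1 hsum
  calc ∑ l ∈ S, f l = ∑ l ∈ S, Λ.indicator f l :=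
        Finset.sum_congr rfl fun l hl => (Set.indicator_of_mem (hS l hl) _).symm
    _ ≤ 1 := sum_le_hasSum S (fun l _ => Set.indicator_nonneg (fun l _ => hf l) l) h2

/-- A mass defect survives a sequence of enlargements with geometrically decreasing losses. -/
lemma not_hasSum_of_rounds {f : Plane → ℝ} {R : ℕ → ℝ} {q δ : ℝ} {J K : ℕ} (hq0 : 0 < q)
    (hq1 : q < 1) (hK : J / (1 - q) * q ^ K ≤ 1 / 2) (hδ : 0 < δ)
    (hbase : HasMassDefect Λ f (R K) δ) (hR : Tendsto R atTop atTop)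
    (hround : ∀ (k : ℕ) (δ : ℝ), HasMassDefect Λ f (R k) δ →
      HasMassDefect Λ f (R (k + 1)) ((1 - q ^ k) ^ J * δ)) :
    ¬ HasSum (fun l : Λ => f l) 1 := by
  classical
  -- With C(1 - q) = J the quantity C q^k drops by exactly J q^k per round, which dominates the loss
  -- by Bernoulli's inequality. The defect never falls below δ(1 - C q^K) ≥ δ/2.
  obtain ⟨C, hC⟩ : ∃ C : ℝ, C = J / (1 - q) := ⟨_, rfl⟩
  rw [← hC] at hK
  have hC0 : 0 ≤ C := hC ▸ div_nonneg (by positivity) (by linarith)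
  have hJC : (J : ℝ) = C * (1 - q) := by
    rw [hC]
    have : 1 - q ≠ 0 := by linarith
    field_simp
  have hall : ∀ k, K ≤ k → HasMassDefect Λ f (R k) (δ * (1 - C * q ^ K + C * q ^ k)) := by
    intro k hk
    induction k, hk using Nat.le_induction with
    | base => simpa using hbase
    | succ k hk ih =>
      refine (hround k _ ih).mono ?_
      have hqk : q ^ k ≤ q ^ K := pow_le_pow_of_le_one hq0.le hq1.le hk
      have hqk0 : 0 < q ^ k := by positivity
      have hqk1 : q ^ k ≤ 1 := pow_le_one₀ hq0.le hq1.le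
      have hber : 1 - J * q ^ k ≤ (1 - q ^ k) ^ J := by
        have := one_add_mul_le_pow (a := -q ^ k) (by linarith) J
        rw [← sub_eq_add_neg] at this
        linarith
      obtain ⟨B, hB⟩ : ∃ B, B = 1 - C * q ^ K + C * q ^ k := ⟨_, rfl⟩
      rw [← hB]
      have hCq : 0 ≤ C * q ^ k := by positivity
      have hB0 : 0 ≤ B := by linarith
      have hB1 : B ≤ 1 := by nlinarith
      have h3 : (1 - C * q ^ K + C * q ^ (k + 1)) ≤ (1 - J * q ^ k) * B := by
        have h4 : (J : ℝ) * q ^ k * B ≤ J * q ^ k := mul_le_of_le_one_right (by positivity) hB1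
        have h5 : C * q ^ (k + 1) = C * q ^ k - J * q ^ k := by
          rw [hJC, pow_succ]
          ring
        rw [h5]
        linarith
      calc δ * (1 - C * q ^ K + C * q ^ (k + 1)) ≤ δ * ((1 - J * q ^ k) * B) :=
            mul_le_mul_of_nonneg_left h3 hδ.le
        _ ≤ δ * ((1 - q ^ k) ^ J * B) := by gcongr
        _ = (1 - q ^ k) ^ J * (δ * B) := by ring
  intro hsum
  have hfin : ∀ S : Finset Λ, ∑ l ∈ S, f l ≤ 1 - δ / 2 := by
    intro S
    obtain ⟨B, hB⟩ := (S.finite_toSet.image fun l : Λ => |l.1 0|).bddAbove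
    obtain ⟨k, hk1, hk2⟩ := ((hR.eventually_gt_atTop B).and (eventually_ge_atTop K)).exists
    have h2 := hall k hk2 (S.map (Function.Embedding.subtype _)) fun l hl => by
      obtain ⟨l', hl', rfl⟩ := Finset.mem_map.1 hl
      exact ⟨l'.2, (hB ⟨l', hl', rfl⟩).trans_lt hk1⟩
    rw [Finset.sum_map] at h2
    refine h2.trans ?_
    have : 0 ≤ C * q ^ k := by positivity
    nlinarith
  have := hasSum_le_of_sum_le hsum hfin
  linarith

/-- Iterating `HasMassDefect.step` at a fixed rate of decay. -/
lemma HasMassDefect.round (h0 : 0 < ρ) (h1 : ρ < 1) (hp : 0 < p) (hD : D.Nonempty)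
    (hv : 2 ≤ v) (hρ : ρ⁻¹ = u / v)
    (hlarge : ∀ l ∈ Λ, ∀ l' ∈ Λ, l ≠ l' → ∃ k : ℕ, 1 ≤ k ∧
      mask D (shear ρ⁻¹ c (-k) (l - l')) = 0 ∧ (u : ℝ) ^ k ≤ v * (p * |l 0 - l' 0|))
    {s : ℕ} (hs : u ≤ 2 ^ s) {T : ℕ} (hT : 1 ≤ T) {β : ℝ} (hβ0 : 0 ≤ β) (hβ1 : β ≤ 1)
    (hdecay : ∀ ξ : Plane, (u : ℝ) ^ T ≤ |ξ 0| → ‖affineFourier ρ c D ξ‖ ^ 2 ≤ β)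
    {ξ : Plane} (hξ : |ξ 0| ≤ 1) {A : ℕ} (hA : s * (2 + 4 * p) ≤ A) {δ : ℝ}
    (h : HasMassDefect Λ (fun l => ‖affineFourier ρ c D (ξ - l)‖ ^ 2)
      ((u : ℝ) ^ (T * A + 1) / (2 * v * p)) δ) (j : ℕ) :
    HasMassDefect Λ (fun l => ‖affineFourier ρ c D (ξ - l)‖ ^ 2)
      ((u : ℝ) ^ (T * (A + j) + 1) / (2 * v * p)) ((1 - β) ^ j * δ) := by
  induction j with
  | zero => simpa using h
  | succ j ih =>
    have h2 := HasMassDefect.step h0 h1 hp hD hv hρ hlarge hs hT hβ0 hβ1 hdecay hξ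
      (n := T * (A + j)) (by
        calc s * (2 * T + 4 * p) ≤ s * (2 * T + T * (4 * p)) := by
              have := Nat.le_mul_of_pos_left (4 * p) hT
              gcongr
          _ = T * (s * (2 + 4 * p)) := by ring
          _ ≤ T * (A + j) := by gcongr; omega) ih
    have e1 : T * (A + j) + T = T * (A + (j + 1)) := by ring
    have e2 : (1 - β) * ((1 - β) ^ j * δ) = (1 - β) ^ (j + 1) * δ := by ring
    rw [e1, e2] at h2
    exact h2

/-- If `ρ⁻¹ = u / v` in lowest terms is not an integer, there is no spectrum. -/
lemma not_hasSum_of_denominator (h0 : 0 < ρ) (h1 : ρ < 1) (hp : p.Prime)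
    (ha0 : ¬ (p : ℤ) ∣ a 0) (hD : D.Nonempty) (hz : HasLatticeZeros p a D)
    (hcop : u.Coprime v) (hv : 2 ≤ v) (hρ : ρ⁻¹ = u / v)
    (hlarge : ∀ l ∈ Λ, ∀ l' ∈ Λ, l ≠ l' → ∃ k : ℕ, 1 ≤ k ∧
      mask D (shear ρ⁻¹ c (-k) (l - l')) = 0 ∧ (u : ℝ) ^ k ≤ v * (p * |l 0 - l' 0|))
    (hsum : ∀ ξ, HasSum (fun l : Λ => ‖affineFourier ρ c D (ξ - l)‖ ^ 2) 1) : False := by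
  classical
  have hr : 1 < ρ⁻¹ := (one_lt_inv₀ h0).2 h1
  have hvR : (2 : ℝ) ≤ v := by exact_mod_cast hv
  have huv : v < u := by
    rw [hρ, one_lt_div (by linarith)] at hr
    exact_mod_cast hr
  have huR : (1 : ℝ) < u := by exact_mod_cast (by omega : 1 < u)
  have hpR : (0 : ℝ) < p := by exact_mod_cast hp.pos
  obtain ⟨b, hb0, hb1, hmask⟩ := exists_norm_mask_le hp ha0 hD hz
    (η := 1 / (2 * ((u : ℝ) + v))) (by positivity)
  obtain ⟨s, hs⟩ : ∃ s, u ≤ 2 ^ s := ⟨u, (Nat.lt_pow_self (by norm_num)).le⟩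
  have hs1 : 1 ≤ s := by
    by_contra! h
    have : s = 0 := by omega
    subst this
    simp at hs
    omega
  have hdec := norm_affineFourier_le_pow (c := c) h0 h1 hD hcop hv hρ hb0 hmask hs
  -- The threshold exponent grows by the factor t + 1 = 3s for each gain b in the decay. Round k
  -- uses T = (t + 1)^k, and A·t steps carry the radius exponent T·A to (t + 1)·T·A.
  obtain ⟨t, ht⟩ : ∃ t, 3 * s = t + 1 := ⟨3 * s - 1, by omega⟩
  have ht1 : 1 < t + 1 := by omega
  rw [ht] at hdec
  obtain ⟨A, hA⟩ : ∃ A, A = s * (2 + 4 * p) := ⟨_, rfl⟩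
  have hA0 : 0 < A := hA ▸ Nat.mul_pos (by omega) (by omega)
  have hq0 : 0 < b ^ 2 := by positivity
  have hq1 : b ^ 2 < 1 := pow_lt_one₀ hb0.le hb1 two_ne_zero
  -- The number of steps per round is constant while the loss per step is q^k with q = b², so the
  -- losses from round K on total at most one half.
  obtain ⟨K, hK⟩ : ∃ K : ℕ, (A * t : ℕ) / (1 - b ^ 2) * (b ^ 2) ^ K < 1 / 2 := by
    have := (tendsto_pow_atTop_nhds_zero_of_lt_one hq0.le hq1).const_mul
      ((A * t : ℕ) / (1 - b ^ 2))
    rw [mul_zero] at this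
    exact (this.eventually_lt_const (by norm_num)).exists
  obtain ⟨R, hR⟩ : ∃ R : ℕ → ℝ, ∀ k, R k = (u : ℝ) ^ ((t + 1) ^ k * A + 1) / (2 * v * p) :=
    ⟨_, fun _ => rfl⟩
  have hradius : Tendsto R atTop atTop := by
    rw [funext hR]
    exact ((tendsto_pow_atTop_atTop_of_one_lt huR).comp ((tendsto_add_atTop_nat 1).comp
      ((tendsto_pow_atTop_atTop_of_one_lt ht1).atTop_mul_const' hA0))).atTop_div_const
      (by positivity)
  obtain ⟨l₁, hl₁, hl₁R⟩ :=
    exists_mem_le_abs h0 h1 hp ha0 hD hz (by omega) (by omega) hlarge hsum (R K)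
  -- A point l₁ of the spectrum outside the starting radius carries positive mass at ξ, which
  -- provides the initial defect.
  obtain ⟨ξ, hξ1, hξF⟩ := exists_affineFourier_sub_ne_zero (c := c) h0 h1 hD hz
    (by omega) (by omega) hρ l₁
  have hbase : HasMassDefect Λ (fun l => ‖affineFourier ρ c D (ξ - l)‖ ^ 2) (R K)
      (‖affineFourier ρ c D (ξ - l₁)‖ ^ 2) := by
    intro S hS
    have hnot : l₁ ∉ S := fun h => absurd (hS l₁ h).2 (not_lt.2 hl₁R)
    have := sum_le_one_of_hasSum (f := fun l => ‖affineFourier ρ c D (ξ - l)‖ ^ 2)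
      (fun l => by positivity) (hsum ξ) (insert l₁ S) fun l hl => by
        rcases Finset.mem_insert.1 hl with rfl | h
        · exact hl₁
        · exact (hS l h).1
    rw [Finset.sum_insert hnot] at this
    linarith
  refine not_hasSum_of_rounds (f := fun l => ‖affineFourier ρ c D (ξ - l)‖ ^ 2) hq0 hq1 hK.le (by positivity) hbase hradius
    (fun k δ hδ => ?_) (hsum ξ)
  rw [hR] at hδ ⊢
  have h2 := hδ.round h0 h1 hp.pos hD hv hρ hlarge hs (Nat.one_le_pow _ _ (by omega))
    (β := (b ^ 2) ^ k) (by positivity) (pow_le_one₀ hq0.le hq1.le) (fun η hη => by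
      rw [← pow_mul, mul_comm, pow_mul]
      exact pow_le_pow_left₀ (norm_nonneg _) (hdec k η hη) 2) hξ1 hA.ge (A * t)
  rwa [show (t + 1) ^ k * (A + A * t) = (t + 1) ^ (k + 1) * A by ring] at h2

end NonIntegral

/-! ### The criterion and the example -/

/-- Spectrality forces `ρ⁻¹ ∈ pℤ` and an admissible off-diagonal entry. -/
lemma integrality_of_isSpectralMeasure {p : ℕ} {ρ c : ℝ} {a : Fin 2 → ℤ}
    {D : Finset (Fin 2 → ℤ)} (h0 : 0 < ρ) (h1 : ρ < 1) (hp : p.Prime) (ha0 : ¬ (p : ℤ) ∣ a 0)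
    (hD : D.Nonempty) (hz : HasLatticeZeros p a D)
    (h : IsSpectralMeasure (selfAffineMeasure (triMatrix ρ ρ c) D)) :
    (∃ m : ℤ, ρ⁻¹ = (p : ℝ) * (m : ℝ)) ∧ c ∈ admissibleEntries p := by
  have := isProbabilityMeasure_selfAffineMeasure (c := c) h0 h1 hD
  obtain ⟨Λ, horth, hsum⟩ := exists_hasSum_of_isSpectralMeasure _ h
  obtain ⟨hc, u, v, hcop, hv0, hpu, hρ, hlarge⟩ :=
    exists_rational_of_spectrum h0 h1 hp ha0 hD hz horth hsum
  refine ⟨?_, hc⟩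
  obtain hv | rfl : 2 ≤ v ∨ v = 1 := by omega
  · exact (not_hasSum_of_denominator h0 h1 hp ha0 hD hz hcop hv hρ hlarge hsum).elim
  · obtain ⟨m, rfl⟩ := hpu
    exact ⟨m, by rw [hρ]; push_cast; simp⟩

lemma isSpectralMeasure_iff_integrality {p : ℕ} {ρ c : ℝ} {a : Fin 2 → ℤ}
    {D : Finset (Fin 2 → ℤ)} (h0 : 0 < ρ) (h1 : ρ < 1) (hp : p.Prime) (ha0 : ¬ (p : ℤ) ∣ a 0)
    (hcard : D.card = p) (hz : HasLatticeZeros p a D) :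
    IsSpectralMeasure (selfAffineMeasure (triMatrix ρ ρ c) D) ↔
      (∃ m : ℤ, ρ⁻¹ = (p : ℝ) * (m : ℝ)) ∧ c ∈ admissibleEntries p := by
  refine ⟨integrality_of_isSpectralMeasure h0 h1 hp ha0
    (Finset.card_pos.1 (hcard ▸ hp.pos)) hz, ?_⟩
  rintro ⟨⟨m, hm⟩, ⟨t, s, hs, hpt, hts, hc⟩ | hc⟩
  · exact isSpectralMeasure_of_integrality hp h0 h1 hcard ha0 hz hm hs hpt hts hc
  -- The value c = 0 is the fraction 0/1.
  · exact isSpectralMeasure_of_integrality hp h0 h1 hcard ha0 hz hm one_ne_zero (dvd_zero _)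
      (Int.gcd_one_right 0) (by simpa using hc)

/-- Three unit vectors with sum zero, one of them being `1`, are the cube roots of unity. -/
lemma exp_add_exp_eq_neg_one_iff (x y : ℝ) :
    1 + Complex.exp (-2 * Real.pi * Complex.I * (x : ℂ)) +
        Complex.exp (-2 * Real.pi * Complex.I * (y : ℂ)) = 0 ↔
      ∃ z w : ℤ, ¬ (3 : ℤ) ∣ z ∧ (3 : ℤ) ∣ w - 2 * z ∧ x = z / 3 ∧ y = w / 3 := by
  set E : ℝ → ℂ := fun x => Complex.exp (-2 * Real.pi * Complex.I * (x : ℂ)) with hE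
  have hadd : ∀ x y, E (x + y) = E x * E y := fun x y => by
    simp only [hE, ← Complex.exp_add]; push_cast; ring_nf
  have hone : ∀ x, E x = 1 ↔ ∃ n : ℤ, x = n := fun x => by
    simp only [hE, Complex.exp_eq_one_iff]
    have h2 : (2 * Real.pi * Complex.I : ℂ) ≠ 0 := Complex.two_pi_I_ne_zero
    constructor
    · rintro ⟨n, hn⟩
      refine ⟨-n, ?_⟩
      have : (x : ℂ) = -n := by
        apply mul_left_cancel₀ h2
        linear_combination -hn
      exact_mod_cast this
    · rintro ⟨n, rfl⟩
      exact ⟨-n, by push_cast; ring⟩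
  have hcube : ∀ x, E (3 * x) = E x ^ 3 := fun x => by
    rw [show 3 * x = x + (x + x) by ring, hadd, hadd]; ring
  have hdbl : ∀ x, E (2 * x) = E x ^ 2 := fun x => by
    rw [two_mul, hadd]; ring
  have hsub : ∀ x y, E x = E y ↔ ∃ n : ℤ, x - y = n := fun x y => by
    have h : E x = E (x - y) * E y := by rw [← hadd, sub_add_cancel]
    rw [← hone, h, mul_eq_right₀ (Complex.exp_ne_zero _)]
  have hnorm : ∀ x, E x * (starRingEnd ℂ) (E x) = 1 := fun x => by
    rw [Complex.mul_conj, Complex.normSq_eq_norm_sq]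
    simp only [hE]
    rw [show (-2 * Real.pi * Complex.I * (x : ℂ)) = ((-2 * Real.pi * x : ℝ) : ℂ) * Complex.I by
      push_cast; ring, Complex.norm_exp_ofReal_mul_I]
    norm_num
  change 1 + E x + E y = 0 ↔ _
  constructor
  · intro h
    have hx2 := hnorm x
    have hy2 := hnorm y
    have hyE : E y = -1 - E x := by linear_combination h
    -- Substituting E(y) = -1 - E(x) into |E(y)| = 1 leaves the equation of the primitive cube roots
    -- of unity.
    have hquad : 1 + E x + E x ^ 2 = 0 := by
      rw [hyE] at hy2
      simp only [map_sub, map_neg, map_one] at hy2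
      linear_combination E x * hy2 - (1 + E x) * hx2
    have h3 : E (3 * x) = 1 := by
      rw [hcube]; linear_combination (E x - 1) * hquad
    obtain ⟨z, hz⟩ := (hone _).1 h3
    have hyx : E y = E (2 * x) := by rw [hdbl]; linear_combination hyE - hquad
    obtain ⟨n, hn⟩ := (hsub _ _).1 hyx
    refine ⟨z, 2 * z + 3 * n, ?_, ⟨n, by ring⟩, by linarith, by push_cast; linarith⟩
    rintro ⟨k, rfl⟩
    have : E x = 1 := (hone x).2 ⟨k, by push_cast at hz; linarith⟩
    rw [this] at hquad
    norm_num at hquad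
  · rintro ⟨z, w, hz, ⟨n, hn⟩, hx, hy⟩
    have hyx : E y = E (2 * x) := by
      refine (hsub _ _).2 ⟨n, ?_⟩
      have : (w : ℝ) - 2 * z = 3 * n := by exact_mod_cast hn
      rw [hx, hy]
      linarith
    have h3 : E x ^ 3 = 1 := by
      rw [← hcube]
      exact (hone _).2 ⟨z, by rw [hx]; ring⟩
    have hx1 : E x - 1 ≠ 0 := fun h => by
      obtain ⟨n, hn⟩ := (hone x).1 (sub_eq_zero.1 h)
      refine hz ⟨n, ?_⟩
      have : (z : ℝ) = 3 * n := by linarith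
      exact_mod_cast this
    rw [hyx, hdbl]
    apply mul_left_cancel₀ hx1
    linear_combination h3

lemma zeroSet_simplex_digits :
    zeroSet (measureFourier (digitMeasure {![0, 0], ![1, 0], ![0, 1]})) =
      latticeCosets 3 ![1, 2] := by
  have hc : ({![0, 0], ![1, 0], ![0, 1]} : Finset (Fin 2 → ℤ)).card = 3 := by decide
  ext ξ
  rw [mem_latticeCosets_iff Nat.prime_three (by intro i; fin_cases i <;> simp)]
  change measureFourier _ ξ = 0 ↔ _
  have hm : mask {![0, 0], ![1, 0], ![0, 1]} ξ =
      3⁻¹ * (1 + Complex.exp (-2 * Real.pi * Complex.I * (ξ 0 : ℂ)) +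
        Complex.exp (-2 * Real.pi * Complex.I * (ξ 1 : ℂ))) := by
    rw [mask, hc, Finset.sum_insert (by decide), Finset.sum_insert (by decide),
      Finset.sum_singleton]
    simp [expFun, digitVec, dotProduct, Fin.sum_univ_two, add_assoc]
  rw [measureFourier_digitMeasure, hm, mul_eq_zero_iff_left (by norm_num),
    exp_add_exp_eq_neg_one_iff]
  constructor
  · rintro ⟨z, w, hz, hw, hx, hy⟩
    exact ⟨![z, w], by simpa using hz, by simpa using hw, fun i => by
      fin_cases i <;> simpa⟩
  · rintro ⟨z, hz, hw, h⟩
    exact ⟨z 0, z 1, by simpa using hz, by simpa using hw, by simpa using h 0, by simpa using h 1⟩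

/-- The criterion for planar Sierpinski-type self-affine measures with equal contraction ratios,
and the explicit measure showing that spectrality does not force `p κ ∈ ℤ` when `c = κ ρ⁻¹`. -/
theorem theorem1p5 :
    (∀ (p : ℕ) (_ : p.Prime) (ρ c : ℝ) (_ : 0 < ρ) (_ : ρ < 1)
        (D : Finset (Fin 2 → ℤ)) (_ : D.card = p)
        (a : Fin 2 → ℤ) (_ : ∀ i, 1 ≤ a i ∧ a i ≤ (p : ℤ) - 1)
        (_ : zeroSet (measureFourier (digitMeasure D)) = latticeCosets p a),
      IsSpectralMeasure (selfAffineMeasure (triMatrix ρ ρ c) D) ↔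
        (∃ m : ℤ, ρ⁻¹ = (p : ℝ) * (m : ℝ)) ∧ c ∈ admissibleEntries p) ∧
    (zeroSet (measureFourier (digitMeasure {![0, 0], ![1, 0], ![0, 1]})) =
        latticeCosets 3 ![1, 2] ∧
      IsSpectralMeasure
        (selfAffineMeasure (triMatrix (1 / 6) (1 / 6) (3 / 4)) {![0, 0], ![1, 0], ![0, 1]}) ∧
      ∀ κ : ℝ, (3 / 4 : ℝ) = κ * (1 / 6 : ℝ)⁻¹ → ¬ ∃ n : ℤ, (3 : ℝ) * κ = (n : ℝ)) := by
  have ha0 : ∀ (p : ℕ) (a : Fin 2 → ℤ), (∀ i, 1 ≤ a i ∧ a i ≤ (p : ℤ) - 1) → ¬ (p : ℤ) ∣ a 0 :=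
    fun p a ha h => by
      have := Int.le_of_dvd (by linarith [(ha 0).1]) h
      linarith [(ha 0).2]
  have ha : ∀ i, 1 ≤ (![1, 2] : Fin 2 → ℤ) i ∧ (![1, 2] : Fin 2 → ℤ) i ≤ ((3 : ℕ) : ℤ) - 1 := by
    intro i
    fin_cases i <;> simp
  refine ⟨fun p hp ρ c h0 h1 D hcard a ha hz => isSpectralMeasure_iff_integrality h0 h1 hp
    (ha0 p a ha) hcard (hasLatticeZeros_of_zeroSet_eq hp ha hz), zeroSet_simplex_digits,
    (isSpectralMeasure_iff_integrality (by norm_num) (by norm_num) Nat.prime_three (ha0 3 _ ha)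
      (by decide) (hasLatticeZeros_of_zeroSet_eq Nat.prime_three ha zeroSet_simplex_digits)).2
      ⟨⟨2, by norm_num⟩, Or.inl ⟨3, 4, by norm_num, by norm_num, by decide, by norm_num⟩⟩,
    fun κ hκ => ?_⟩
  -- Here κ = 1/8, and 3/8 is not an integer.
  rintro ⟨n, hn⟩
  have h8 : (8 * n : ℝ) = 3 := by
    rw [← hn]
    linarith
  have : 8 * n = 3 := by exact_mod_cast h8
  omega
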